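/- **Setting.** Let $I$ be a positive definite symmetric $3\times 3$ matrix, $m,r>0$ and $\rho=mr^2$. The motion of Chaplygin's sphere (mass $m$, radius $r$, moment of inertia tensor $I$, center of mass at the center, rolling without slipping on a horizontal plane) is described by $(A,\omega,p)\in \mathrm{SO}(3)\times\mathbf R^3\times\mathbf R^2$ with $$\dot A\,z=A(\omega\times z)\quad(z\in\mathbf R^3),\qquad I\dot\omega-(I\omega)\times\omega=\rho\,(\langle u,\dot\omega\rangle u-\dot\omega),\qquad \dot p=r\,(A\omega)\times e_3,\qquad u:=A^{-1}e_3 .$$ The equations for $(A,\omega)$ describe the rotational motion; together with $\dot u=u\times\omega$, the equation for $\omega$ gives the $\mathrm E(2)$-reduced system for $(u,\omega)\in S^2\times\mathbf R^3$. Put $I_{\rho,u}\,\omega=(I+\rho)\omega-\rho\langle u,\omega\rangle u$. The moment of momentum about the contact point, $j=A\,I_{\rho,u}\,\omega$, and the kinetic energy $T=\frac12\langle I\omega,\omega\rangle+\frac12\rho\|u\times\omega\|^2$ are constants of motion. For fixed $j$ let $T_j$ be the function on $\mathrm{SO}(3)$ given by $T_j(A)=T(A,\omega)$ with $\omega=I_{\rho,u}^{-1}A^{-1}j$.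 The motion in an open subset $M$ of a phase space is *quasi-periodic on analytic $n$-tori, depending analytically on parameters $\varepsilon\in E$* ($E$ open in $\mathbf R^s$) if there are an analytic diffeomorphism $\Phi:(\mathbf R^n/\mathbf Z^n)\times E\to M$ and an analytic $\nu:E\to\mathbf R^n$ such that $t\mapsto\Phi(x+t\,\nu(\varepsilon),\varepsilon)$ is a solution for all $x$ and $\varepsilon$. **Proposition.** Let $j=j_3e_3$ be vertical, and let $T$ be a regular value of $T_j$. 1. Each solution of the $\mathrm E(2)$-reduced system on the corresponding level set in the $(u,\omega)$-space is periodic, with a positive minimal period. 2. The rotational motion is quasi-periodic on analytic 2-tori depending analytically on $j$ and $T$: for each $(A_0,\omega_0)$ with moment $j_3e_3$ and energy $T$ there are an open neighborhood $E$ of $(j_3,T)$ in $\mathbf R^2$ and a neighborhood $M$ of $(A_0,\omega_0)$, open in the set of all $(A,\omega)$ with vertical moment, on which the motion is quasi-periodic on analytic 2-tori with parameters $\varepsilon\in E$ as above, where the torus $\Phi(\cdot,\varepsilon)$ lies in the level set with moment $\varepsilon_1e_3$ and energy $\varepsilon_2$. The solution starting at $(A_0,\omega_0)$ is $t\mapsto\Phi(x_0+t\,\nu(j_3,T),(j_3,T))$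 for some $x_0$. 3. Let $(A(t),\omega(t),p(t))$ be a solution of the full system with moment $j_3e_3$ and energy $T$, and let $P$ be the minimal period of $(u(t),\omega(t))$. Suppose that $(A(t),\omega(t))$ is not periodic with period $P$. Then the full motion is quasi-periodic on analytic 2-tori depending analytically on $j$ and $T$: there are an open neighborhood $E$ of $(j_3,T)$, an analytic map $\Phi$ from $(\mathbf R^2/\mathbf Z^2)\times E$ to $\mathrm{SO}(3)\times\mathbf R^3\times\mathbf R^2$ and an analytic $\nu:E\to\mathbf R^2$ such that, with additional translation parameter $c\in\mathbf R^2$, the map $(x,(\varepsilon,c))\mapsto\Phi(x,\varepsilon)+(0,0,c)$ is an analytic diffeomorphism from $(\mathbf R^2/\mathbf Z^2)\times(E\times\mathbf R^2)$ onto an open subset of the set of all $(A,\omega,p)$ with vertical moment, $t\mapsto\Phi(x+t\,\nu(\varepsilon),\varepsilon)+(0,0,c)$ is a solution of the full system for all $x,\varepsilon,c$, with moment $\varepsilon_1e_3$ and energy $\varepsilon_2$, and $(A(t),\omega(t),p(t))=\Phi(x_0+t\,\nu(j_3,T),(j_3,T))+(0,0,c_0)$ for some $x_0,c_0$ and all $t$.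 In particular $p(t)$ stays in a bounded subset of the plane. 4. If, in the situation of 3, $(A(t),\omega(t))$ is periodic with the period $P$, then $p(t)=t\,w+q(t)$ for a constant vector $w\in\mathbf R^2$ and a function $q$ which is periodic with period $P$. -/

import Mathlib

open Matrix

attribute [local instance] Matrix.normedAddCommGroup Matrix.normedSpace

namespace ChaplyginSphere

/-- Vectors of `ℝ³`, in coordinates. -/
abbrev Vec : Type := Fin 3 → ℝ

/-- Vectors of the horizontal plane `ℝ²`. -/
abbrev Plane : Type := Fin 2 → ℝ

/-- Real `3 × 3` matrices. -/
abbrev Mat : Type := Matrix (Fin 3) (Fin 3) ℝ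

/-- The vertical unit vector. -/
def e₃ : Vec := ![0, 0, 1]

/-- `SO(3)` as a subset of the space of matrices. -/
def SO3 : Set Mat := {A | Aᵀ * A = 1 ∧ A.det = 1}

/-- The antisymmetric matrix of the linear map `z ↦ ω × z`. -/
def hat (ω : Vec) : Mat :=
  !![0, -ω 2, ω 1; ω 2, 0, -ω 0; -ω 1, ω 0, 0]

theorem hat_mulVec (ω z : Vec) : hat ω *ᵥ z = ω ⨯₃ z := by
  ext i
  fin_cases i <;> simp [hat, cross_apply, Matrix.mulVec, dotProduct, Fin.sum_univ_three] <;> ring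

/-- `u = A⁻¹ e₃`, the vertical direction in body coordinates (for `A ∈ SO(3)` the inverse is the
transpose). -/
def vert (A : Mat) : Vec := Aᵀ *ᵥ e₃

/-- The symmetric matrix `I_{ρ,u} ω = (I + ρ) ω - ρ ⟨u, ω⟩ u`. -/
def inertiaAt (I : Mat) (ρ : ℝ) (u : Vec) : Mat :=
  I + ρ • (1 : Mat) - ρ • vecMulVec u u

/-- The moment of momentum about the point of contact, `j = A I_{ρ,u} ω` with `u = A⁻¹ e₃`. -/
def moment (I : Mat) (ρ : ℝ) (A : Mat) (ω : Vec) : Vec :=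
  A *ᵥ (inertiaAt I ρ (vert A) *ᵥ ω)

/-- The kinetic energy `T = ½ ⟨I ω, ω⟩ + ½ ρ ‖u × ω‖²`. -/
noncomputable def energy (I : Mat) (ρ : ℝ) (u ω : Vec) : ℝ :=
  1 / 2 * ((I *ᵥ ω) ⬝ᵥ ω) + 1 / 2 * ρ * ((u ⨯₃ ω) ⬝ᵥ (u ⨯₃ ω))

/-- The angular velocity `ω_j(A) = I_{ρ,u}⁻¹ A⁻¹ j`, the unique `ω` for which `(A, ω)` has
moment `j`. -/
noncomputable def omegaOf (I : Mat) (ρ : ℝ) (j : Vec) (A : Mat) : Vec :=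
  (inertiaAt I ρ (vert A))⁻¹ *ᵥ (Aᵀ *ᵥ j)

/-- The function `T_j` on `SO(3)`: the kinetic energy on the level set of the moment `j`. -/
noncomputable def energyOn (I : Mat) (ρ : ℝ) (j : Vec) (A : Mat) : ℝ :=
  energy I ρ (vert A) (omegaOf I ρ j A)

/-- `T` is a regular value of `T_j : SO(3) → ℝ`: at each point `A` of the level set, the derivative
of `T_j` in the direction of some tangent vector `A ∘ hat ν` of `SO(3)` is nonzero. -/
def IsRegularValue (I : Mat) (ρ : ℝ) (j : Vec) (T : ℝ) : Prop :=
  ∀ A ∈ SO3, energyOn I ρ j A = T →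
    ∃ ν : Vec, deriv (fun s : ℝ => energyOn I ρ j (A * NormedSpace.exp (s • hat ν))) 0 ≠ 0

/-- The common level set of the constants of motion `j` and `T` in the `(A, ω)`-space. -/
def levelSet (I : Mat) (ρ : ℝ) (j : Vec) (T : ℝ) : Set (Mat × Vec) :=
  {z | z.1 ∈ SO3 ∧ moment I ρ z.1 z.2 = j ∧ energy I ρ (vert z.1) z.2 = T}

/-- The projection `(A, ω) ↦ (u, ω)`, `u = A⁻¹ e₃`, onto the `E(2)`-reduced phase space. -/
def reduce (z : Mat × Vec) : Vec × Vec := (vert z.1, z.2)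

/-- The states of the rotational motion with vertical moment. -/
def verticalRot (I : Mat) (ρ : ℝ) : Set (Mat × Vec) :=
  {z | z.1 ∈ SO3 ∧ ∃ h : ℝ, moment I ρ z.1 z.2 = h • e₃}

/-- The states `(A, ω, p)` of the full system with vertical moment. -/
def verticalFull (I : Mat) (ρ : ℝ) : Set (Mat × Vec × Plane) :=
  {z | (z.1, z.2.1) ∈ verticalRot I ρ}

/-- The dynamical equation
`I dω/dt - (I ω) × ω = ρ (⟨u, dω/dt⟩ u - dω/dt)`, with `ω' = dω/dt`. -/
def DynamicalEq (I : Mat) (ρ : ℝ) (u ω ω' : Vec) : Prop :=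
  I *ᵥ ω' - (I *ᵥ ω) ⨯₃ ω = ρ • ((u ⬝ᵥ ω') • u - ω')

/-- Solutions `t ↦ (u, ω)` of the `E(2)`-reduced system in `S² × ℝ³`. -/
def IsReducedSolution (I : Mat) (ρ : ℝ) (γ : ℝ → Vec × Vec) : Prop :=
  ∀ t, (γ t).1 ⬝ᵥ (γ t).1 = 1 ∧
    ∃ ω' : Vec, HasDerivAt γ ((γ t).1 ⨯₃ (γ t).2, ω') t ∧ DynamicalEq I ρ (γ t).1 (γ t).2 ω'

/-- Solutions `t ↦ (A, ω)` of the rotational motion in `SO(3) × ℝ³`. -/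
def IsRotSolution (I : Mat) (ρ : ℝ) (γ : ℝ → Mat × Vec) : Prop :=
  ∀ t, (γ t).1 ∈ SO3 ∧
    ∃ ω' : Vec, HasDerivAt γ ((γ t).1 * hat (γ t).2, ω') t ∧
      DynamicalEq I ρ (vert (γ t).1) (γ t).2 ω'

/-- The velocity `r (A ω) × e₃` of the point of contact, as a vector of the horizontal plane. -/
def contactVelocity (r : ℝ) (A : Mat) (ω : Vec) : Plane :=
  ![(r • ((A *ᵥ ω) ⨯₃ e₃)) 0, (r • ((A *ᵥ ω) ⨯₃ e₃)) 1]

/-- Solutions `t ↦ (A, ω, p)` of the full system in `SO(3) × ℝ³ × ℝ²`, for a sphere of mass `m`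
and radius `r`. -/
def IsFullSolution (I : Mat) (m r : ℝ) (γ : ℝ → Mat × Vec × Plane) : Prop :=
  ∀ t, (γ t).1 ∈ SO3 ∧
    ∃ ω' : Vec, HasDerivAt γ ((γ t).1 * hat (γ t).2.1, ω', contactVelocity r (γ t).1 (γ t).2.1) t ∧
      DynamicalEq I (m * r ^ 2) (vert (γ t).1) (γ t).2.1 ω'

/-- `P` is the minimal period of the (nonconstant) periodic motion `f`. -/
def IsMinimalPeriod {X : Type*} (f : ℝ → X) (P : ℝ) : Prop :=
  0 < P ∧ Function.Periodic f P ∧ ∀ Q, 0 < Q → Q < P → ¬ Function.Periodic f Q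

/-- The motion in an open subset `M` of the phase space `V` is quasiperiodic on analytic
`n`-dimensional tori, with analytic dependence on the parameters `ε ∈ E`.

The analytic diffeomorphism `(ℝⁿ/ℤⁿ) × E → M` is given by its lift `Φ` to `ℝⁿ × E`: an analytic
immersion which is `ℤⁿ`-periodic in the first variable, injective modulo `ℤⁿ`, and whose image `M`
is open in `V`. (It is used with `V` a submanifold of dimension `n + dim E` near `M`, so that the
induced bijection onto `M` is a local diffeomorphism.)
The pullback of the velocity field is the constant field `ν ε` on each torus. -/
structure IsQuasiperiodicFamily {S Q : Type*} [NormedAddCommGroup S] [NormedSpace ℝ S]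
    [NormedAddCommGroup Q] [NormedSpace ℝ Q] {n : ℕ} (V : Set S) (IsSol : (ℝ → S) → Prop)
    (E : Set Q) (Φ : (Fin n → ℝ) × Q → S) (ν : Q → Fin n → ℝ) : Prop where
  isOpen_param : IsOpen E
  analytic_map : AnalyticOnNhd ℝ Φ (Set.univ ×ˢ E)
  analytic_freq : AnalyticOnNhd ℝ ν E
  eq_iff : ∀ x y : Fin n → ℝ, ∀ ε ∈ E, ∀ δ ∈ E,
    Φ (x, ε) = Φ (y, δ) ↔ ε = δ ∧ ∃ k : Fin n → ℤ, ∀ i, x i = y i + k i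
  immersion : ∀ x : Fin n → ℝ, ∀ ε ∈ E, Function.Injective (fderiv ℝ Φ (x, ε))
  isOpen_image : ∃ U : Set S, IsOpen U ∧ Φ '' (Set.univ ×ˢ E) = U ∩ V
  motion : ∀ x : Fin n → ℝ, ∀ ε ∈ E, IsSol (fun t : ℝ => Φ (x + t • ν ε, ε))

/-- The family of tori in the full phase space obtained from `Φ` by all horizontal translations
`c ∈ ℝ²`. -/
def translates {n : ℕ} (Φ : (Fin n → ℝ) × (ℝ × ℝ) → Mat × Vec × Plane) :
    (Fin n → ℝ) × ((ℝ × ℝ) × Plane) → Mat × Vec × Plane :=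
  fun z => Φ (z.1, z.2.1) + (0, 0, z.2.2)

end ChaplyginSphere

/-! Let `B` be the inverse of `I + ρ`. If the moment is `j e₃`, the relation `I_{ρ,u} ω = j u` gives
`ω = κ B u`, and both `κ` and `c = ⟨u, B u⟩` are functions of `(j, T)` alone
(`IsInertiaInverse.mem_levelSet_iff`). The reduced motion is therefore `u' = κ u × B u` on the curve
`⟨u, B u⟩ = c` of the unit sphere, as for a free rigid body. Regularity of `T` forces `j ≠ 0` and
keeps `c` away from the eigenvalues of `B`, so the curve consists of two ovals around a principal
axis, without rest points (`IsInertiaInverse.exists_axis`). These ovals have an explicit analytic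
parametrization (`isLevelCurve`), and an integration followed by an inversion makes the phase
proportional to time (`exists_uniform_phase`).

The vertical `u` determines `A` up to a rotation about `e₃`. A moving frame built from `u` and `u ×
B u` fixes this freedom along an oval, and the angle between it and the true motion is a single
integral (`IsLevelCurve.exists_isTrajectoryFamily`). After one period `A` returns up to a rotation
by `2 π θ`. All rotations of the trajectory sweep out a torus, and the shear by `θ` turns the motion
on it into a linear flow. Solutions are thus constructed by quadratures; uniqueness identifies them
with the given ones.

The velocity of the contact point turns with the trajectory, so one period acts on its position by a
rotation `R` by `2 π θ` followed by a translation. If `R ≠ 1`, this map has a fixed point; measured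
from there, the position is merely rotated in each period and is a function on the same torus
(`IsTrajectoryFamily.exists_isContactFamily`). If `R = 1`, the rotational motion is periodic with
the reduced period, and the constant displacement per period is the drift. -/

/-! ### Analytic dependence of integrals and inverse functions on parameters -/

-- Since `L τ` does not increase norms, the terms of the series at `L τ y` are dominated by `‖p n‖ *
-- ‖y‖ ^ n` uniformly in `τ`. Summation and integration commute, with no loss of radius.
open scoped ENNReal NNReal Topology in
theorem HasFPowerSeriesOnBall.integral_comp_linear {G V : Type*} [NormedAddCommGroup G]
    [NormedSpace ℝ G] [NormedAddCommGroup V] [NormedSpace ℝ V] [CompleteSpace V] {F : G → V}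
    {p : FormalMultilinearSeries ℝ G V} {y₀ : G} {R : ℝ≥0∞} (hF : HasFPowerSeriesOnBall F p y₀ R)
    {L : ℝ → G →L[ℝ] G} (hL : Continuous L) (hL1 : ∀ τ ∈ Set.Icc (0 : ℝ) 1, ‖L τ‖ ≤ 1) :
    HasFPowerSeriesOnBall (fun y => ∫ τ in (0 : ℝ)..1, F (y₀ + L τ (y - y₀)))
      (fun n => ∫ τ in (0 : ℝ)..1, (p n).compContinuousLinearMap fun _ => L τ) y₀ R := by
  have hcont : ∀ n, Continuous fun τ => (p n).compContinuousLinearMap fun _ => L τ := fun n =>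
    ((p n).compContinuousLinearMapLRight (E := fun _ => G)).cont.comp
      (continuous_pi fun _ => hL)
  have hIoc : ∀ τ ∈ Set.uIoc (0 : ℝ) 1, ‖L τ‖ ≤ 1 := by
    intro τ hτ
    rw [Set.uIoc_of_le zero_le_one] at hτ
    exact hL1 τ ⟨hτ.1.le, hτ.2⟩
  refine ⟨?_, hF.r_pos, ?_⟩
  · refine hF.r_le.trans (FormalMultilinearSeries.radius_le_of_le fun n => ?_)
    refine (intervalIntegral.norm_integral_le_of_norm_le_const (C := ‖p n‖) fun τ hτ => ?_).trans
      (by simp)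
    refine ((p n).norm_compContinuousLinearMap_le _).trans ?_
    exact mul_le_of_le_one_right (norm_nonneg _)
      (Finset.prod_le_one (fun _ _ => norm_nonneg _) fun _ _ => hIoc τ hτ)
  · intro y hy
    have hsum : Summable fun n => ‖p n‖ * ‖y‖ ^ n := by
      have hy' : ((‖y‖₊ : ℝ≥0) : ℝ≥0∞) < p.radius := by
        refine lt_of_lt_of_le ?_ hF.r_le
        simpa [enorm_eq_nnnorm] using hy
      simpa using p.summable_norm_mul_pow hy'
    have key : HasSum (fun n => ∫ τ in (0 : ℝ)..1, p n fun _ => L τ y)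
        (∫ τ in (0 : ℝ)..1, F (y₀ + L τ y)) := by
      refine intervalIntegral.hasSum_integral_of_dominated_convergence
        (fun n _ => ‖p n‖ * ‖y‖ ^ n) ?_ ?_ ?_ ?_ ?_
      · intro n
        refine Continuous.aestronglyMeasurable ?_
        exact (p n).cont.comp (continuous_pi fun _ => hL.clm_apply continuous_const)
      · refine fun n => Filter.Eventually.of_forall fun τ hτ => ?_
        refine ((p n).le_opNorm _).trans ?_
        simp only [Finset.prod_const, Finset.card_univ, Fintype.card_fin]
        gcongr
        exact (L τ).le_of_opNorm_le_of_le (hIoc τ hτ) le_rfl |>.trans (by simp)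
      · exact Filter.Eventually.of_forall fun _ _ => hsum
      · exact intervalIntegrable_const
      · refine Filter.Eventually.of_forall fun τ hτ => hF.hasSum ?_
        have h1 : ‖L τ y‖ ≤ ‖y‖ :=
          (L τ).le_of_opNorm_le_of_le (hIoc τ hτ) le_rfl |>.trans (by simp)
        simp only [Metric.mem_eball, edist_zero_right] at hy ⊢
        refine lt_of_le_of_lt ?_ hy
        rw [enorm_le_iff_norm_le]
        exact h1
    convert key using 1
    · ext n
      have h2 : ∫ τ in (0 : ℝ)..1, (ContinuousMultilinearMap.apply ℝ (fun _ : Fin n => G) V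
          fun _ => y) ((p n).compContinuousLinearMap fun _ => L τ) = _ :=
        ContinuousLinearMap.intervalIntegral_comp_comm _ ((hcont n).intervalIntegrable 0 1)
      exact h2.symm
    · simp

section ParametricIntegral

variable {Q V : Type*} [NormedAddCommGroup Q] [NormedSpace ℝ Q] [NormedAddCommGroup V]
  [NormedSpace ℝ V]

theorem AnalyticOnNhd.continuous_slice {E : Set Q} {F : ℝ × Q → V}
    (hF : AnalyticOnNhd ℝ F (Set.univ ×ˢ E)) {ε : Q} (hε : ε ∈ E) : Continuous fun s => F (s, ε) :=
  continuous_iff_continuousAt.2 fun s =>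
    (hF (s, ε) ⟨trivial, hε⟩).continuousAt.comp (f := fun s => (s, ε)) (by fun_prop)

variable [CompleteSpace V]

/-- The substitution `s = s₀ + τ (z.1 - s₀)` turns the primitive into `z.1 - s₀` times an integral
over `[0, 1]` of `F` composed with the contractions `(a, q) ↦ (τ a, q)` about the base point. -/
theorem AnalyticAt.parametric_primitive_self {F : ℝ × Q → V} {s₀ : ℝ} {ε₀ : Q}
    (hF : AnalyticAt ℝ F (s₀, ε₀)) :
    AnalyticAt ℝ (fun z : ℝ × Q => ∫ s in s₀..z.1, F (s, z.2)) (s₀, ε₀) := by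
  obtain ⟨p, R, hp⟩ := hF
  let L : ℝ → (ℝ × Q) →L[ℝ] (ℝ × Q) := fun τ =>
    τ • (ContinuousLinearMap.inl ℝ ℝ Q).comp (ContinuousLinearMap.fst ℝ ℝ Q) +
      (ContinuousLinearMap.inr ℝ ℝ Q).comp (ContinuousLinearMap.snd ℝ ℝ Q)
  have hLapp : ∀ τ z, L τ z = (τ * z.1, z.2) := fun τ z => by simp [L]
  have hL : Continuous L := by fun_prop
  have hL1 : ∀ τ ∈ Set.Icc (0 : ℝ) 1, ‖L τ‖ ≤ 1 := by
    intro τ hτ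
    refine ContinuousLinearMap.opNorm_le_bound _ zero_le_one fun z => ?_
    rw [hLapp, one_mul, Prod.norm_def, Prod.norm_def, norm_mul, Real.norm_of_nonneg hτ.1]
    exact max_le_max (mul_le_of_le_one_left (norm_nonneg _) hτ.2) le_rfl
  have h1 : AnalyticAt ℝ _ (s₀, ε₀) := ⟨_, R, hp.integral_comp_linear hL hL1⟩
  have h2 : AnalyticAt ℝ (fun z : ℝ × Q => z.1 - s₀) (s₀, ε₀) :=
    analyticAt_fst.sub analyticAt_const
  refine (h2.smul h1).congr (Filter.Eventually.of_forall fun z => ?_)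
  have h3 := intervalIntegral.smul_integral_comp_add_mul (a := 0) (b := 1)
    (fun s => F (s, z.2)) (z.1 - s₀) s₀
  simp only [mul_zero, add_zero, mul_one, add_sub_cancel] at h3
  simp only [Pi.smul_apply', ← h3, hLapp]
  congr 1
  refine intervalIntegral.integral_congr fun τ _ => ?_
  simp [mul_comm]

variable {F : ℝ × Q → V} {E : Set Q}

/-- Analyticity in the parameter propagates along the endpoint, starting from `0`. The endpoints at
which it holds form a set that is open and closed, because integrals over short intervals are
analytic. -/
theorem AnalyticOnNhd.parametric_primitive (hE : IsOpen E)
    (hF : AnalyticOnNhd ℝ F (Set.univ ×ˢ E)) :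
    AnalyticOnNhd ℝ (fun z : ℝ × Q => ∫ s in (0 : ℝ)..z.1, F (s, z.2)) (Set.univ ×ˢ E) := by
  have hint : ∀ ε ∈ E, ∀ a b : ℝ, IntervalIntegrable (fun s => F (s, ε)) MeasureTheory.volume a b :=
    fun ε hε a b => (hF.continuous_slice hε).intervalIntegrable a b
  rintro ⟨s₁, ε₀⟩ ⟨-, hε₀⟩
  have hloc : ∀ s₀ : ℝ, AnalyticAt ℝ (fun z : ℝ × Q => ∫ s in s₀..z.1, F (s, z.2)) (s₀, ε₀) :=
    fun s₀ => (hF (s₀, ε₀) ⟨trivial, hε₀⟩).parametric_primitive_self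
  have hnear : ∀ s₀ : ℝ, ∀ᶠ s in nhds s₀,
      AnalyticAt ℝ (fun ε : Q => ∫ s' in s₀..s, F (s', ε)) ε₀ := by
    intro s₀
    have h := (hloc s₀).eventually_analyticAt
    have h' : Filter.Tendsto (fun s : ℝ => (s, ε₀)) (nhds s₀) (nhds (s₀, ε₀)) :=
      Continuous.tendsto (by fun_prop) s₀
    filter_upwards [h'.eventually h] with s hs
    exact hs.comp_of_eq (g := fun z : ℝ × Q => ∫ s' in s₀..z.1, F (s', z.2))
      (f := fun ε : Q => (s, ε)) (analyticAt_const.prod analyticAt_id) rfl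
  let 𝒮 : Set ℝ := {s | AnalyticAt ℝ (fun ε : Q => ∫ s' in (0 : ℝ)..s, F (s', ε)) ε₀}
  have hev : ∀ᶠ ε in nhds ε₀, ε ∈ E := hE.mem_nhds hε₀
  have hiff : ∀ s₀ : ℝ, ∀ᶠ s in nhds s₀, (s ∈ 𝒮 ↔ s₀ ∈ 𝒮) := by
    intro s₀
    filter_upwards [hnear s₀] with s hs
    constructor
    · intro h
      refine (h.sub hs).congr (hev.mono fun ε hε => ?_)
      rw [Pi.sub_apply, sub_eq_iff_eq_add]
      exact (intervalIntegral.integral_add_adjacent_intervals (hint ε hε _ _)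
        (hint ε hε _ _)).symm
    · intro h
      refine (AnalyticAt.add h hs).congr (hev.mono fun ε hε => ?_)
      exact intervalIntegral.integral_add_adjacent_intervals (hint ε hε _ _) (hint ε hε _ _)
  have hclopen : IsClopen 𝒮 := by
    constructor
    · rw [← isOpen_compl_iff, isOpen_iff_mem_nhds]
      intro s hs
      filter_upwards [hiff s] with s' hs' h
      exact hs (hs'.1 h)
    · rw [isOpen_iff_mem_nhds]
      intro s hs
      filter_upwards [hiff s] with s' hs' using hs'.2 hs
  have h0 : (0 : ℝ) ∈ 𝒮 := by
    simp only [𝒮, Set.mem_ofPred_eq, intervalIntegral.integral_same]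
    exact analyticAt_const
  have huniv : 𝒮 = Set.univ := hclopen.eq_univ ⟨0, h0⟩
  have h1 : AnalyticAt ℝ (fun ε : Q => ∫ s' in (0 : ℝ)..s₁, F (s', ε)) ε₀ := by
    have : s₁ ∈ 𝒮 := huniv ▸ trivial
    exact this
  have h2 : AnalyticAt ℝ (fun z : ℝ × Q => ∫ s' in (0 : ℝ)..s₁, F (s', z.2)) (s₁, ε₀) :=
    h1.comp_of_eq (g := fun ε : Q => ∫ s' in (0 : ℝ)..s₁, F (s', ε)) analyticAt_snd rfl
  have hev' : ∀ᶠ z in nhds (s₁, ε₀), z.2 ∈ E := continuousAt_snd.eventually hev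
  refine (AnalyticAt.add h2 (hloc s₁)).congr (hev'.mono fun z hz => ?_)
  exact intervalIntegral.integral_add_adjacent_intervals (hint z.2 hz _ _) (hint z.2 hz _ _)

theorem AnalyticOnNhd.hasDerivAt_parametric_primitive (hF : AnalyticOnNhd ℝ F (Set.univ ×ˢ E))
    {ε : Q} (hε : ε ∈ E) (s : ℝ) :
    HasDerivAt (fun s => ∫ s' in (0 : ℝ)..s, F (s', ε)) (F (s, ε)) s :=
  intervalIntegral.integral_hasDerivAt_right
    ((hF.continuous_slice hε).intervalIntegrable _ _)
    ((hF.continuous_slice hε).stronglyMeasurableAtFilter _ _)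
    (hF.continuous_slice hε).continuousAt

/-- A family of analytic functions of one variable, bijective and with nonvanishing derivatives,
has an analytic family of inverse functions. -/
theorem AnalyticOnNhd.parametric_inverse {Q : Type*} [NormedAddCommGroup Q] [NormedSpace ℝ Q]
    [CompleteSpace Q] {E : Set Q} (hE : IsOpen E) {X : ℝ × Q → ℝ}
    (hX : AnalyticOnNhd ℝ X (Set.univ ×ˢ E)) {Y : ℝ × Q → ℝ}
    (hYX : ∀ s, ∀ ε ∈ E, Y (X (s, ε), ε) = s) (hXY : ∀ x, ∀ ε ∈ E, X (Y (x, ε), ε) = x)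
    {X' : ℝ × Q → ℝ} (hX' : ∀ s, ∀ ε ∈ E, HasDerivAt (fun s => X (s, ε)) (X' (s, ε)) s)
    (hne : ∀ s, ∀ ε ∈ E, X' (s, ε) ≠ 0) :
    AnalyticOnNhd ℝ Y (Set.univ ×ˢ E) := by
  rintro ⟨x₀, ε₀⟩ ⟨-, hε₀⟩
  obtain ⟨s₀, rfl⟩ : ∃ s₀, X (s₀, ε₀) = x₀ := ⟨_, hXY x₀ ε₀ hε₀⟩
  have hXa : AnalyticAt ℝ X (s₀, ε₀) := hX _ ⟨trivial, hε₀⟩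
  set X₁ := fderiv ℝ X (s₀, ε₀) with hX₁
  have hX1 : HasFDerivAt X X₁ (s₀, ε₀) := hXa.differentiableAt.hasFDerivAt
  have hc : X₁ (1, 0) = X' (s₀, ε₀) := by
    have h1 : HasDerivAt (fun s : ℝ => (s, ε₀)) ((1 : ℝ), (0 : Q)) s₀ :=
      (hasDerivAt_id s₀).prodMk (hasDerivAt_const s₀ ε₀)
    exact (HasFDerivAt.comp_hasDerivAt s₀ hX1 h1).unique (hX' s₀ ε₀ hε₀)
  set c := X' (s₀, ε₀) with hcdef
  have hc0 : c ≠ 0 := hne s₀ ε₀ hε₀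
  have hsplit : ∀ (a : ℝ) (q : Q), X₁ (a, q) = c * a + X₁ (0, q) := by
    intro a q
    have : (a, q) = a • ((1 : ℝ), (0 : Q)) + (0, q) := by simp
    rw [this, map_add, map_smul, hc, smul_eq_mul, mul_comm]
  -- The derivative of `(X z, z.2)` is triangular with diagonal entry `c ≠ 0`, so its inverse can be
  -- written down.
  let e : (ℝ × Q) ≃L[ℝ] (ℝ × Q) := ContinuousLinearEquiv.equivOfInverse
    (X₁.prod (ContinuousLinearMap.snd ℝ ℝ Q))
    ((c⁻¹ • (ContinuousLinearMap.fst ℝ ℝ Q - X₁.comp ((ContinuousLinearMap.inr ℝ ℝ Q).comp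
      (ContinuousLinearMap.snd ℝ ℝ Q)))).prod (ContinuousLinearMap.snd ℝ ℝ Q))
    (by
      rintro ⟨a, q⟩
      simp [hsplit a q, hc0])
    (by
      rintro ⟨a, q⟩
      simp only [ContinuousLinearMap.prod_apply, ContinuousLinearMap.coe_snd', Prod.mk.injEq,
        and_true]
      rw [hsplit]
      simp [hc0])
  let G : ℝ × Q → ℝ × Q := fun z => (X z, z.2)
  have hG : AnalyticAt ℝ G (s₀, ε₀) := hXa.prod analyticAt_snd
  have hG' : HasFDerivAt G (e : (ℝ × Q) →L[ℝ] (ℝ × Q)) (s₀, ε₀) := hX1.prodMk hasFDerivAt_snd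
  -- The exponent `⊤` is the analytic class, so the local inverse is analytic and not merely smooth.
  have hGc : ContDiffAt ℝ ⊤ G (s₀, ε₀) := hG.contDiffAt
  have hs := hGc.hasStrictFDerivAt' hG' (by simp)
  have hinv : AnalyticAt ℝ (hGc.localInverse hG' (by simp)) (G (s₀, ε₀)) :=
    (hGc.to_localInverse hG' (by simp)).analyticAt
  have huniq : ∀ᶠ y in nhds (G (s₀, ε₀)), hGc.localInverse hG' (by simp) y = (Y y, y.2) := by
    have hr := hs.eventually_right_inverse
    have hev : ∀ᶠ y in nhds (G (s₀, ε₀)), y.2 ∈ E :=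
      continuousAt_snd.eventually (hE.mem_nhds hε₀)
    filter_upwards [hr, hev] with y hy hyE
    change G (hs.localInverse G e (s₀, ε₀) y) = y at hy
    set z := hs.localInverse G e (s₀, ε₀) y with hz
    have h2 : (G z).2 = y.2 := congrArg Prod.snd hy
    change z.2 = y.2 at h2
    have h1 : (G z).1 = y.1 := congrArg Prod.fst hy
    change X z = y.1 at h1
    have h3 := hYX z.1 z.2 (h2 ▸ hyE)
    change z = _
    refine Prod.ext ?_ h2
    rw [← h3]
    change Y (X z, z.2) = Y y
    rw [h1, h2]
  exact (analyticAt_fst.comp (hinv.congr huniq))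

end ParametricIntegral

/-! ### Uniform phase on a family of circles -/

theorem intervalIntegral_add_period {f : ℝ → ℝ} (hf : Continuous f)
    (hp : Function.Periodic f 1) (s : ℝ) :
    ∫ s' in (0 : ℝ)..(s + 1), f s' = (∫ s' in (0 : ℝ)..s, f s') + ∫ s' in (0 : ℝ)..1, f s' := by
  rw [← intervalIntegral.integral_add_adjacent_intervals (hf.intervalIntegrable 0 s)
    (hf.intervalIntegrable s (s + 1))]
  have := hp.intervalIntegral_add_eq s 0
  rw [this, zero_add]

theorem Function.surjective_of_add_one {X : ℝ → ℝ} (hX : Continuous X)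
    (h1 : ∀ s, X (s + 1) = X s + 1) : Function.Surjective X := by
  have hper : Function.Periodic (fun s => X s - s) 1 := fun s => by simp only [h1]; ring
  have hn : ∀ n : ℤ, X n = X 0 + n := fun n => by
    have := hper.int_mul_eq n
    simp only [mul_one, sub_zero] at this
    linarith
  intro y
  refine mem_range_of_exists_le_of_exists_ge hX ⟨(⌊y - X 0⌋ : ℤ), ?_⟩ ⟨(⌈y - X 0⌉ : ℤ), ?_⟩
  · rw [hn]; linarith [Int.floor_le (y - X 0)]
  · rw [hn]; linarith [Int.le_ceil (y - X 0)]

theorem eq_add_int_of_add_one {X : ℝ → ℝ} (h1 : ∀ s, X (s + 1) = X s + 1) (s : ℝ) (n : ℤ) :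
    X (s + n) = X s + n := by
  have hper : Function.Periodic (fun s => X s - s) 1 := fun s => by simp only [h1]; ring
  have := hper.int_mul n s
  simp only [mul_one] at this
  linarith

/-- The phase which increases at a constant rate along the motion `ds/dt = 1 / k` on a family of
circles, as an analytic family of parametrizations of these circles; `K` is the signed period. -/
theorem exists_uniform_phase {Q : Type*} [NormedAddCommGroup Q] [NormedSpace ℝ Q]
    [CompleteSpace Q] {E : Set Q} (hE : IsOpen E) {k : ℝ × Q → ℝ}
    (hk : AnalyticOnNhd ℝ k (Set.univ ×ˢ E)) (hper : ∀ s ε, k (s + 1, ε) = k (s, ε))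
    (hpos : ∀ s, ∀ ε ∈ E, 0 < k (0, ε) * k (s, ε)) :
    ∃ (K : Q → ℝ) (Y : ℝ × Q → ℝ), AnalyticOnNhd ℝ K E ∧ AnalyticOnNhd ℝ Y (Set.univ ×ˢ E) ∧
      (∀ ε ∈ E, K ε ≠ 0) ∧ (∀ ε ∈ E, ∀ x, Y (x + 1, ε) = Y (x, ε) + 1) ∧
      (∀ ε ∈ E, Function.Bijective fun x => Y (x, ε)) ∧
      (∀ ε ∈ E, ∀ x, HasDerivAt (fun x => Y (x, ε)) (K ε * (k (Y (x, ε), ε))⁻¹) x) := by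
  let X₀ : ℝ × Q → ℝ := fun z => ∫ s in (0 : ℝ)..z.1, k (s, z.2)
  let K : Q → ℝ := fun ε => X₀ (1, ε)
  have hX₀ : AnalyticOnNhd ℝ X₀ (Set.univ ×ˢ E) := hk.parametric_primitive hE
  have hK : AnalyticOnNhd ℝ K E := fun ε hε =>
    (hX₀ (1, ε) ⟨trivial, hε⟩).comp_of_eq (f := fun ε => ((1 : ℝ), ε))
      (analyticAt_const.prod analyticAt_id) rfl
  have hkne : ∀ ε ∈ E, ∀ s, k (s, ε) ≠ 0 := fun ε hε s h => by
    have := hpos s ε hε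
    rw [h] at this
    simp at this
  have hKpos : ∀ ε ∈ E, 0 < k (0, ε) * K ε := by
    intro ε hε
    have hc := hk.continuous_slice hε
    simp only [K, X₀, ← intervalIntegral.integral_const_mul]
    exact intervalIntegral.intervalIntegral_pos_of_pos
      ((continuous_const.mul hc).intervalIntegrable _ _) (fun s => hpos s ε hε) zero_lt_one
  have hKne : ∀ ε ∈ E, K ε ≠ 0 := fun ε hε h => by
    have := hKpos ε hε
    rw [h] at this
    simp at this
  -- Division by the signed period makes the phase increasing, whatever the sign of `k`, with a gain
  -- of exactly one per turn.
  let X : ℝ × Q → ℝ := fun z => X₀ z * (K z.2)⁻¹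
  have hXa : AnalyticOnNhd ℝ X (Set.univ ×ˢ E) := fun z hz =>
    (hX₀ z hz).mul (((hK z.2 hz.2).comp_of_eq analyticAt_snd rfl).inv (hKne z.2 hz.2))
  have hX' : ∀ s, ∀ ε ∈ E, HasDerivAt (fun s => X (s, ε)) (k (s, ε) * (K ε)⁻¹) s :=
    fun s ε hε => (hk.hasDerivAt_parametric_primitive hε s).mul_const (K ε)⁻¹
  have hX'pos : ∀ s, ∀ ε ∈ E, 0 < k (s, ε) * (K ε)⁻¹ := by
    intro s ε hε
    have h1 := div_pos (hpos s ε hε) (hKpos ε hε)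
    have h2 := hkne ε hε 0
    rwa [mul_div_mul_left _ _ h2, div_eq_mul_inv] at h1
  have hX1 : ∀ ε ∈ E, ∀ s, X (s + 1, ε) = X (s, ε) + 1 := by
    intro ε hε s
    have := intervalIntegral_add_period (hk.continuous_slice hε) (fun s => hper s ε) s
    simp only [X, X₀, this]
    rw [add_mul]
    congr 1
    exact mul_inv_cancel₀ (hKne ε hε)
  have hmono : ∀ ε ∈ E, StrictMono fun s => X (s, ε) := fun ε hε =>
    strictMono_of_deriv_pos fun s => by rw [(hX' s ε hε).deriv]; exact hX'pos s ε hε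
  have hXc : ∀ ε ∈ E, Continuous fun s => X (s, ε) := fun ε hε => hXa.continuous_slice hε
  have hsurj : ∀ ε ∈ E, Function.Surjective fun s => X (s, ε) := fun ε hε =>
    Function.surjective_of_add_one (hXc ε hε) (hX1 ε hε)
  -- Nothing is required of the inverse outside `E`.
  have hchoice : ∀ z : ℝ × Q, ∃ s, z.2 ∈ E → X (s, z.2) = z.1 := by
    intro z
    by_cases hz : z.2 ∈ E
    · obtain ⟨s, hs⟩ := hsurj z.2 hz z.1
      exact ⟨s, fun _ => hs⟩
    · exact ⟨0, fun h => absurd h hz⟩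
  choose Y hY using hchoice
  have hXY : ∀ x, ∀ ε ∈ E, X (Y (x, ε), ε) = x := fun x ε hε => hY (x, ε) hε
  have hYX : ∀ s, ∀ ε ∈ E, Y (X (s, ε), ε) = s := fun s ε hε =>
    (hmono ε hε).injective (hXY _ ε hε)
  have hYa := hXa.parametric_inverse hE hYX hXY (X' := fun z => k z * (K z.2)⁻¹) hX' fun s ε hε => (hX'pos s ε hε).ne'
  refine ⟨K, Y, hK, hYa, hKne, ?_, ?_, ?_⟩
  · intro ε hε x
    apply (hmono ε hε).injective
    simp only [hXY _ ε hε, hX1 ε hε]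
  · exact fun ε hε => ⟨Function.LeftInverse.injective (g := fun s => X (s, ε)) fun x => hXY x ε hε,
      fun s => ⟨X (s, ε), hYX s ε hε⟩⟩
  · intro ε hε x
    have h := HasDerivAt.of_local_left_inverse (hYa.continuous_slice hε).continuousAt
      (hX' (Y (x, ε)) ε hε) (hX'pos _ ε hε).ne'
      (Filter.Eventually.of_forall fun x => hXY x ε hε)
    simpa [mul_inv, mul_comm] using h

/-! ### Analyticity and derivatives of vector and matrix expressions -/

namespace ChaplyginSphere

section Calculus

variable {X : Type*} [NormedAddCommGroup X] [NormedSpace ℝ X]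

theorem hasDerivAt_mat_iff {A : ℝ → Mat} {A' : Mat} {t : ℝ} :
    HasDerivAt A A' t ↔ ∀ i j, HasDerivAt (fun t => A t i j) (A' i j) t := by
  refine (hasDerivAt_pi (φ := fun t i => A t i) (φ' := fun i => A' i)).trans
    (forall_congr' fun i => ?_)
  exact hasDerivAt_pi (φ := fun t j => A t i j) (φ' := fun j => A' i j)

theorem analyticAt_mat_iff {A : X → Mat} {x : X} :
    AnalyticAt ℝ A x ↔ ∀ i j, AnalyticAt ℝ (fun x => A x i j) x := by
  refine (analyticAt_pi_iff (f := fun i x => A x i)).trans (forall_congr' fun i => ?_)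
  exact analyticAt_pi_iff (f := fun j x => A x i j)

variable {x : X} {t : ℝ}

theorem analyticAt_dot {a b : X → Vec} (ha : AnalyticAt ℝ a x) (hb : AnalyticAt ℝ b x) :
    AnalyticAt ℝ (fun x => a x ⬝ᵥ b x) x := by
  rw [analyticAt_pi_iff (f := fun i x => a x i)] at ha
  rw [analyticAt_pi_iff (f := fun i x => b x i)] at hb
  simp only [dotProduct, Fin.sum_univ_three]
  exact (((ha 0).mul (hb 0)).add ((ha 1).mul (hb 1))).add ((ha 2).mul (hb 2))

theorem hasDerivAt_dot {a b : ℝ → Vec} {a' b' : Vec} (ha : HasDerivAt a a' t)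
    (hb : HasDerivAt b b' t) :
    HasDerivAt (fun t => a t ⬝ᵥ b t) (a' ⬝ᵥ b t + a t ⬝ᵥ b') t := by
  rw [hasDerivAt_pi] at ha hb
  simp only [dotProduct, Fin.sum_univ_three]
  have h := (((ha 0).mul (hb 0)).add ((ha 1).mul (hb 1))).add ((ha 2).mul (hb 2))
  exact h.congr_deriv (by ring)

theorem analyticAt_cross {a b : X → Vec} (ha : AnalyticAt ℝ a x) (hb : AnalyticAt ℝ b x) :
    AnalyticAt ℝ (fun x => a x ⨯₃ b x) x := by
  rw [analyticAt_pi_iff (f := fun i x => a x i)] at ha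
  rw [analyticAt_pi_iff (f := fun i x => b x i)] at hb
  refine AnalyticAt.pi (f := fun i x => (a x ⨯₃ b x) i) fun i => ?_
  fin_cases i <;> simp only [cross_apply]
  · exact ((ha 1).mul (hb 2)).sub ((ha 2).mul (hb 1))
  · exact ((ha 2).mul (hb 0)).sub ((ha 0).mul (hb 2))
  · exact ((ha 0).mul (hb 1)).sub ((ha 1).mul (hb 0))

theorem hasDerivAt_cross {a b : ℝ → Vec} {a' b' : Vec} (ha : HasDerivAt a a' t)
    (hb : HasDerivAt b b' t) :
    HasDerivAt (fun t => a t ⨯₃ b t) (a' ⨯₃ b t + a t ⨯₃ b') t := by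
  rw [hasDerivAt_pi] at ha hb ⊢
  intro i
  fin_cases i <;> simp only [cross_apply]
  · exact (((ha 1).mul (hb 2)).sub ((ha 2).mul (hb 1))).congr_deriv (by simp; ring)
  · exact (((ha 2).mul (hb 0)).sub ((ha 0).mul (hb 2))).congr_deriv (by simp; ring)
  · exact (((ha 0).mul (hb 1)).sub ((ha 1).mul (hb 0))).congr_deriv (by simp; ring)

theorem analyticAt_mul {A B : X → Mat} (hA : AnalyticAt ℝ A x) (hB : AnalyticAt ℝ B x) :
    AnalyticAt ℝ (fun x => A x * B x) x := by
  rw [analyticAt_mat_iff] at *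
  intro i j
  simp only [Matrix.mul_apply, Fin.sum_univ_three]
  exact (((hA i 0).mul (hB 0 j)).add ((hA i 1).mul (hB 1 j))).add ((hA i 2).mul (hB 2 j))

theorem hasDerivAt_mul {A B : ℝ → Mat} {A' B' : Mat} (hA : HasDerivAt A A' t)
    (hB : HasDerivAt B B' t) :
    HasDerivAt (fun t => A t * B t) (A' * B t + A t * B') t := by
  rw [hasDerivAt_mat_iff] at *
  intro i j
  simp only [Matrix.add_apply, Matrix.mul_apply, Fin.sum_univ_three]
  exact ((((hA i 0).mul (hB 0 j)).add ((hA i 1).mul (hB 1 j))).add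
    ((hA i 2).mul (hB 2 j))).congr_deriv (by ring)

theorem analyticAt_mulVec {A : X → Mat} {b : X → Vec} (hA : AnalyticAt ℝ A x)
    (hb : AnalyticAt ℝ b x) : AnalyticAt ℝ (fun x => A x *ᵥ b x) x := by
  rw [analyticAt_mat_iff] at hA
  exact AnalyticAt.pi (f := fun i x => (A x *ᵥ b x) i) fun i =>
    analyticAt_dot (AnalyticAt.pi (f := fun j x => A x i j) fun j => hA i j) hb

theorem hasDerivAt_mulVec {A : ℝ → Mat} {A' : Mat} {b : ℝ → Vec} {b' : Vec}
    (hA : HasDerivAt A A' t) (hb : HasDerivAt b b' t) :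
    HasDerivAt (fun t => A t *ᵥ b t) (A' *ᵥ b t + A t *ᵥ b') t := by
  rw [hasDerivAt_pi]
  rw [hasDerivAt_mat_iff] at hA
  exact fun i => hasDerivAt_dot (hasDerivAt_pi.2 (hA i)) hb

theorem hasDerivAt_transpose {A : ℝ → Mat} {A' : Mat} (hA : HasDerivAt A A' t) :
    HasDerivAt (fun t => (A t)ᵀ) A'ᵀ t := by
  rw [hasDerivAt_mat_iff] at *
  exact fun i j => hA j i

theorem hasDerivAt_const_mulVec (B : Mat) {b : ℝ → Vec} {b' : Vec} (hb : HasDerivAt b b' t) :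
    HasDerivAt (fun t => B *ᵥ b t) (B *ᵥ b') t :=
  (hasDerivAt_mulVec (hasDerivAt_const t B) hb).congr_deriv (by simp)

theorem hasDerivAt_vert {A : ℝ → Mat} {A' : Mat} (hA : HasDerivAt A A' t) :
    HasDerivAt (fun t => vert (A t)) (vert A') t :=
  (hasDerivAt_mulVec (hasDerivAt_transpose hA) (hasDerivAt_const t e₃)).congr_deriv (by simp [vert])

theorem continuous_vert : Continuous vert :=
  (Continuous.matrix_mulVec (continuous_id.matrix_transpose) continuous_const)

end Calculus

/-! ### Rotations and the cross product -/

section Algebra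

theorem hat_transpose (a : Vec) : (hat a)ᵀ = -hat a := by
  ext i j
  fin_cases i <;> fin_cases j <;> simp [hat]

theorem hat_add (a b : Vec) : hat (a + b) = hat a + hat b := by
  ext i j
  fin_cases i <;> fin_cases j <;> simp [hat] <;> ring

theorem hat_smul (c : ℝ) (a : Vec) : hat (c • a) = c • hat a := by
  ext i j
  fin_cases i <;> fin_cases j <;> simp [hat]

theorem hat_eq_zero {a : Vec} (h : hat a = 0) : a = 0 := by
  have h0 := congrFun (congrFun h 2) 1
  have h1 := congrFun (congrFun h 0) 2
  have h2 := congrFun (congrFun h 1) 0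
  simp [hat] at h0 h1 h2
  ext i
  fin_cases i <;> simp [h0, h1, h2]

theorem ext_mulVec {A B : Mat} (h : ∀ z, A *ᵥ z = B *ᵥ z) : A = B :=
  Matrix.ext_of_mulVec_single fun _ => h _

theorem mul_transpose_of_mem {A : Mat} (hA : A ∈ SO3) : A * Aᵀ = 1 := mul_eq_one_comm.1 hA.1

theorem transpose_mem {A : Mat} (hA : A ∈ SO3) : Aᵀ ∈ SO3 :=
  ⟨by rw [transpose_transpose]; exact mul_transpose_of_mem hA, by rw [det_transpose]; exact hA.2⟩

theorem mul_mem {A B : Mat} (hA : A ∈ SO3) (hB : B ∈ SO3) : A * B ∈ SO3 :=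
  ⟨by rw [transpose_mul, Matrix.mul_assoc, ← Matrix.mul_assoc Aᵀ, hA.1, Matrix.one_mul, hB.1],
    by rw [det_mul, hA.2, hB.2, one_mul]⟩

theorem mulVec_transpose_mulVec {A : Mat} (hA : A ∈ SO3) (z : Vec) : A *ᵥ (Aᵀ *ᵥ z) = z := by
  rw [mulVec_mulVec, mul_transpose_of_mem hA, one_mulVec]

theorem transpose_mulVec_mulVec {A : Mat} (hA : A ∈ SO3) (z : Vec) : Aᵀ *ᵥ (A *ᵥ z) = z := by
  rw [mulVec_mulVec, hA.1, one_mulVec]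

theorem mulVec_dot (A : Mat) (x y : Vec) : (A *ᵥ x) ⬝ᵥ y = x ⬝ᵥ (Aᵀ *ᵥ y) := by
  rw [dotProduct_comm, dotProduct_mulVec, dotProduct_comm, mulVec_transpose]

theorem dot_mulVec_mulVec {A : Mat} (hA : A ∈ SO3) (x y : Vec) :
    (A *ᵥ x) ⬝ᵥ (A *ᵥ y) = x ⬝ᵥ y := by
  rw [mulVec_dot, transpose_mulVec_mulVec hA]

/-- The transposed adjugate is the cofactor matrix, that is, the second exterior power of `A` when
bivectors are identified with vectors. For a rotation it is `A` itself, so rotations preserve the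
cross product. -/
theorem adjugate_transpose_mulVec_cross (A : Mat) (x y : Vec) :
    (adjugate A)ᵀ *ᵥ (x ⨯₃ y) = (A *ᵥ x) ⨯₃ (A *ᵥ y) := by
  ext i
  fin_cases i <;>
    simp [adjugate_fin_three, cross_apply, mulVec, dotProduct, Fin.sum_univ_three] <;> ring

theorem adjugate_of_mem {A : Mat} (hA : A ∈ SO3) : adjugate A = Aᵀ := by
  have h := mul_adjugate A
  rw [hA.2, one_smul] at h
  calc adjugate A = (Aᵀ * A) * adjugate A := by rw [hA.1, Matrix.one_mul]
    _ = Aᵀ := by rw [Matrix.mul_assoc, h, Matrix.mul_one]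

theorem mulVec_cross {A : Mat} (hA : A ∈ SO3) (x y : Vec) :
    A *ᵥ (x ⨯₃ y) = (A *ᵥ x) ⨯₃ (A *ᵥ y) := by
  rw [← adjugate_transpose_mulVec_cross, adjugate_of_mem hA, transpose_transpose]

theorem hat_mulVec_mul {A : Mat} (hA : A ∈ SO3) (ω : Vec) : hat (A *ᵥ ω) * A = A * hat ω :=
  ext_mulVec fun z => by
    rw [← mulVec_mulVec, ← mulVec_mulVec, hat_mulVec, hat_mulVec, mulVec_cross hA]

theorem mulVec_vert {A : Mat} (hA : A ∈ SO3) : A *ᵥ vert A = e₃ := mulVec_transpose_mulVec hA e₃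

theorem hat_e₃_mul {A : Mat} (hA : A ∈ SO3) : hat e₃ * A = A * hat (vert A) := by
  rw [← hat_mulVec_mul hA, mulVec_vert hA]

theorem e₃_dot_e₃ : e₃ ⬝ᵥ e₃ = 1 := by simp [e₃]

theorem vert_dot_vert {A : Mat} (hA : A ∈ SO3) : vert A ⬝ᵥ vert A = 1 := by
  rw [vert, dot_mulVec_mulVec (transpose_mem hA), e₃_dot_e₃]

theorem vert_mul_hat (A : Mat) (ω : Vec) : vert (A * hat ω) = vert A ⨯₃ ω := by
  rw [vert, transpose_mul, ← mulVec_mulVec, hat_transpose, neg_mulVec, hat_mulVec,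
    ← cross_anticomm, neg_neg]
  rfl

theorem cross_dot_cross_self (a b : Vec) :
    (a ⨯₃ b) ⬝ᵥ (a ⨯₃ b) = (a ⬝ᵥ a) * (b ⬝ᵥ b) - (a ⬝ᵥ b) ^ 2 := by
  rw [cross_dot_cross, dotProduct_comm b a]
  ring

theorem dot_self_eq_zero_iff {a : Vec} : a ⬝ᵥ a = 0 ↔ a = 0 := dotProduct_self_eq_zero

theorem dot_self_nonneg (a : Vec) : 0 ≤ a ⬝ᵥ a := by
  simp only [dotProduct, Fin.sum_univ_three]
  nlinarith [mul_self_nonneg (a 0), mul_self_nonneg (a 1), mul_self_nonneg (a 2)]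

/-- The rotation about the vertical axis by the angle `2 π y`. -/
noncomputable def rotVertical (y : ℝ) : Mat :=
  !![Real.cos (2 * Real.pi * y), -Real.sin (2 * Real.pi * y), 0;
    Real.sin (2 * Real.pi * y), Real.cos (2 * Real.pi * y), 0; 0, 0, 1]

theorem rotVertical_add (x y : ℝ) : rotVertical (x + y) = rotVertical x * rotVertical y := by
  ext i j
  fin_cases i <;> fin_cases j <;>
    simp [rotVertical, Matrix.mul_apply, Fin.sum_univ_three, mul_add, Real.cos_add, Real.sin_add]
      <;> ring

theorem rotVertical_transpose (y : ℝ) : (rotVertical y)ᵀ = rotVertical (-y) := by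
  ext i j
  fin_cases i <;> fin_cases j <;> simp [rotVertical]

theorem rotVertical_zero : rotVertical 0 = 1 := by
  ext i j
  fin_cases i <;> fin_cases j <;> simp [rotVertical]

theorem rotVertical_mem (y : ℝ) : rotVertical y ∈ SO3 := by
  refine ⟨by rw [rotVertical_transpose, ← rotVertical_add, neg_add_cancel, rotVertical_zero], ?_⟩
  have := Real.cos_sq_add_sin_sq (2 * Real.pi * y)
  simp [rotVertical, det_fin_three]
  linarith

theorem rotVertical_eq_one_iff {y : ℝ} : rotVertical y = 1 ↔ ∃ n : ℤ, y = n := by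
  constructor
  · intro h
    have h0 : Real.cos (2 * Real.pi * y) = 1 := by
      have := congrFun (congrFun h 0) 0
      simpa [rotVertical] using this
    obtain ⟨n, hn⟩ := (Real.cos_eq_one_iff _).1 h0
    refine ⟨n, ?_⟩
    have := Real.pi_pos
    have h2 : (2 * Real.pi) * (n - y) = 0 := by linarith
    rcases mul_eq_zero.1 h2 with h | h
    · linarith
    · linarith
  · rintro ⟨n, rfl⟩
    have h1 : Real.cos (2 * Real.pi * n) = 1 := (Real.cos_eq_one_iff _).2 ⟨n, by ring⟩
    have h2 : Real.sin (2 * Real.pi * n) = 0 := Real.sin_eq_zero_iff.2 ⟨2 * n, by push_cast; ring⟩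
    ext i j
    fin_cases i <;> fin_cases j <;> simp [rotVertical, h1, h2]

theorem rotVertical_eq_iff {x y : ℝ} :
    rotVertical x = rotVertical y ↔ ∃ n : ℤ, x = y + n := by
  have h : rotVertical x = rotVertical (x - y) * rotVertical y := by
    rw [← rotVertical_add, sub_add_cancel]
  have h2 : rotVertical x = rotVertical y ↔ rotVertical (x - y) = 1 := by
    constructor
    · intro h'
      rw [sub_eq_add_neg, rotVertical_add, h', ← rotVertical_add, add_neg_cancel, rotVertical_zero]
    · intro h'
      rw [h, h', Matrix.one_mul]
  rw [h2, rotVertical_eq_one_iff]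
  exact exists_congr fun n => sub_eq_iff_eq_add'

theorem rotVertical_transpose_mulVec_e₃ (y : ℝ) : (rotVertical y)ᵀ *ᵥ e₃ = e₃ := by
  ext i
  fin_cases i <;> simp [rotVertical, e₃, mulVec, dotProduct, Fin.sum_univ_three]

theorem vert_rotVertical_mul (y : ℝ) (A : Mat) : vert (rotVertical y * A) = vert A := by
  rw [vert, transpose_mul, ← mulVec_mulVec, rotVertical_transpose_mulVec_e₃]
  rfl

theorem hasDerivAt_rotVertical {y : ℝ → ℝ} {y' t : ℝ} (hy : HasDerivAt y y' t) :
    HasDerivAt (fun t => rotVertical (y t)) ((2 * Real.pi * y') • (hat e₃ * rotVertical (y t))) t := by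
  have h := hy.const_mul (2 * Real.pi)
  have hc := h.cos
  have hs := h.sin
  rw [hasDerivAt_mat_iff]
  intro i j
  fin_cases i <;> fin_cases j <;>
    simp [rotVertical, hat, e₃]
  · exact hc.congr_deriv (by ring)
  · exact hs.neg.congr_deriv (by ring)
  · exact hasDerivAt_const _ _
  · exact hs.congr_deriv (by ring)
  · exact hc.congr_deriv (by ring)
  · exact hasDerivAt_const _ _
  · exact hasDerivAt_const _ _
  · exact hasDerivAt_const _ _
  · exact hasDerivAt_const _ _

theorem analyticAt_rotVertical {X : Type*} [NormedAddCommGroup X] [NormedSpace ℝ X] {y : X → ℝ}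
    {x : X} (hy : AnalyticAt ℝ y x) : AnalyticAt ℝ (fun x => rotVertical (y x)) x := by
  have h : AnalyticAt ℝ (fun x => 2 * Real.pi * y x) x := analyticAt_const.mul hy
  have hc : AnalyticAt ℝ (fun x => Real.cos (2 * Real.pi * y x)) x :=
    Real.analyticAt_cos.comp_of_eq h rfl
  have hs : AnalyticAt ℝ (fun x => Real.sin (2 * Real.pi * y x)) x :=
    Real.analyticAt_sin.comp_of_eq h rfl
  rw [analyticAt_mat_iff]
  intro i j
  fin_cases i <;> fin_cases j <;>
    simp [rotVertical] <;> first | exact hc | exact hs | exact hs.neg | exact analyticAt_const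

theorem exists_eq_cos_sin {x y : ℝ} (h : x ^ 2 + y ^ 2 = 1) :
    ∃ φ : ℝ, x = Real.cos φ ∧ y = Real.sin φ := by
  have hn : ‖(⟨x, y⟩ : ℂ)‖ = 1 := by
    rw [Complex.norm_eq_sqrt_sq_add_sq, h, Real.sqrt_one]
  have h0 : (⟨x, y⟩ : ℂ) ≠ 0 := norm_ne_zero_iff.1 (by rw [hn]; exact one_ne_zero)
  exact ⟨Complex.arg ⟨x, y⟩, by rw [Complex.cos_arg h0, hn, div_one],
    by rw [Complex.sin_arg, hn, div_one]⟩

/-- A rotation fixing the vertical is a rotation about the vertical axis. -/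
theorem exists_eq_rotVertical {A : Mat} (hA : A ∈ SO3) (h : vert A = e₃) :
    ∃ y, A = rotVertical y := by
  have h3 : ∀ j, A 2 j = e₃ j := fun j => by
    have := congrFun h j
    simpa [vert, e₃, mulVec, dotProduct, Fin.sum_univ_three] using this
  have h20 := h3 0
  have h21 := h3 1
  have h22 := h3 2
  -- By orthogonality the vertical third row is also the third column.
  have hA' : A *ᵥ e₃ = e₃ := by
    rw [← h]
    exact (mulVec_vert hA).trans h.symm
  have h02 : A 0 2 = 0 := by
    have := congrFun hA' 0
    simpa [e₃, mulVec, dotProduct, Fin.sum_univ_three] using this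
  have h12 : A 1 2 = 0 := by
    have := congrFun hA' 1
    simpa [e₃, mulVec, dotProduct, Fin.sum_univ_three] using this
  simp [e₃] at h20 h21 h22
  -- Equality of adjugate and transpose expresses the second column of the horizontal block by the
  -- first one, which is a unit vector and defines the angle.
  have hadj := adjugate_of_mem hA
  have ha := congrFun (congrFun hadj 0) 0
  have hb := congrFun (congrFun hadj 0) 1
  have hn := congrFun (congrFun hA.1 0) 0
  simp [adjugate_fin_three, Matrix.mul_apply, Fin.sum_univ_three, h20, h21, h22, h02, h12] at ha hb hn
  have hn' : (A 0 0) ^ 2 + (A 1 0) ^ 2 = 1 := by linarith [hn]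
  obtain ⟨φ, hc, hs⟩ : ∃ φ : ℝ, A 0 0 = Real.cos φ ∧ A 1 0 = Real.sin φ  :=
    exists_eq_cos_sin hn'
  refine ⟨φ / (2 * Real.pi), ?_⟩
  have hφ : 2 * Real.pi * (φ / (2 * Real.pi)) = φ := by
    field_simp
  ext i j
  fin_cases i <;> fin_cases j <;>
    simp [rotVertical, hφ, h20, h21, h22, h02, h12, ← hc, ← hs] <;> linarith

end Algebra

/-! ### The inertia operator and the level sets of moment and energy -/

/-- `B` is the inverse of `I + ρ`. -/
structure IsInertiaInverse (I : Mat) (ρ : ℝ) (B : Mat) : Prop where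
  inv : (I + ρ • (1 : Mat)) * B = 1
  symm : Bᵀ = B
  lt_one : ∀ u : Vec, u ⬝ᵥ u = 1 → ρ * (u ⬝ᵥ (B *ᵥ u)) < 1

/-- The value of the quadratic form of `B` on the level set with vertical moment `ε.1` and
energy `ε.2`. -/
noncomputable def levelValue (ρ : ℝ) (ε : ℝ × ℝ) : ℝ := 2 * ε.2 / (ε.1 ^ 2 + 2 * ρ * ε.2)

/-- The factor in `ω = κ B u` on the level set with vertical moment `ε.1` and energy `ε.2`. -/
noncomputable def levelFactor (ρ : ℝ) (ε : ℝ × ℝ) : ℝ := (ε.1 ^ 2 + 2 * ρ * ε.2) / ε.1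

section

variable {I : Mat} {ρ : ℝ} {B : Mat}

theorem inertiaAt_mulVec (I : Mat) (ρ : ℝ) (u ω : Vec) :
    inertiaAt I ρ u *ᵥ ω = (I + ρ • (1 : Mat)) *ᵥ ω - (ρ * (u ⬝ᵥ ω)) • u := by
  rw [inertiaAt, sub_mulVec, smul_mulVec, vecMulVec_mulVec]
  ext i
  simp
  ring

theorem IsInertiaInverse.mulVec_mulVec (hB : IsInertiaInverse I ρ B) (z : Vec) :
    (I + ρ • (1 : Mat)) *ᵥ (B *ᵥ z) = z := by
  rw [Matrix.mulVec_mulVec, hB.inv, one_mulVec]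

theorem IsInertiaInverse.mulVec_mulVec' (hB : IsInertiaInverse I ρ B) (z : Vec) :
    B *ᵥ ((I + ρ • (1 : Mat)) *ᵥ z) = z := by
  rw [Matrix.mulVec_mulVec, mul_eq_one_comm.1 hB.inv, one_mulVec]

theorem IsInertiaInverse.dot_comm (hB : IsInertiaInverse I ρ B) (x y : Vec) :
    (B *ᵥ x) ⬝ᵥ y = x ⬝ᵥ (B *ᵥ y) := by
  rw [mulVec_dot, hB.symm]

/-- The operator is a rank-one perturbation of `I + ρ`. Applying `B` leaves only the scalar `⟨u, ω⟩`
unknown, and pairing with `u` determines it because `1 - ρ ⟨u, B u⟩` is positive. -/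
theorem IsInertiaInverse.inertiaAt_mulVec_eq_iff (hB : IsInertiaInverse I ρ B) {u ω : Vec}
    (hu : u ⬝ᵥ u = 1) (j : ℝ) :
    inertiaAt I ρ u *ᵥ ω = j • u ↔ ω = (j / (1 - ρ * (u ⬝ᵥ (B *ᵥ u)))) • (B *ᵥ u) := by
  have h1 : 1 - ρ * (u ⬝ᵥ (B *ᵥ u)) ≠ 0 := (sub_pos.2 (hB.lt_one u hu)).ne'
  rw [inertiaAt_mulVec]
  constructor
  · intro h
    have h2 : (I + ρ • (1 : Mat)) *ᵥ ω = (j + ρ * (u ⬝ᵥ ω)) • u := by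
      rw [add_smul, ← h, sub_add_cancel]
    have h3 : ω = (j + ρ * (u ⬝ᵥ ω)) • (B *ᵥ u) := by
      rw [← mulVec_smul, ← h2, hB.mulVec_mulVec']
    have h4 : u ⬝ᵥ ω = (j + ρ * (u ⬝ᵥ ω)) * (u ⬝ᵥ (B *ᵥ u)) := by
      conv_lhs => rw [h3, dotProduct_smul, smul_eq_mul]
    have h5 : j + ρ * (u ⬝ᵥ ω) = j / (1 - ρ * (u ⬝ᵥ (B *ᵥ u))) := by
      rw [eq_div_iff h1]
      linear_combination ρ * h4
    rw [← h5]
    exact h3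
  · intro h
    rw [h, mulVec_smul, hB.mulVec_mulVec, ← sub_smul, dotProduct_smul, smul_eq_mul]
    congr 1
    field_simp

theorem energy_eq_of_inertiaAt {u ω : Vec} (hu : u ⬝ᵥ u = 1) :
    energy I ρ u ω = 1 / 2 * ((inertiaAt I ρ u *ᵥ ω) ⬝ᵥ ω) := by
  rw [energy, cross_dot_cross_self, hu, inertiaAt_mulVec, add_mulVec, smul_mulVec, one_mulVec,
    sub_dotProduct, add_dotProduct, smul_dotProduct, smul_dotProduct, smul_eq_mul, smul_eq_mul]
  ring

theorem moment_eq_iff {A : Mat} (hA : A ∈ SO3) {ω : Vec} {j : ℝ} :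
    moment I ρ A ω = j • e₃ ↔ inertiaAt I ρ (vert A) *ᵥ ω = j • vert A := by
  constructor
  · intro h
    rw [← transpose_mulVec_mulVec hA (inertiaAt I ρ (vert A) *ᵥ ω)]
    change Aᵀ *ᵥ moment I ρ A ω = _
    rw [h, mulVec_smul]
    rfl
  · intro h
    rw [moment, h, mulVec_smul, mulVec_vert hA]

theorem IsInertiaInverse.energy_eq (hB : IsInertiaInverse I ρ B) {u ω : Vec} (hu : u ⬝ᵥ u = 1)
    {j : ℝ} (h : inertiaAt I ρ u *ᵥ ω = j • u) :
    energy I ρ u ω = 1 / 2 * j ^ 2 * (u ⬝ᵥ (B *ᵥ u)) / (1 - ρ * (u ⬝ᵥ (B *ᵥ u))) := by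
  rw [energy_eq_of_inertiaAt hu, h, (hB.inertiaAt_mulVec_eq_iff hu j).1 h, smul_dotProduct,
    dotProduct_smul, smul_eq_mul, smul_eq_mul]
  ring

/-- On the level set, `j² + 2 ρ T` equals `j² / (1 - ρ ⟨u, B u⟩)`. -/
theorem IsInertiaInverse.pos_of_mem_levelSet (hB : IsInertiaInverse I ρ B) {ε : ℝ × ℝ}
    (h1 : ε.1 ≠ 0) {z : Mat × Vec} (hz : z ∈ levelSet I ρ (ε.1 • e₃) ε.2) :
    0 < ε.1 ^ 2 + 2 * ρ * ε.2 := by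
  obtain ⟨hA, hm, hT⟩ := hz
  have hu := vert_dot_vert hA
  have hg := sub_pos.2 (hB.lt_one _ hu)
  rw [← hT, hB.energy_eq hu ((moment_eq_iff hA).1 hm)]
  have : ε.1 ^ 2 + 2 * ρ * (1 / 2 * ε.1 ^ 2 * (vert z.1 ⬝ᵥ (B *ᵥ vert z.1)) /
      (1 - ρ * (vert z.1 ⬝ᵥ (B *ᵥ vert z.1)))) =
      ε.1 ^ 2 / (1 - ρ * (vert z.1 ⬝ᵥ (B *ᵥ vert z.1))) := by
    field_simp
    ring
  rw [this]
  positivity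

/-- The energy is a fractional linear function of `g = ⟨u, B u⟩`. Solving for `g` gives
`levelValue`, and inserting this into `j / (1 - ρ g)` gives `levelFactor`; so `ω` is one fixed
multiple of `B u` on the whole level set. -/
theorem IsInertiaInverse.mem_levelSet_iff (hB : IsInertiaInverse I ρ B) {ε : ℝ × ℝ}
    (h1 : ε.1 ≠ 0) (hD : 0 < ε.1 ^ 2 + 2 * ρ * ε.2) {z : Mat × Vec} (hA : z.1 ∈ SO3) :
    z ∈ levelSet I ρ (ε.1 • e₃) ε.2 ↔ vert z.1 ⬝ᵥ (B *ᵥ vert z.1) = levelValue ρ ε ∧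
      z.2 = levelFactor ρ ε • (B *ᵥ vert z.1) := by
  have hu := vert_dot_vert hA
  have hg := sub_pos.2 (hB.lt_one _ hu)
  set g := vert z.1 ⬝ᵥ (B *ᵥ vert z.1) with hgdef
  have key : g = levelValue ρ ε → ε.1 / (1 - ρ * g) = levelFactor ρ ε := by
    intro h
    rw [h] at hg ⊢
    rw [levelFactor, div_eq_div_iff hg.ne' h1, levelValue]
    field_simp
    ring
  constructor
  · rintro ⟨-, hm, hT⟩
    have hm' := (moment_eq_iff hA).1 hm
    have hg' : g = levelValue ρ ε := by
      rw [hB.energy_eq hu hm', ← hgdef, div_eq_iff hg.ne'] at hT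
      rw [levelValue, eq_div_iff hD.ne']
      linear_combination 2 * hT
    refine ⟨hg', ?_⟩
    rw [← key hg']
    exact (hB.inertiaAt_mulVec_eq_iff hu ε.1).1 hm'
  · rintro ⟨hg', hω⟩
    rw [← key hg'] at hω
    have hm' := (hB.inertiaAt_mulVec_eq_iff hu ε.1).2 hω
    refine ⟨hA, (moment_eq_iff hA).2 hm', ?_⟩
    rw [hB.energy_eq hu hm', ← hgdef, div_eq_iff hg.ne']
    have hgD : g * (ε.1 ^ 2 + 2 * ρ * ε.2) = 2 * ε.2 := by
      rw [hg', levelValue, div_mul_cancel₀ _ hD.ne']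
    linear_combination (1 / 2) * hgD

/-- The candidate for `ω'` is orthogonal to `u`, so the equation reduces to `(I + ρ) ω' = (I ω) ×
ω`. Both sides are `κ u × ω`, since `(I + ρ) ω = κ u` and `ω × ω = 0`. -/
theorem IsInertiaInverse.dynamicalEq (hB : IsInertiaInverse I ρ B) {u ω : Vec} {κ : ℝ}
    (hω : ω = κ • (B *ᵥ u)) : DynamicalEq I ρ u ω (κ • (B *ᵥ (u ⨯₃ ω))) := by
  have h1 : u ⬝ᵥ (κ • (B *ᵥ (u ⨯₃ ω))) = 0 := by
    rw [dotProduct_smul, ← hB.dot_comm, ← smul_dotProduct, ← hω, dot_cross_self]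
  have h2 : (I + ρ • (1 : Mat)) *ᵥ ω = κ • u := by rw [hω, mulVec_smul, hB.mulVec_mulVec]
  have h3 : (I + ρ • (1 : Mat)) *ᵥ (κ • (B *ᵥ (u ⨯₃ ω))) = κ • (u ⨯₃ ω) := by
    rw [mulVec_smul, hB.mulVec_mulVec]
  rw [add_mulVec, smul_mulVec, one_mulVec] at h2 h3
  have h4 : (I *ᵥ ω) ⨯₃ ω = κ • (u ⨯₃ ω) := by
    rw [← LinearMap.map_smul₂, ← h2, LinearMap.map_add₂, LinearMap.map_smul₂, cross_self,
      smul_zero, add_zero]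
  rw [DynamicalEq, h1, zero_smul, zero_sub, h4, ← h3]
  simp

/-! ### Conservation laws and uniqueness of solutions -/

theorem eq_of_hasDerivAt_zero {V : Type*} [NormedAddCommGroup V] [NormedSpace ℝ V] {f : ℝ → V}
    (hf : ∀ t, HasDerivAt f 0 t) (s t : ℝ) : f s = f t :=
  is_const_of_deriv_eq_zero (fun t => (hf t).differentiableAt) (fun t => (hf t).deriv) s t

theorem hasDerivAt_prod_fst {V W : Type*} [NormedAddCommGroup V] [NormedSpace ℝ V]
    [NormedAddCommGroup W] [NormedSpace ℝ W] {γ : ℝ → V × W} {v : V} {w : W} {t : ℝ}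
    (h : HasDerivAt γ (v, w) t) : HasDerivAt (fun t => (γ t).1) v t :=
  (ContinuousLinearMap.fst ℝ V W).hasFDerivAt.comp_hasDerivAt t h

theorem hasDerivAt_prod_snd {V W : Type*} [NormedAddCommGroup V] [NormedSpace ℝ V]
    [NormedAddCommGroup W] [NormedSpace ℝ W] {γ : ℝ → V × W} {v : V} {w : W} {t : ℝ}
    (h : HasDerivAt γ (v, w) t) : HasDerivAt (fun t => (γ t).2) w t :=
  (ContinuousLinearMap.snd ℝ V W).hasFDerivAt.comp_hasDerivAt t h

theorem IsReducedSolution.hasDerivAt_fst {γ : ℝ → Vec × Vec} (hγ : IsReducedSolution I ρ γ)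
    (t : ℝ) : HasDerivAt (fun t => (γ t).1) ((γ t).1 ⨯₃ (γ t).2) t := by
  obtain ⟨-, ω', h, -⟩ := hγ t
  exact hasDerivAt_prod_fst h

/-- Both `I_{ρ,u} ω` and `u` move like body coordinates of vectors fixed in space, so `d = I_{ρ,u} ω
- j u` satisfies `d' = d × ω`. Its length is constant, and zero initially. -/
theorem IsReducedSolution.inertiaAt_mulVec {γ : ℝ → Vec × Vec} (hγ : IsReducedSolution I ρ γ)
    {j : ℝ} (h0 : inertiaAt I ρ (γ 0).1 *ᵥ (γ 0).2 = j • (γ 0).1) (t : ℝ) :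
    inertiaAt I ρ (γ t).1 *ᵥ (γ t).2 = j • (γ t).1 := by
  let d : ℝ → Vec := fun t => inertiaAt I ρ (γ t).1 *ᵥ (γ t).2 - j • (γ t).1
  have hd : ∀ t, HasDerivAt d (d t ⨯₃ (γ t).2) t := by
    intro t
    obtain ⟨hu, ω', h, hdyn⟩ := hγ t
    have hu' := hγ.hasDerivAt_fst t
    have hω' : HasDerivAt (fun t => (γ t).2) ω' t := hasDerivAt_prod_snd h
    have h1 := (((hasDerivAt_const_mulVec (I + ρ • (1 : Mat)) hω').sub
      (((hasDerivAt_dot hu' hω').const_mul ρ).smul hu')).sub (hu'.const_smul j))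
    refine (h1.congr_of_eventuallyEq (Filter.Eventually.of_forall fun t => ?_)).congr_deriv ?_
    · simp [d, ChaplyginSphere.inertiaAt_mulVec]
    · rw [DynamicalEq] at hdyn
      have e1 : (I + ρ • (1 : Mat)) *ᵥ ω' = (I *ᵥ (γ t).2) ⨯₃ (γ t).2 +
          (ρ * ((γ t).1 ⬝ᵥ ω')) • (γ t).1 := by
        rw [add_mulVec, smul_mulVec, one_mulVec, mul_smul, ← sub_eq_iff_eq_add']
        rw [smul_sub, ← sub_eq_zero] at hdyn
        rw [← sub_eq_zero, ← hdyn]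
        abel
      have e2 : ((γ t).1 ⨯₃ (γ t).2) ⬝ᵥ (γ t).2 = 0 := by
        rw [dotProduct_comm, dot_cross_self]
      simp only [d, ChaplyginSphere.inertiaAt_mulVec, e1, e2, add_mulVec, smul_mulVec, one_mulVec,
        LinearMap.map_sub₂, LinearMap.map_add₂, LinearMap.map_smul₂, cross_self]
      simp only [zero_add, smul_zero, add_zero]
      abel
  have hE : ∀ t, HasDerivAt (fun t => d t ⬝ᵥ d t) 0 t := fun t =>
    (hasDerivAt_dot (hd t) (hd t)).congr_deriv (by
      rw [dotProduct_comm, dot_self_cross, add_zero])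
  have h1 := eq_of_hasDerivAt_zero hE t 0
  have h2 : d 0 = 0 := sub_eq_zero.2 h0
  simp only [h2, dotProduct_zero] at h1
  exact sub_eq_zero.1 (dotProduct_self_eq_zero.1 h1)

/-- The factor of `B u` could vary only with `⟨u, B u⟩`, whose derivative `2 ⟨u × ω, B u⟩` vanishes
because `ω` is a multiple of `B u`. -/
theorem IsInertiaInverse.eq_of_isReducedSolution (hB : IsInertiaInverse I ρ B)
    {γ : ℝ → Vec × Vec} (hγ : IsReducedSolution I ρ γ) {j : ℝ}
    (h0 : inertiaAt I ρ (γ 0).1 *ᵥ (γ 0).2 = j • (γ 0).1) (t : ℝ) :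
    (γ t).2 = (j / (1 - ρ * ((γ 0).1 ⬝ᵥ (B *ᵥ (γ 0).1)))) • (B *ᵥ (γ t).1) := by
  have hω := fun t => (hB.inertiaAt_mulVec_eq_iff (hγ t).1 j).1 (hγ.inertiaAt_mulVec h0 t)
  have hg : ∀ t, HasDerivAt (fun t => (γ t).1 ⬝ᵥ (B *ᵥ (γ t).1)) 0 t := fun t => by
    have hu := hγ.hasDerivAt_fst t
    refine (hasDerivAt_dot hu (hasDerivAt_const_mulVec B hu)).congr_deriv ?_
    rw [← hB.dot_comm (γ t).1, dotProduct_comm (B *ᵥ (γ t).1), ← two_mul, hω t, map_smul,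
      smul_dotProduct, dotProduct_comm (_ ⨯₃ _), dot_cross_self, smul_zero, mul_zero]
  rw [hω t, eq_of_hasDerivAt_zero hg t 0]

theorem analyticAt_const_mulVec {X : Type*} [NormedAddCommGroup X] [NormedSpace ℝ X] (B : Mat)
    {b : X → Vec} {x : X} (hb : AnalyticAt ℝ b x) : AnalyticAt ℝ (fun x => B *ᵥ b x) x :=
  analyticAt_mulVec analyticAt_const hb

theorem IsInertiaInverse.isReducedSolution_unique (hB : IsInertiaInverse I ρ B)
    {γ₁ γ₂ : ℝ → Vec × Vec} (h₁ : IsReducedSolution I ρ γ₁) (h₂ : IsReducedSolution I ρ γ₂) {j : ℝ}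
    (h0 : inertiaAt I ρ (γ₁ 0).1 *ᵥ (γ₁ 0).2 = j • (γ₁ 0).1) (h : γ₁ 0 = γ₂ 0) : γ₁ = γ₂ := by
  set κ := j / (1 - ρ * ((γ₁ 0).1 ⬝ᵥ (B *ᵥ (γ₁ 0).1))) with hκ
  have hω₁ : ∀ t, (γ₁ t).2 = κ • (B *ᵥ (γ₁ t).1) := hB.eq_of_isReducedSolution h₁ h0
  have hω₂ : ∀ t, (γ₂ t).2 = κ • (B *ᵥ (γ₂ t).1) := by
    rw [hκ, h]
    exact hB.eq_of_isReducedSolution h₂ (h ▸ h0)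
  let v : Vec → Vec := fun u => u ⨯₃ (κ • (B *ᵥ u))
  have hv : ContDiff ℝ 1 v := contDiff_iff_contDiffAt.2 fun u =>
    (analyticAt_cross (b := fun u => κ • (B *ᵥ u)) analyticAt_id
      (analyticAt_const.fun_smul (analyticAt_const_mulVec B analyticAt_id))).contDiffAt
  -- The Euclidean unit sphere lies in the compact unit ball of the sup norm, where the quadratic
  -- field `v` is Lipschitz.
  have hsub : ∀ u : Vec, u ⬝ᵥ u = 1 → u ∈ Metric.closedBall (0 : Vec) 1 := by
    intro u hu
    rw [mem_closedBall_zero_iff, pi_norm_le_iff_of_nonneg zero_le_one]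
    intro i
    rw [Real.norm_eq_abs, ← sq_le_one_iff_abs_le_one, ← hu]
    simp only [dotProduct, sq]
    exact Finset.single_le_sum (f := fun i => u i * u i) (fun i _ => mul_self_nonneg _)
      (Finset.mem_univ i)
  obtain ⟨L, hL⟩ := hv.locallyLipschitz.locallyLipschitzOn.exists_lipschitzOnWith_of_compact
    (isCompact_closedBall (0 : Vec) 1)
  have hu : (fun t => (γ₁ t).1) = fun t => (γ₂ t).1 := by
    refine ODE_solution_unique_univ (v := fun _ => v) (K := L)
      (s := fun _ => Metric.closedBall (0 : Vec) 1) (t₀ := 0)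
      (fun _ => hL) (fun t => ⟨?_, hsub _ (h₁ t).1⟩) (fun t => ⟨?_, hsub _ (h₂ t).1⟩) ?_
    · simp only [v, ← hω₁]
      exact h₁.hasDerivAt_fst t
    · simp only [v, ← hω₂]
      exact h₂.hasDerivAt_fst t
    · simp only [h]
  funext t
  refine Prod.ext (congrFun hu t) ?_
  rw [hω₁, hω₂, congrFun hu t]

theorem IsRotSolution.reduce {γ : ℝ → Mat × Vec} (hγ : IsRotSolution I ρ γ) :
    IsReducedSolution I ρ fun t => reduce (γ t) := by
  intro t
  obtain ⟨hA, ω', h, hdyn⟩ := hγ t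
  refine ⟨vert_dot_vert hA, ω', ?_, hdyn⟩
  have hA' := hasDerivAt_prod_fst h
  have hω' := hasDerivAt_prod_snd h
  have := (hasDerivAt_vert hA').prodMk hω'
  exact this.congr_deriv (by rw [vert_mul_hat]; rfl)

theorem IsInertiaInverse.isRotSolution_unique (hB : IsInertiaInverse I ρ B)
    {γ₁ γ₂ : ℝ → Mat × Vec} (h₁ : IsRotSolution I ρ γ₁) (h₂ : IsRotSolution I ρ γ₂) {j : ℝ}
    (h0 : moment I ρ (γ₁ 0).1 (γ₁ 0).2 = j • e₃) (h : γ₁ 0 = γ₂ 0) : γ₁ = γ₂ := by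
  have hr := hB.isReducedSolution_unique h₁.reduce h₂.reduce
    ((moment_eq_iff (h₁ 0).1).1 h0) (by simp only [h])
  have hω : ∀ t, (γ₁ t).2 = (γ₂ t).2 := fun t => by
    have := congrFun hr t
    exact congrArg Prod.snd (a₁ := reduce (γ₁ t)) (a₂ := reduce (γ₂ t)) this
  -- With a common `ω`, the two contributions cancel by antisymmetry of `hat ω`.
  have hconst : ∀ t, HasDerivAt (fun t => (γ₁ t).1 * ((γ₂ t).1)ᵀ) 0 t := by
    intro t
    obtain ⟨-, ω₁, hd₁, -⟩ := h₁ t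
    obtain ⟨-, ω₂, hd₂, -⟩ := h₂ t
    have hA₁ := hasDerivAt_prod_fst hd₁
    have hA₂ := hasDerivAt_prod_fst hd₂
    refine (hasDerivAt_mul hA₁ (hasDerivAt_transpose hA₂)).congr_deriv ?_
    simp [hω t, hat_transpose, Matrix.mul_assoc]
  funext t
  refine Prod.ext ?_ (hω t)
  have h1 := eq_of_hasDerivAt_zero hconst t 0
  simp only [h, mul_transpose_of_mem (h₂ 0).1] at h1
  calc (γ₁ t).1 = (γ₁ t).1 * (((γ₂ t).1)ᵀ * (γ₂ t).1) := by rw [(h₂ t).1.1, Matrix.mul_one]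
    _ = (γ₂ t).1 := by rw [← Matrix.mul_assoc, h1, Matrix.one_mul]

theorem IsFullSolution.isRotSolution {m r : ℝ} {γ : ℝ → Mat × Vec × Plane}
    (hγ : IsFullSolution I m r γ) :
    IsRotSolution I (m * r ^ 2) fun t => ((γ t).1, (γ t).2.1) := by
  intro t
  obtain ⟨hA, ω', h, hdyn⟩ := hγ t
  exact ⟨hA, ω', (hasDerivAt_prod_fst h).prodMk (hasDerivAt_prod_fst (hasDerivAt_prod_snd h)),
    hdyn⟩

theorem IsFullSolution.hasDerivAt_position {m r : ℝ} {γ : ℝ → Mat × Vec × Plane}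
    (hγ : IsFullSolution I m r γ) (t : ℝ) :
    HasDerivAt (fun t => (γ t).2.2) (contactVelocity r (γ t).1 (γ t).2.1) t := by
  obtain ⟨hA, ω', h, hdyn⟩ := hγ t
  exact hasDerivAt_prod_snd (hasDerivAt_prod_snd h)

theorem IsInertiaInverse.isFullSolution_unique {m r : ℝ} (hB : IsInertiaInverse I (m * r ^ 2) B)
    {γ₁ γ₂ : ℝ → Mat × Vec × Plane} (h₁ : IsFullSolution I m r γ₁) (h₂ : IsFullSolution I m r γ₂)
    {j : ℝ} (h0 : moment I (m * r ^ 2) (γ₁ 0).1 (γ₁ 0).2.1 = j • e₃) (h : γ₁ 0 = γ₂ 0) :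
    γ₁ = γ₂ := by
  have hr := hB.isRotSolution_unique h₁.isRotSolution h₂.isRotSolution h0 (by simp only [h])
  have hA : ∀ t, (γ₁ t).1 = (γ₂ t).1 := fun t =>
    (Prod.mk.inj (congrFun hr t)).1
  have hω : ∀ t, (γ₁ t).2.1 = (γ₂ t).2.1 := fun t => (Prod.mk.inj (congrFun hr t)).2
  have hd : ∀ t, HasDerivAt (fun t => (γ₁ t).2.2 - (γ₂ t).2.2) 0 t := fun t =>
    ((h₁.hasDerivAt_position t).sub (h₂.hasDerivAt_position t)).congr_deriv (by
      rw [hA, hω, sub_self])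
  funext t
  refine Prod.ext (hA t) (Prod.ext (hω t) ?_)
  have := eq_of_hasDerivAt_zero hd t 0
  simp only [h, sub_self] at this
  exact sub_eq_zero.1 this

/-- If the rotational motion has period `P`, then the point of contact drifts at a constant rate,
up to a motion of period `P`. -/
theorem IsFullSolution.exists_drift {m r : ℝ} {γ : ℝ → Mat × Vec × Plane}
    (hγ : IsFullSolution I m r γ) {P : ℝ} (hP : P ≠ 0)
    (hper : Function.Periodic (fun t => ((γ t).1, (γ t).2.1)) P) :
    ∃ (w : Plane) (q : ℝ → Plane), Function.Periodic q P ∧ ∀ t, (γ t).2.2 = t • w + q t := by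
  -- The contact velocity depends only on `(A, ω)`, so the displacement over one period is
  -- independent of its starting time.
  have hd : ∀ t, HasDerivAt (fun t => (γ (t + P)).2.2 - (γ t).2.2) 0 t := fun t => by
    refine (((hγ.hasDerivAt_position (t + P)).comp_add_const t P).sub
      (hγ.hasDerivAt_position t)).congr_deriv ?_
    have h1 : (γ (t + P)).1 = (γ t).1 := (Prod.mk.inj (hper t)).1
    have h2 : (γ (t + P)).2.1 = (γ t).2.1 := (Prod.mk.inj (hper t)).2
    rw [h1, h2, sub_self]
  let w : Plane := P⁻¹ • ((γ (0 + P)).2.2 - (γ 0).2.2)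
  refine ⟨w, fun t => (γ t).2.2 - t • w, fun t => ?_, fun t => by simp⟩
  have h1 : (γ (t + P)).2.2 - (γ t).2.2 = P • w := by
    rw [smul_inv_smul₀ hP]
    exact eq_of_hasDerivAt_zero hd t 0
  simp only
  rw [add_smul, ← h1]
  abel

end

/-! ### Tori swept out by rotating trajectories about the vertical -/

/-- An analytic family of trajectories `x ↦ G (x, ε)` of the rotational motion, parametrized
uniformly with period one up to a rotation by `2 π θ ε` about the vertical axis. The velocity of
the parameter is `1 / K ε`, and `U` singles out a component of the level sets. -/
structure IsTrajectoryFamily (I : Mat) (ρ : ℝ) (E : Set (ℝ × ℝ)) (G : ℝ × (ℝ × ℝ) → Mat × Vec)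
    (θ K : ℝ × ℝ → ℝ) (U : Set Vec) : Prop where
  isOpen_param : IsOpen E
  isOpen_region : IsOpen U
  analytic : AnalyticOnNhd ℝ G (Set.univ ×ˢ E)
  analytic_angle : AnalyticOnNhd ℝ θ E
  analytic_period : AnalyticOnNhd ℝ K E
  period_ne_zero : ∀ ε ∈ E, K ε ≠ 0
  mem_levelSet : ∀ x, ∀ ε ∈ E, G (x, ε) ∈ levelSet I ρ (ε.1 • e₃) ε.2
  add_one : ∀ x, ∀ ε ∈ E, G (x + 1, ε) = (rotVertical (θ ε) * (G (x, ε)).1, (G (x, ε)).2)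
  velocity : ∀ x, ∀ ε ∈ E, ∃ ω' : Vec,
    HasDerivAt (fun x => G (x, ε)) (K ε • ((G (x, ε)).1 * hat (G (x, ε)).2), K ε • ω') x ∧
      DynamicalEq I ρ (vert (G (x, ε)).1) (G (x, ε)).2 ω'
  injective : ∀ ε ∈ E, ∀ x y, vert (G (x, ε)).1 = vert (G (y, ε)).1 → ∃ n : ℤ, x = y + n
  mem_region : ∀ x, ∀ ε ∈ E, vert (G (x, ε)).1 ∈ U
  surjective : ∀ ε ∈ E, ∀ z ∈ levelSet I ρ (ε.1 • e₃) ε.2, vert z.1 ∈ U →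
    ∃ x, vert z.1 = vert (G (x, ε)).1
  cross_ne_zero : ∀ x, ∀ ε ∈ E, vert (G (x, ε)).1 ⨯₃ (G (x, ε)).2 ≠ 0

/-- The tori swept out by the rotations of a family of trajectories about the vertical axis. -/
noncomputable def rotTorus (G : ℝ × (ℝ × ℝ) → Mat × Vec) (θ : ℝ × ℝ → ℝ) :
    (Fin 2 → ℝ) × (ℝ × ℝ) → Mat × Vec :=
  fun z => (rotVertical (z.1 0 - θ z.2 * z.1 1) * (G (z.1 1, z.2)).1, (G (z.1 1, z.2)).2)

/-- The frequencies of the motion on the tori `rotTorus G θ`. -/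
noncomputable def torusFrequency (θ K : ℝ × ℝ → ℝ) : ℝ × ℝ → Fin 2 → ℝ :=
  fun ε => ![θ ε * (K ε)⁻¹, (K ε)⁻¹]

/-- The vertical component of the moment, together with the energy. -/
noncomputable def momentEnergy (I : Mat) (ρ : ℝ) (z : Mat × Vec) : ℝ × ℝ :=
  (moment I ρ z.1 z.2 2, energy I ρ (vert z.1) z.2)

section

variable {I : Mat} {ρ : ℝ}

theorem analyticAt_prod_fst {X V W : Type*} [NormedAddCommGroup X] [NormedSpace ℝ X]
    [NormedAddCommGroup V] [NormedSpace ℝ V] [NormedAddCommGroup W] [NormedSpace ℝ W]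
    {f : X → V × W} {x : X} (hf : AnalyticAt ℝ f x) : AnalyticAt ℝ (fun x => (f x).1) x :=
  analyticAt_fst.comp_of_eq hf rfl

theorem analyticAt_prod_snd {X V W : Type*} [NormedAddCommGroup X] [NormedSpace ℝ X]
    [NormedAddCommGroup V] [NormedSpace ℝ V] [NormedAddCommGroup W] [NormedSpace ℝ W]
    {f : X → V × W} {x : X} (hf : AnalyticAt ℝ f x) : AnalyticAt ℝ (fun x => (f x).2) x :=
  analyticAt_snd.comp_of_eq hf rfl

theorem analyticAt_vert {X : Type*} [NormedAddCommGroup X] [NormedSpace ℝ X] {A : X → Mat} {x : X}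
    (hA : AnalyticAt ℝ A x) : AnalyticAt ℝ (fun x => vert (A x)) x := by
  refine analyticAt_mulVec ?_ analyticAt_const
  rw [analyticAt_mat_iff] at hA ⊢
  exact fun i j => hA j i

theorem analyticAt_momentEnergy (I : Mat) (ρ : ℝ) (z : Mat × Vec) :
    AnalyticAt ℝ (momentEnergy I ρ) z := by
  have hA : AnalyticAt ℝ (fun z : Mat × Vec => z.1) z := analyticAt_fst
  have hω : AnalyticAt ℝ (fun z : Mat × Vec => z.2) z := analyticAt_snd
  have hu := analyticAt_vert hA
  have hm : AnalyticAt ℝ (fun z : Mat × Vec => moment I ρ z.1 z.2) z := by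
    simp only [moment, inertiaAt_mulVec]
    exact analyticAt_mulVec hA ((analyticAt_const_mulVec _ hω).fun_sub
      ((analyticAt_const.fun_mul (analyticAt_dot hu hω)).fun_smul hu))
  have hm2 : AnalyticAt ℝ (fun z : Mat × Vec => moment I ρ z.1 z.2 2) z :=
    (analyticAt_pi_iff (f := fun i (z : Mat × Vec) => moment I ρ z.1 z.2 i)).1 hm 2
  have hc := analyticAt_cross hu hω
  exact hm2.prod ((analyticAt_const.fun_mul (analyticAt_dot (analyticAt_const_mulVec I hω) hω)).add
    (analyticAt_const.fun_mul (analyticAt_dot hc hc)))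

theorem continuous_momentEnergy (I : Mat) (ρ : ℝ) : Continuous (momentEnergy I ρ) :=
  continuous_iff_continuousAt.2 fun z => (analyticAt_momentEnergy I ρ z).continuousAt

theorem momentEnergy_of_mem {ε : ℝ × ℝ} {z : Mat × Vec}
    (hz : z ∈ levelSet I ρ (ε.1 • e₃) ε.2) : momentEnergy I ρ z = ε := by
  obtain ⟨-, hm, hT⟩ := hz
  refine Prod.ext ?_ hT
  simp [momentEnergy, hm, e₃]

theorem mem_levelSet_of_mem_verticalRot {z : Mat × Vec} (hz : z ∈ verticalRot I ρ) :
    z ∈ levelSet I ρ ((momentEnergy I ρ z).1 • e₃) (momentEnergy I ρ z).2 := by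
  obtain ⟨hA, h, hm⟩ := hz
  refine ⟨hA, ?_, rfl⟩
  simp [momentEnergy, hm, e₃]

theorem mem_verticalRot_of_mem {j T : ℝ} {z : Mat × Vec} (hz : z ∈ levelSet I ρ (j • e₃) T) :
    z ∈ verticalRot I ρ := ⟨hz.1, j, hz.2.1⟩

theorem rotVertical_mem_levelSet {j T : ℝ} {z : Mat × Vec} (hz : z ∈ levelSet I ρ (j • e₃) T)
    (y : ℝ) : (rotVertical y * z.1, z.2) ∈ levelSet I ρ (j • e₃) T := by
  obtain ⟨hA, hm, hT⟩ := hz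
  have hRA := mul_mem (rotVertical_mem y) hA
  refine ⟨hRA, (moment_eq_iff hRA).2 ?_, ?_⟩
  · simp only [vert_rotVertical_mul]
    exact (moment_eq_iff hA).1 hm
  · simp only [vert_rotVertical_mul]
    exact hT

/-- On a level set the direction of the vertical determines the state up to a rotation. -/
theorem exists_rotVertical_of_vert_eq {B : Mat} (hB : IsInertiaInverse I ρ B) {j T : ℝ}
    {z z' : Mat × Vec} (hz : z ∈ levelSet I ρ (j • e₃) T) (hz' : z' ∈ levelSet I ρ (j • e₃) T)
    (h : vert z.1 = vert z'.1) : ∃ y, z = (rotVertical y * z'.1, z'.2) := by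
  obtain ⟨y, hy⟩ := exists_eq_rotVertical (mul_mem hz.1 (transpose_mem hz'.1)) (by
    rw [vert, transpose_mul, transpose_transpose, ← mulVec_mulVec]
    change z'.1 *ᵥ vert z.1 = e₃
    rw [h, mulVec_vert hz'.1])
  refine ⟨y, Prod.ext ?_ ?_⟩
  · simp only
    rw [← hy, Matrix.mul_assoc, hz'.1.1, Matrix.mul_one]
  · have h1 := (hB.inertiaAt_mulVec_eq_iff (vert_dot_vert hz.1) j).1 ((moment_eq_iff hz.1).1 hz.2.1)
    have h2 := (hB.inertiaAt_mulVec_eq_iff (vert_dot_vert hz'.1) j).1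
      ((moment_eq_iff hz'.1).1 hz'.2.1)
    simp only
    rw [h1, h2, h]

namespace IsTrajectoryFamily

variable {E : Set (ℝ × ℝ)} {G : ℝ × (ℝ × ℝ) → Mat × Vec} {θ K : ℝ × ℝ → ℝ} {U : Set Vec}

theorem mono (h : IsTrajectoryFamily I ρ E G θ K U) {E' : Set (ℝ × ℝ)} (hE' : IsOpen E')
    (hsub : E' ⊆ E) : IsTrajectoryFamily I ρ E' G θ K U where
  isOpen_param := hE'
  isOpen_region := h.isOpen_region
  analytic := h.analytic.mono (Set.prod_mono le_rfl hsub)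
  analytic_angle := h.analytic_angle.mono hsub
  analytic_period := h.analytic_period.mono hsub
  period_ne_zero ε hε := h.period_ne_zero ε (hsub hε)
  mem_levelSet x ε hε := h.mem_levelSet x ε (hsub hε)
  add_one x ε hε := h.add_one x ε (hsub hε)
  velocity x ε hε := h.velocity x ε (hsub hε)
  injective ε hε := h.injective ε (hsub hε)
  mem_region x ε hε := h.mem_region x ε (hsub hε)
  surjective ε hε := h.surjective ε (hsub hε)
  cross_ne_zero x ε hε := h.cross_ne_zero x ε (hsub hε)

theorem add_int (h : IsTrajectoryFamily I ρ E G θ K U) (x : ℝ) {ε : ℝ × ℝ} (hε : ε ∈ E) (n : ℤ) :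
    G (x + n, ε) = (rotVertical (θ ε * n) * (G (x, ε)).1, (G (x, ε)).2) := by
  -- Turning back by the angle accumulated up to phase `x` gives a periodic function, which covers
  -- shifts by negative integers too.
  have hper : Function.Periodic
      (fun x => (rotVertical (-(θ ε * x)) * (G (x, ε)).1, (G (x, ε)).2)) 1 := fun x => by
    simp only [h.add_one x ε hε, ← Matrix.mul_assoc, ← rotVertical_add]
    congr 3
    ring
  have h1 := hper.int_mul n x
  simp only [mul_one, Prod.mk.injEq] at h1
  refine Prod.ext ?_ h1.2
  simp only
  have h2 : rotVertical (θ ε * (x + n)) * (rotVertical (-(θ ε * (x + n))) * (G (x + n, ε)).1) =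
      (G (x + n, ε)).1 := by
    rw [← Matrix.mul_assoc, ← rotVertical_add, add_neg_cancel, rotVertical_zero, Matrix.one_mul]
  rw [← h2, h1.1, ← Matrix.mul_assoc, ← rotVertical_add]
  congr 2
  ring

theorem rotTorus_mem_levelSet (h : IsTrajectoryFamily I ρ E G θ K U) (x : Fin 2 → ℝ) {ε : ℝ × ℝ}
    (hε : ε ∈ E) : rotTorus G θ (x, ε) ∈ levelSet I ρ (ε.1 • e₃) ε.2 :=
  rotVertical_mem_levelSet (h.mem_levelSet (x 1) ε hε) _

/-- Moment and energy recover the parameter, the direction `u` recovers `x 1` modulo one, and the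
remaining rotation recovers `x 0` modulo one. Conversely, the shear `-θ x₁` in `rotTorus` cancels
the twist acquired by the trajectory in one period. -/
theorem rotTorus_eq_iff (h : IsTrajectoryFamily I ρ E G θ K U) (x y : Fin 2 → ℝ) {ε δ : ℝ × ℝ}
    (hε : ε ∈ E) (hδ : δ ∈ E) : rotTorus G θ (x, ε) = rotTorus G θ (y, δ) ↔
      ε = δ ∧ ∃ k : Fin 2 → ℤ, ∀ i, x i = y i + k i := by
  constructor
  · intro heq
    have hεδ : ε = δ := by
      rw [← momentEnergy_of_mem (h.rotTorus_mem_levelSet x hε), heq,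
        momentEnergy_of_mem (h.rotTorus_mem_levelSet y hδ)]
    subst hεδ
    refine ⟨rfl, ?_⟩
    have h1 := congrArg (fun z : Mat × Vec => vert z.1) heq
    simp only [rotTorus, vert_rotVertical_mul] at h1
    obtain ⟨n, hn⟩ := h.injective ε hε _ _ h1
    have h2 := (Prod.mk.inj heq).1
    simp only [hn, h.add_int (y 1) hε n, ← Matrix.mul_assoc, ← rotVertical_add] at h2
    have hA := (h.mem_levelSet (y 1) ε hε).1
    have h3 := congrArg (fun M => M * ((G (y 1, ε)).1)ᵀ) h2
    simp only [Matrix.mul_assoc, mul_transpose_of_mem hA, Matrix.mul_one] at h3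
    obtain ⟨m, hm⟩ := rotVertical_eq_iff.1 h3
    refine ⟨![m, n], fun i => ?_⟩
    fin_cases i
    · simp only [Fin.zero_eta, cons_val_zero]
      linarith
    · simpa using hn
  · rintro ⟨rfl, k, hk⟩
    refine Prod.ext ?_ ?_
    · simp only [rotTorus, hk 1, h.add_int (y 1) hε (k 1), ← Matrix.mul_assoc, ← rotVertical_add]
      congr 1
      refine rotVertical_eq_iff.2 ⟨k 0, ?_⟩
      rw [hk 0]
      ring
    · simp only [rotTorus, hk 1, h.add_int (y 1) hε (k 1)]

theorem analytic_rotTorus (h : IsTrajectoryFamily I ρ E G θ K U) :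
    AnalyticOnNhd ℝ (rotTorus G θ) (Set.univ ×ˢ E) := by
  rintro ⟨x, ε⟩ ⟨-, hε⟩
  have h0 : ∀ i, AnalyticAt ℝ (fun z : (Fin 2 → ℝ) × (ℝ × ℝ) => z.1 i) (x, ε) :=
    (analyticAt_pi_iff (f := fun i (z : (Fin 2 → ℝ) × (ℝ × ℝ)) => z.1 i)).1 analyticAt_fst
  have hG : AnalyticAt ℝ (fun z : (Fin 2 → ℝ) × (ℝ × ℝ) => G (z.1 1, z.2)) (x, ε) :=
    (h.analytic (x 1, ε) ⟨trivial, hε⟩).comp_of_eq ((h0 1).prod analyticAt_snd) rfl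
  have hθ : AnalyticAt ℝ (fun z : (Fin 2 → ℝ) × (ℝ × ℝ) => θ z.2) (x, ε) :=
    (h.analytic_angle ε hε).comp_of_eq analyticAt_snd rfl
  exact (analyticAt_mul (analyticAt_rotVertical ((h0 0).fun_sub (hθ.fun_mul (h0 1))))
    (analyticAt_prod_fst hG)).prod (analyticAt_prod_snd hG)

theorem hasDerivAt_line (h : IsTrajectoryFamily I ρ E G θ K U) (x b t : ℝ) {ε : ℝ × ℝ}
    (hε : ε ∈ E) : ∃ ω' : Vec,
    HasDerivAt (fun t : ℝ => G (x + t * b, ε)) ((b * K ε) • ((G (x + t * b, ε)).1 *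
      hat (G (x + t * b, ε)).2), (b * K ε) • ω') t ∧
      DynamicalEq I ρ (vert (G (x + t * b, ε)).1) (G (x + t * b, ε)).2 ω' := by
  obtain ⟨ω', h1, h2⟩ := h.velocity (x + t * b) ε hε
  refine ⟨ω', ?_, h2⟩
  have h3 : HasDerivAt (fun t : ℝ => x + t * b) b t := by
    simpa using ((hasDerivAt_id t).mul_const b).const_add x
  refine (h1.scomp t h3).congr_deriv ?_
  simp [mul_smul]

/-- A kernel vector has no parameter component, because `momentEnergy` reads the parameter off.
Along the torus the derivative is infinitesimal rotation by a combination of `u` and `ω`, and these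
are linearly independent. -/
theorem immersion_rotTorus (h : IsTrajectoryFamily I ρ E G θ K U) (x : Fin 2 → ℝ) {ε : ℝ × ℝ}
    (hε : ε ∈ E) : Function.Injective (fderiv ℝ (rotTorus G θ) (x, ε)) := by
  rw [injective_iff_map_eq_zero]
  rintro ⟨dx, dε⟩ hv
  have hd : HasFDerivAt (rotTorus G θ) (fderiv ℝ (rotTorus G θ) (x, ε)) (x, ε) :=
    (h.analytic_rotTorus (x, ε) ⟨trivial, hε⟩).differentiableAt.hasFDerivAt
  have hdε : dε = 0 := by
    have h1 := (analyticAt_momentEnergy I ρ (rotTorus G θ (x, ε))).differentiableAt.hasFDerivAt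
    have h2 := h1.comp (x, ε) hd
    have h3 : HasFDerivAt (momentEnergy I ρ ∘ rotTorus G θ)
        (ContinuousLinearMap.snd ℝ (Fin 2 → ℝ) (ℝ × ℝ)) (x, ε) := by
      refine hasFDerivAt_snd.congr_of_eventuallyEq ?_
      have hev : ∀ᶠ z in nhds (x, ε), z.2 ∈ E :=
        continuousAt_snd.eventually (h.isOpen_param.mem_nhds hε)
      exact hev.mono fun z hz => momentEnergy_of_mem (h.rotTorus_mem_levelSet z.1 hz)
    have h4 : fderiv ℝ (momentEnergy I ρ) (rotTorus G θ (x, ε))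
        (fderiv ℝ (rotTorus G θ) (x, ε) (dx, dε)) = dε :=
      DFunLike.congr_fun (h2.unique h3) (dx, dε)
    rw [hv, map_zero] at h4
    exact h4.symm
  subst hdε
  have hline : HasDerivAt (fun t : ℝ => ((x + t • dx, ε) : (Fin 2 → ℝ) × (ℝ × ℝ))) (dx, 0) 0 := by
    have h1 : HasDerivAt (fun t : ℝ => x + t • dx) dx 0 := by
      simpa using ((hasDerivAt_id (0 : ℝ)).smul_const dx).const_add x
    exact h1.prodMk (hasDerivAt_const _ _)
  have hzero : HasDerivAt (fun t : ℝ => rotTorus G θ (x + t • dx, ε)) 0 0 := by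
    rw [← hv]
    exact HasFDerivAt.comp_hasDerivAt_of_eq 0 hd hline (by simp)
  obtain ⟨ω', h1, -⟩ := h.hasDerivAt_line (x 1) (dx 1) 0 hε
  have hy : HasDerivAt (fun t : ℝ => (x 0 + t * dx 0) - θ ε * (x 1 + t * dx 1))
      (dx 0 - θ ε * dx 1) 0 := by
    have h0 : ∀ i, HasDerivAt (fun t : ℝ => x i + t * dx i) (dx i) 0 := fun i => by
      simpa using ((hasDerivAt_id (0 : ℝ)).mul_const (dx i)).const_add (x i)
    exact (h0 0).sub ((h0 1).const_mul _)
  have h2 := hasDerivAt_mul (hasDerivAt_rotVertical hy) (hasDerivAt_prod_fst h1)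
  have h3 : HasDerivAt (fun t : ℝ => (rotTorus G θ (x + t • dx, ε)).1) 0 0 := by
    have : HasDerivAt (fun t : ℝ => rotTorus G θ (x + t • dx, ε)) ((0 : Mat), (0 : Vec)) 0 := hzero
    exact hasDerivAt_prod_fst this
  have h4 := h2.unique h3
  simp only [zero_mul, add_zero] at h4
  set A := (G (x 1, ε)).1
  set ω := (G (x 1, ε)).2
  have hA : A ∈ SO3 := (h.mem_levelSet (x 1) ε hε).1
  set R := rotVertical (x 0 - θ ε * x 1)
  have hR : R ∈ SO3 := rotVertical_mem _
  have hRA : R * A ∈ SO3 := mul_mem hR hA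
  have hu : vert (R * A) = vert A := vert_rotVertical_mul _ _
  have h5 : (R * A) * hat ((2 * Real.pi * (dx 0 - θ ε * dx 1)) • vert A + (dx 1 * K ε) • ω) = 0 := by
    rw [← h4, hat_add, hat_smul, hat_smul, Matrix.mul_add, Matrix.mul_smul, Matrix.mul_smul,
      Matrix.smul_mul, Matrix.mul_smul, Matrix.mul_assoc (hat e₃), hat_e₃_mul hRA, hu,
      Matrix.mul_assoc R A, Matrix.mul_assoc R A]
  have h6 : (2 * Real.pi * (dx 0 - θ ε * dx 1)) • vert A + (dx 1 * K ε) • ω = 0 := by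
    apply hat_eq_zero
    have := congrArg (fun M => (R * A)ᵀ * M) h5
    simpa only [← Matrix.mul_assoc, hRA.1, Matrix.one_mul, Matrix.mul_zero] using this
  -- The cross product with `u` removes the vertical term and isolates `dx 1`.
  have h7 : (dx 1 * K ε) • (vert A ⨯₃ ω) = 0 := by
    have := congrArg (fun a => vert A ⨯₃ a) h6
    simpa using this
  have h8 : dx 1 = 0 := by
    rcases smul_eq_zero.1 h7 with h' | h'
    · exact (mul_eq_zero.1 h').resolve_right (h.period_ne_zero ε hε)
    · exact absurd h' (h.cross_ne_zero (x 1) ε hε)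
  rw [h8] at h6
  have hu0 : vert A ≠ 0 := fun h' => by
    have := vert_dot_vert hA
    rw [h'] at this
    simp at this
  have h9 : dx 0 = 0 := by
    simp only [mul_zero, sub_zero, zero_mul, zero_smul, add_zero] at h6
    rcases smul_eq_zero.1 h6 with h' | h'
    · exact (mul_eq_zero.1 h').resolve_left (by positivity)
    · exact absurd h' hu0
  refine Prod.ext (funext fun i => ?_) rfl
  fin_cases i
  · exact h9
  · exact h8

/-- The frequencies are chosen such that `x 0 - θ x 1` stays constant: the rotation is fixed and
only the phase along the trajectory advances. -/
theorem rotTorus_line (x : Fin 2 → ℝ) {ε : ℝ × ℝ} (t : ℝ) :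
    rotTorus G θ (x + t • torusFrequency θ K ε, ε) =
      (rotVertical (x 0 - θ ε * x 1) * (G (x 1 + t * (K ε)⁻¹, ε)).1,
        (G (x 1 + t * (K ε)⁻¹, ε)).2) := by
  simp only [rotTorus, torusFrequency, Pi.add_apply, Pi.smul_apply, smul_eq_mul, cons_val_zero,
    cons_val_one]
  congr 3
  ring

theorem isRotSolution (h : IsTrajectoryFamily I ρ E G θ K U) (x : Fin 2 → ℝ) {ε : ℝ × ℝ}
    (hε : ε ∈ E) :
    IsRotSolution I ρ fun t => rotTorus G θ (x + t • torusFrequency θ K ε, ε) := by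
  intro t
  obtain ⟨ω', h1, h2⟩ := h.hasDerivAt_line (x 1) (K ε)⁻¹ t hε
  simp only [rotTorus_line (G := G) (θ := θ) (K := K) x (ε := ε)]
  refine ⟨mul_mem (rotVertical_mem _) (h.mem_levelSet _ ε hε).1, ω', ?_, ?_⟩
  · rw [inv_mul_cancel₀ (h.period_ne_zero ε hε), one_smul, one_smul] at h1
    have h3 := hasDerivAt_mul (hasDerivAt_const t (rotVertical (x 0 - θ ε * x 1)))
      (hasDerivAt_prod_fst h1)
    refine (h3.prodMk (hasDerivAt_prod_snd h1)).congr_deriv ?_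
    rw [Matrix.zero_mul, zero_add, ← Matrix.mul_assoc]
  · rw [vert_rotVertical_mul]
    exact h2

theorem exists_rotTorus_eq {B : Mat} (hB : IsInertiaInverse I ρ B)
    (h : IsTrajectoryFamily I ρ E G θ K U) {ε : ℝ × ℝ} (hε : ε ∈ E) {z : Mat × Vec}
    (hz : z ∈ levelSet I ρ (ε.1 • e₃) ε.2) (hzU : vert z.1 ∈ U) :
    ∃ x, rotTorus G θ (x, ε) = z := by
  obtain ⟨x₁, hx₁⟩ := h.surjective ε hε z hz hzU
  obtain ⟨y, hy⟩ := exists_rotVertical_of_vert_eq hB hz (h.mem_levelSet x₁ ε hε) hx₁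
  refine ⟨![y + θ ε * x₁, x₁], ?_⟩
  rw [hy]
  simp [rotTorus]

/-- The image is cut out by conditions on `u` and the conserved quantities, which are open; this is
how the tori are seen to fill an open set of states with vertical moment. -/
theorem image_rotTorus {B : Mat} (hB : IsInertiaInverse I ρ B)
    (h : IsTrajectoryFamily I ρ E G θ K U) :
    rotTorus G θ '' (Set.univ ×ˢ E) =
      {z | momentEnergy I ρ z ∈ E ∧ vert z.1 ∈ U} ∩ verticalRot I ρ := by
  ext z
  constructor
  · rintro ⟨⟨x, ε⟩, ⟨-, hε⟩, rfl⟩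
    have hm := h.rotTorus_mem_levelSet x hε
    refine ⟨⟨?_, ?_⟩, mem_verticalRot_of_mem hm⟩
    · rw [momentEnergy_of_mem hm]
      exact hε
    · simp only [rotTorus, vert_rotVertical_mul]
      exact h.mem_region _ ε hε
  · rintro ⟨⟨hz, hzU⟩, hzV⟩
    obtain ⟨x, hx⟩ := h.exists_rotTorus_eq hB hz (mem_levelSet_of_mem_verticalRot hzV) hzU
    exact ⟨(x, _), ⟨trivial, hz⟩, hx⟩

theorem isOpen_momentEnergy_region (h : IsTrajectoryFamily I ρ E G θ K U) :
    IsOpen {z : Mat × Vec | momentEnergy I ρ z ∈ E ∧ vert z.1 ∈ U} :=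
  (h.isOpen_param.preimage (continuous_momentEnergy I ρ)).inter
    (h.isOpen_region.preimage (continuous_vert.comp continuous_fst))

theorem analytic_torusFrequency (h : IsTrajectoryFamily I ρ E G θ K U) :
    AnalyticOnNhd ℝ (torusFrequency θ K) E := by
  intro ε hε
  have hK := (h.analytic_period ε hε).fun_inv (h.period_ne_zero ε hε)
  refine AnalyticAt.pi (f := fun i ε => torusFrequency θ K ε i) fun i => ?_
  fin_cases i
  · exact (h.analytic_angle ε hε).mul hK
  · exact hK

/-- The rotational motion is quasiperiodic on the rotated trajectories. -/
theorem isQuasiperiodicFamily_rot {B : Mat} (hB : IsInertiaInverse I ρ B)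
    (h : IsTrajectoryFamily I ρ E G θ K U) :
    IsQuasiperiodicFamily (verticalRot I ρ) (IsRotSolution I ρ) E (rotTorus G θ)
      (torusFrequency θ K) where
  isOpen_param := h.isOpen_param
  analytic_map := h.analytic_rotTorus
  analytic_freq := h.analytic_torusFrequency
  eq_iff x y _ hε _ hδ := h.rotTorus_eq_iff x y hε hδ
  immersion x _ hε := h.immersion_rotTorus x hε
  isOpen_image := ⟨_, h.isOpen_momentEnergy_region, h.image_rotTorus hB⟩
  motion x _ hε := h.isRotSolution x hε

end IsTrajectoryFamily

end

/-! ### The contact point and the tori of the full system -/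

/-- The rotation of the horizontal plane by the angle `2 π y`. -/
noncomputable def rotPlane (y : ℝ) (p : Plane) : Plane :=
  ![Real.cos (2 * Real.pi * y) * p 0 - Real.sin (2 * Real.pi * y) * p 1,
    Real.sin (2 * Real.pi * y) * p 0 + Real.cos (2 * Real.pi * y) * p 1]

theorem rotPlane_add (x y : ℝ) (p : Plane) : rotPlane (x + y) p = rotPlane x (rotPlane y p) := by
  ext i
  fin_cases i <;> simp [rotPlane, mul_add, Real.cos_add, Real.sin_add] <;> ring

theorem rotPlane_zero (p : Plane) : rotPlane 0 p = p := by
  ext i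
  fin_cases i <;> simp [rotPlane]

theorem rotPlane_int (n : ℤ) (p : Plane) : rotPlane n p = p := by
  have h1 : Real.cos (2 * Real.pi * n) = 1 := (Real.cos_eq_one_iff _).2 ⟨n, by ring⟩
  have h2 : Real.sin (2 * Real.pi * n) = 0 := Real.sin_eq_zero_iff.2 ⟨2 * n, by push_cast; ring⟩
  ext i
  fin_cases i <;> simp [rotPlane, h1, h2]

theorem rotPlane_smul (y c : ℝ) (p : Plane) : rotPlane y (c • p) = c • rotPlane y p := by
  ext i
  fin_cases i <;> simp [rotPlane] <;> ring

theorem hasDerivAt_rotPlane (y : ℝ) {p : ℝ → Plane} {p' : Plane} {t : ℝ} (hp : HasDerivAt p p' t) :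
    HasDerivAt (fun t => rotPlane y (p t)) (rotPlane y p') t := by
  rw [hasDerivAt_pi] at hp ⊢
  intro i
  fin_cases i
  · exact ((hp 0).const_mul _).sub ((hp 1).const_mul _)
  · exact ((hp 0).const_mul _).add ((hp 1).const_mul _)

theorem analyticAt_rotPlane {X : Type*} [NormedAddCommGroup X] [NormedSpace ℝ X] {y : X → ℝ}
    {p : X → Plane} {x : X} (hy : AnalyticAt ℝ y x) (hp : AnalyticAt ℝ p x) :
    AnalyticAt ℝ (fun x => rotPlane (y x) (p x)) x := by
  have h : AnalyticAt ℝ (fun x => 2 * Real.pi * y x) x := analyticAt_const.mul hy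
  have hc : AnalyticAt ℝ (fun x => Real.cos (2 * Real.pi * y x)) x :=
    Real.analyticAt_cos.comp_of_eq h rfl
  have hs : AnalyticAt ℝ (fun x => Real.sin (2 * Real.pi * y x)) x :=
    Real.analyticAt_sin.comp_of_eq h rfl
  rw [analyticAt_pi_iff (f := fun i x => p x i)] at hp
  refine AnalyticAt.pi (f := fun i x => rotPlane (y x) (p x) i) fun i => ?_
  fin_cases i
  · exact (hc.mul (hp 0)).sub (hs.mul (hp 1))
  · exact (hs.mul (hp 0)).add (hc.mul (hp 1))

theorem contactVelocity_eq (r : ℝ) (A : Mat) (ω : Vec) :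
    contactVelocity r A ω = ![r * (A *ᵥ ω) 1, -(r * (A *ᵥ ω) 0)] := by
  ext i
  fin_cases i <;> simp [contactVelocity, cross_apply, e₃]

theorem contactVelocity_rotVertical_mul (r y : ℝ) (A : Mat) (ω : Vec) :
    contactVelocity r (rotVertical y * A) ω = rotPlane y (contactVelocity r A ω) := by
  rw [contactVelocity_eq, contactVelocity_eq, ← mulVec_mulVec]
  generalize A *ᵥ ω = x
  ext i
  fin_cases i <;> simp [rotPlane, rotVertical, mulVec, dotProduct, Fin.sum_univ_three] <;> ring

/-- The tori swept out by the rotations of a family of trajectories with contact points `σ`. -/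
noncomputable def fullTorus (G : ℝ × (ℝ × ℝ) → Mat × Vec) (θ : ℝ × ℝ → ℝ)
    (σ : ℝ × (ℝ × ℝ) → Plane) : (Fin 2 → ℝ) × (ℝ × ℝ) → Mat × Vec × Plane :=
  fun z => ((rotTorus G θ z).1, (rotTorus G θ z).2,
    rotPlane (z.1 0 - θ z.2 * z.1 1) (σ (z.1 1, z.2)))

/-- `σ` describes the motion of the contact point along a family of trajectories, rotated together
with the trajectory after one period. -/
structure IsContactFamily (r : ℝ) (E : Set (ℝ × ℝ)) (G : ℝ × (ℝ × ℝ) → Mat × Vec)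
    (θ K : ℝ × ℝ → ℝ) (σ : ℝ × (ℝ × ℝ) → Plane) : Prop where
  analytic : AnalyticOnNhd ℝ σ (Set.univ ×ˢ E)
  add_one : ∀ x, ∀ ε ∈ E, σ (x + 1, ε) = rotPlane (θ ε) (σ (x, ε))
  velocity : ∀ x, ∀ ε ∈ E, HasDerivAt (fun x => σ (x, ε))
    (K ε • contactVelocity r (G (x, ε)).1 (G (x, ε)).2) x

section

variable {I : Mat} {ρ r : ℝ} {E : Set (ℝ × ℝ)} {G : ℝ × (ℝ × ℝ) → Mat × Vec} {θ K : ℝ × ℝ → ℝ}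
  {σ : ℝ × (ℝ × ℝ) → Plane} {U : Set Vec}

theorem analyticAt_contactVelocity {X : Type*} [NormedAddCommGroup X] [NormedSpace ℝ X] (r : ℝ)
    {A : X → Mat} {ω : X → Vec} {x : X} (hA : AnalyticAt ℝ A x) (hω : AnalyticAt ℝ ω x) :
    AnalyticAt ℝ (fun x => contactVelocity r (A x) (ω x)) x := by
  have h := analyticAt_mulVec hA hω
  rw [analyticAt_pi_iff (f := fun i x => (A x *ᵥ ω x) i)] at h
  simp only [contactVelocity_eq]
  refine AnalyticAt.pi (f := fun i x => (![r * (A x *ᵥ ω x) 1, -(r * (A x *ᵥ ω x) 0)] : Plane) i)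
    fun i => ?_
  fin_cases i
  · exact analyticAt_const.mul (h 1)
  · exact (analyticAt_const.mul (h 0)).neg

/-- Away from resonance, the contact point can be placed such that it moves quasiperiodically. -/
theorem IsTrajectoryFamily.exists_isContactFamily (h : IsTrajectoryFamily I ρ E G θ K U) (r : ℝ)
    (hθ : ∀ ε ∈ E, Real.cos (2 * Real.pi * θ ε) ≠ 1) : ∃ σ, IsContactFamily r E G θ K σ := by
  let w : ℝ × (ℝ × ℝ) → Plane := fun z => K z.2 • contactVelocity r (G z).1 (G z).2
  have hw : AnalyticOnNhd ℝ w (Set.univ ×ˢ E) := fun z hz =>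
    ((h.analytic_period z.2 hz.2).comp_of_eq analyticAt_snd rfl).fun_smul
      (analyticAt_contactVelocity r (analyticAt_prod_fst (h.analytic z hz))
        (analyticAt_prod_snd (h.analytic z hz)))
  have hw1 : ∀ x, ∀ ε ∈ E, w (x + 1, ε) = rotPlane (θ ε) (w (x, ε)) := fun x ε hε => by
    simp only [w, h.add_one x ε hε, contactVelocity_rotVertical_mul, rotPlane_smul]
  let σ₁ : ℝ × (ℝ × ℝ) → Plane := fun z => ∫ s in (0 : ℝ)..z.1, w (s, z.2)
  have hσ₁ : AnalyticOnNhd ℝ σ₁ (Set.univ ×ˢ E) := hw.parametric_primitive h.isOpen_param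
  let W : ℝ × ℝ → Plane := fun ε => σ₁ (1, ε)
  have hW : AnalyticOnNhd ℝ W E := fun ε hε =>
    (hσ₁ (1, ε) ⟨trivial, hε⟩).comp_of_eq (f := fun ε => ((1 : ℝ), ε))
      (analyticAt_const.prod analyticAt_id) rfl
  -- The position at phase zero has to solve `σ₀ + W = R σ₀`, where `W` is the displacement in one
  -- period and `R` the rotation by `2 π θ`. Since `(R - 1) (R⁻¹ - 1) = 2 - 2 cos (2 π θ)`, the
  -- solution is `(R⁻¹ - 1) W` divided by this number.
  let σ₀ : ℝ × ℝ → Plane := fun ε =>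
    (2 - 2 * Real.cos (2 * Real.pi * θ ε))⁻¹ • (rotPlane (-θ ε) (W ε) - W ε)
  have hne : ∀ ε ∈ E, 2 - 2 * Real.cos (2 * Real.pi * θ ε) ≠ 0 := fun ε hε h0 =>
    hθ ε hε (by linarith)
  have hσ₀ : AnalyticOnNhd ℝ σ₀ E := by
    intro ε hε
    have h1 : AnalyticAt ℝ (fun ε => 2 * Real.pi * θ ε) ε :=
      analyticAt_const.mul (h.analytic_angle ε hε)
    have h2 : AnalyticAt ℝ (fun ε => Real.cos (2 * Real.pi * θ ε)) ε :=
      Real.analyticAt_cos.comp_of_eq h1 rfl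
    exact ((analyticAt_const.fun_sub (analyticAt_const.fun_mul h2)).fun_inv (hne ε hε)).fun_smul
      ((analyticAt_rotPlane (h.analytic_angle ε hε).fun_neg (hW ε hε)).fun_sub (hW ε hε))
  have hσ₀eq : ∀ ε ∈ E, σ₀ ε + W ε = rotPlane (θ ε) (σ₀ ε) := by
    intro ε hε
    have hn := hne ε hε
    have hcs := Real.sin_sq_add_cos_sq (2 * Real.pi * θ ε)
    have key : ∀ c s a b D : ℝ, s ^ 2 + c ^ 2 = 1 → D ≠ 0 → D = 2 - 2 * c →
        D⁻¹ * (c * a + s * b - a) + a =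
          c * (D⁻¹ * (c * a + s * b - a)) - s * (D⁻¹ * (-(s * a) + c * b - b)) ∧
        D⁻¹ * (-(s * a) + c * b - b) + b =
          s * (D⁻¹ * (c * a + s * b - a)) + c * (D⁻¹ * (-(s * a) + c * b - b)) := by
      intro c s a b D h1 hD hDc
      constructor
      · field_simp
        rw [hDc]
        linear_combination (-a) * h1
      · field_simp
        rw [hDc]
        linear_combination (-b) * h1
    obtain ⟨k1, k2⟩ := key _ _ (W ε 0) (W ε 1) _ hcs hn rfl
    have s0 : σ₀ ε 0 = (2 - 2 * Real.cos (2 * Real.pi * θ ε))⁻¹ *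
        (Real.cos (2 * Real.pi * θ ε) * W ε 0 + Real.sin (2 * Real.pi * θ ε) * W ε 1 - W ε 0) := by
      change _ * ((Real.cos (2 * Real.pi * -θ ε) * W ε 0 -
        Real.sin (2 * Real.pi * -θ ε) * W ε 1) - W ε 0) = _
      rw [mul_neg, Real.cos_neg, Real.sin_neg, neg_mul, sub_neg_eq_add]
    have s1 : σ₀ ε 1 = (2 - 2 * Real.cos (2 * Real.pi * θ ε))⁻¹ *
        (-(Real.sin (2 * Real.pi * θ ε) * W ε 0) + Real.cos (2 * Real.pi * θ ε) * W ε 1 - W ε 1) := by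
      change _ * ((Real.sin (2 * Real.pi * -θ ε) * W ε 0 +
        Real.cos (2 * Real.pi * -θ ε) * W ε 1) - W ε 1) = _
      rw [mul_neg, Real.cos_neg, Real.sin_neg, neg_mul]
    rw [← s0, ← s1] at k1 k2
    ext i
    fin_cases i
    · exact k1
    · exact k2
  have hvel : ∀ x, ∀ ε ∈ E, HasDerivAt (fun x => σ₀ ε + σ₁ (x, ε)) (w (x, ε)) x :=
    fun x ε hε => (hw.hasDerivAt_parametric_primitive hε x).const_add (σ₀ ε)
  refine ⟨fun z => σ₀ z.2 + σ₁ z, ?_, ?_, hvel⟩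
  · exact fun z hz => ((hσ₀ z.2 hz.2).comp_of_eq analyticAt_snd rfl).fun_add (hσ₁ z hz)
  · intro x ε hε
    -- Both positions have the same velocity, so it suffices to compare them at phase zero, where
    -- equality is the equation for `σ₀`.
    have hd : ∀ x, HasDerivAt
        (fun x => (σ₀ ε + σ₁ (x + 1, ε)) - rotPlane (θ ε) (σ₀ ε + σ₁ (x, ε))) 0 x := fun x => by
      refine (((hvel (x + 1) ε hε).comp_add_const x 1).sub
        (hasDerivAt_rotPlane (θ ε) (hvel x ε hε))).congr_deriv ?_
      rw [hw1 x ε hε, sub_self]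
    have h1 := eq_of_hasDerivAt_zero hd x 0
    have h2 : σ₁ (0, ε) = 0 := intervalIntegral.integral_same
    simp only [h2, add_zero, zero_add] at h1
    rw [show σ₁ (1, ε) = W ε from rfl, hσ₀eq ε hε, sub_self] at h1
    exact sub_eq_zero.1 h1

theorem IsContactFamily.add_int (hσ : IsContactFamily r E G θ K σ) (x : ℝ) {ε : ℝ × ℝ}
    (hε : ε ∈ E) (n : ℤ) : σ (x + n, ε) = rotPlane (θ ε * n) (σ (x, ε)) := by
  have hper : Function.Periodic (fun x => rotPlane (-(θ ε * x)) (σ (x, ε))) 1 := fun x => by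
    simp only [hσ.add_one x ε hε, ← rotPlane_add]
    congr 1
    ring
  have h1 := hper.int_mul n x
  simp only [mul_one] at h1
  have h2 : rotPlane (θ ε * (x + n)) (rotPlane (-(θ ε * (x + n))) (σ (x + n, ε))) =
      σ (x + n, ε) := by
    rw [← rotPlane_add, add_neg_cancel, rotPlane_zero]
  rw [← h2, h1, ← rotPlane_add]
  congr 1
  ring

theorem IsContactFamily.rotPlane_eq (hσ : IsContactFamily r E G θ K σ) {x y : Fin 2 → ℝ}
    {ε : ℝ × ℝ} (hε : ε ∈ E) (hxy : ∃ k : Fin 2 → ℤ, ∀ i, x i = y i + k i) :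
    rotPlane (x 0 - θ ε * x 1) (σ (x 1, ε)) = rotPlane (y 0 - θ ε * y 1) (σ (y 1, ε)) := by
  obtain ⟨k, hk⟩ := hxy
  rw [hk 1, hσ.add_int (y 1) hε, ← rotPlane_add, hk 0]
  have : y 0 + k 0 - θ ε * (y 1 + k 1) + θ ε * k 1 = (y 0 - θ ε * y 1) + (k 0 : ℤ) := by ring
  rw [this, rotPlane_add, rotPlane_int]

theorem translates_eq (z : (Fin 2 → ℝ) × ((ℝ × ℝ) × Plane)) :
    translates (fullTorus G θ σ) z = ((rotTorus G θ (z.1, z.2.1)).1, (rotTorus G θ (z.1, z.2.1)).2,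
      rotPlane (z.1 0 - θ z.2.1 * z.1 1) (σ (z.1 1, z.2.1)) + z.2.2) := by
  simp [translates, fullTorus]

theorem IsContactFamily.analytic_fullTorus (hσ : IsContactFamily r E G θ K σ)
    (h : IsTrajectoryFamily I ρ E G θ K U) :
    AnalyticOnNhd ℝ (fullTorus G θ σ) (Set.univ ×ˢ E) := by
  rintro ⟨x, ε⟩ hz
  have h1 := h.analytic_rotTorus _ hz
  have h0 : ∀ i, AnalyticAt ℝ (fun z : (Fin 2 → ℝ) × (ℝ × ℝ) => z.1 i) (x, ε) :=
    (analyticAt_pi_iff (f := fun i (z : (Fin 2 → ℝ) × (ℝ × ℝ)) => z.1 i)).1 analyticAt_fst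
  have h2 : AnalyticAt ℝ (fun z : (Fin 2 → ℝ) × (ℝ × ℝ) => σ (z.1 1, z.2)) (x, ε) :=
    (hσ.analytic (x 1, ε) ⟨trivial, hz.2⟩).comp_of_eq ((h0 1).prod analyticAt_snd) rfl
  have hθ : AnalyticAt ℝ (fun z : (Fin 2 → ℝ) × (ℝ × ℝ) => θ z.2) (x, ε) :=
    (h.analytic_angle ε hz.2).comp_of_eq analyticAt_snd rfl
  exact (analyticAt_prod_fst h1).prod ((analyticAt_prod_snd h1).prod
    (analyticAt_rotPlane ((h0 0).fun_sub (hθ.fun_mul (h0 1))) h2))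

theorem IsContactFamily.analytic_translates (hσ : IsContactFamily r E G θ K σ)
    (h : IsTrajectoryFamily I ρ E G θ K U) :
    AnalyticOnNhd ℝ (translates (fullTorus G θ σ)) (Set.univ ×ˢ (E ×ˢ Set.univ)) := by
  rintro ⟨x, ε, c⟩ ⟨-, hε, -⟩
  have hproj : AnalyticAt ℝ (fun z : (Fin 2 → ℝ) × ((ℝ × ℝ) × Plane) => (z.1, z.2.1))
      (x, ε, c) := analyticAt_fst.prod (analyticAt_prod_fst analyticAt_snd)
  have h1 : AnalyticAt ℝ (fun z : (Fin 2 → ℝ) × ((ℝ × ℝ) × Plane) => fullTorus G θ σ (z.1, z.2.1))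
      (x, ε, c) :=
    (hσ.analytic_fullTorus h (x, ε) ⟨trivial, hε⟩).comp_of_eq hproj rfl
  have h2 : AnalyticAt ℝ (fun z : (Fin 2 → ℝ) × ((ℝ × ℝ) × Plane) =>
      ((0, 0, z.2.2) : Mat × Vec × Plane)) (x, ε, c) :=
    analyticAt_const.prod (analyticAt_const.prod (analyticAt_prod_snd analyticAt_snd))
  exact h1.add h2

theorem IsContactFamily.translates_eq_iff (hσ : IsContactFamily r E G θ K σ)
    (h : IsTrajectoryFamily I ρ E G θ K U) (x y : Fin 2 → ℝ) {ε δ : (ℝ × ℝ) × Plane}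
    (hε : ε.1 ∈ E) (hδ : δ.1 ∈ E) :
    translates (fullTorus G θ σ) (x, ε) = translates (fullTorus G θ σ) (y, δ) ↔
      ε = δ ∧ ∃ k : Fin 2 → ℤ, ∀ i, x i = y i + k i := by
  obtain ⟨ε, c⟩ := ε
  obtain ⟨δ, d⟩ := δ
  simp only at hε hδ
  simp only [translates_eq, Prod.mk.injEq]
  have hrot := h.rotTorus_eq_iff x y hε hδ
  rw [Prod.ext_iff] at hrot
  constructor
  · rintro ⟨h1, h2, h3⟩
    obtain ⟨rfl, hk⟩ := hrot.1 ⟨h1, h2⟩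
    rw [hσ.rotPlane_eq hε hk] at h3
    exact ⟨⟨rfl, add_left_cancel h3⟩, hk⟩
  · rintro ⟨⟨rfl, rfl⟩, hk⟩
    obtain ⟨h1, h2⟩ := hrot.2 ⟨rfl, hk⟩
    exact ⟨h1, h2, by rw [hσ.rotPlane_eq hε hk]⟩

/-- Forgetting the contact point reduces the claim to `immersion_rotTorus`; the plane component then
detects the translation. -/
theorem IsContactFamily.immersion_translates (hσ : IsContactFamily r E G θ K σ)
    (h : IsTrajectoryFamily I ρ E G θ K U) (x : Fin 2 → ℝ) {ε : (ℝ × ℝ) × Plane} (hε : ε.1 ∈ E) :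
    Function.Injective (fderiv ℝ (translates (fullTorus G θ σ)) (x, ε)) := by
  obtain ⟨ε, c⟩ := ε
  simp only at hε
  rw [injective_iff_map_eq_zero]
  rintro ⟨dx, dε, dc⟩ hv
  set L := fderiv ℝ (translates (fullTorus G θ σ)) (x, ε, c)
  have hd : HasFDerivAt (translates (fullTorus G θ σ)) L (x, ε, c) :=
    (hσ.analytic_translates h (x, ε, c) ⟨trivial, hε, trivial⟩).differentiableAt.hasFDerivAt
  have hrot : HasFDerivAt (rotTorus G θ) (fderiv ℝ (rotTorus G θ) (x, ε)) (x, ε) :=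
    (h.analytic_rotTorus (x, ε) ⟨trivial, hε⟩).differentiableAt.hasFDerivAt
  have hproj : HasFDerivAt (fun z : (Fin 2 → ℝ) × ((ℝ × ℝ) × Plane) => (z.1, z.2.1))
      ((ContinuousLinearMap.fst ℝ (Fin 2 → ℝ) ((ℝ × ℝ) × Plane)).prod
        ((ContinuousLinearMap.fst ℝ (ℝ × ℝ) Plane).comp
          (ContinuousLinearMap.snd ℝ (Fin 2 → ℝ) ((ℝ × ℝ) × Plane)))) (x, ε, c) :=
    hasFDerivAt_fst.prodMk (hasFDerivAt_fst.comp _ hasFDerivAt_snd)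
  let π : (Mat × Vec × Plane) →L[ℝ] (Mat × Vec) :=
    (ContinuousLinearMap.fst ℝ Mat (Vec × Plane)).prod ((ContinuousLinearMap.fst ℝ Vec Plane).comp
      (ContinuousLinearMap.snd ℝ Mat (Vec × Plane)))
  have h1 : HasFDerivAt (fun z : (Fin 2 → ℝ) × ((ℝ × ℝ) × Plane) => rotTorus G θ (z.1, z.2.1))
      (π.comp L) (x, ε, c) := by
    refine (π.hasFDerivAt.comp _ hd).congr_of_eventuallyEq (Filter.Eventually.of_forall fun z => ?_)
    simp only [Function.comp_apply, translates_eq]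
    rfl
  have h2 := HasFDerivAt.comp (x, ε, c) (g := rotTorus G θ) hrot hproj
  have h3 : fderiv ℝ (rotTorus G θ) (x, ε) (dx, dε) = π (L (dx, dε, dc)) :=
    DFunLike.congr_fun (h2.unique h1) (dx, dε, dc)
  rw [hv, map_zero] at h3
  have h4 := (injective_iff_map_eq_zero _).1 (h.immersion_rotTorus x hε) _ h3
  obtain ⟨rfl, rfl⟩ := Prod.mk.inj h4
  have hline : HasDerivAt (fun t : ℝ => ((x, ε, c + t • dc) : (Fin 2 → ℝ) × ((ℝ × ℝ) × Plane)))
      (0, 0, dc) 0 := by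
    have h1 : HasDerivAt (fun t : ℝ => c + t • dc) dc 0 := by
      simpa using ((hasDerivAt_id (0 : ℝ)).smul_const dc).const_add c
    exact (hasDerivAt_const _ _).prodMk ((hasDerivAt_const _ _).prodMk h1)
  have hzero : HasDerivAt (fun t : ℝ => translates (fullTorus G θ σ) (x, ε, c + t • dc))
      ((0 : Mat), (0 : Vec), (0 : Plane)) 0 := by
    have := HasFDerivAt.comp_hasDerivAt_of_eq 0 hd hline (by simp)
    exact this.congr_deriv hv
  have h5 := hasDerivAt_prod_snd (hasDerivAt_prod_snd hzero)
  have h6 : HasDerivAt (fun t : ℝ => (translates (fullTorus G θ σ) (x, ε, c + t • dc)).2.2) dc 0 := by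
    simp only [translates_eq]
    have h1 : HasDerivAt (fun t : ℝ => c + t • dc) dc 0 := by
      simpa using ((hasDerivAt_id (0 : ℝ)).smul_const dc).const_add c
    exact h1.const_add _
  rw [h6.unique h5]
  rfl

/-- As `x 0 - θ x 1` is constant along the flow, trajectory and contact point are turned by the same
fixed angle, and the contact velocity is equivariant under such rotations. -/
theorem IsContactFamily.isFullSolution {m : ℝ} (hσ : IsContactFamily r E G θ K σ)
    (h : IsTrajectoryFamily I (m * r ^ 2) E G θ K U) (x : Fin 2 → ℝ) {ε : (ℝ × ℝ) × Plane}
    (hε : ε.1 ∈ E) :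
    IsFullSolution I m r fun t =>
      translates (fullTorus G θ σ) (x + t • torusFrequency θ K ε.1, ε) := by
  intro t
  obtain ⟨hA, ω', h1, h2⟩ := h.isRotSolution x hε t
  simp only [translates_eq]
  refine ⟨hA, ω', (hasDerivAt_prod_fst h1).prodMk ((hasDerivAt_prod_snd h1).prodMk ?_), h2⟩
  refine HasDerivAt.add_const _ ?_
  have e0 : ∀ t : ℝ, (x + t • torusFrequency θ K ε.1) 0 -
      θ ε.1 * (x + t • torusFrequency θ K ε.1) 1 = x 0 - θ ε.1 * x 1 := fun t => by
    simp only [torusFrequency, Pi.add_apply, Pi.smul_apply, smul_eq_mul, cons_val_zero,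
      cons_val_one]
    ring
  have e1 : ∀ t : ℝ, (x + t • torusFrequency θ K ε.1) 1 = x 1 + t * (K ε.1)⁻¹ := fun t => by
    simp [torusFrequency]
  rw [IsTrajectoryFamily.rotTorus_line, contactVelocity_rotVertical_mul]
  simp only [e0]
  simp only [e1]
  refine hasDerivAt_rotPlane _ ?_
  have h3 : HasDerivAt (fun t : ℝ => x 1 + t * (K ε.1)⁻¹) (K ε.1)⁻¹ t := by
    simpa using ((hasDerivAt_id t).mul_const (K ε.1)⁻¹).const_add (x 1)
  refine ((hσ.velocity (x 1 + t * (K ε.1)⁻¹) ε.1 hε).scomp t h3).congr_deriv ?_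
  rw [inv_smul_smul₀ (h.period_ne_zero ε.1 hε)]

theorem IsTrajectoryFamily.exists_translates_eq {B : Mat} (hB : IsInertiaInverse I ρ B)
    (h : IsTrajectoryFamily I ρ E G θ K U) {ε : ℝ × ℝ}
    (hε : ε ∈ E) {z : Mat × Vec × Plane} (hz : (z.1, z.2.1) ∈ levelSet I ρ (ε.1 • e₃) ε.2)
    (hzU : vert z.1 ∈ U) : ∃ x c, translates (fullTorus G θ σ) (x, ε, c) = z := by
  obtain ⟨x, hx⟩ := h.exists_rotTorus_eq hB hε hz hzU
  refine ⟨x, z.2.2 - rotPlane (x 0 - θ ε * x 1) (σ (x 1, ε)), ?_⟩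
  rw [translates_eq]
  simp [hx]

/-- The full motion is quasiperiodic on the rotated and translated trajectories. -/
theorem IsContactFamily.isQuasiperiodicFamily_full {m : ℝ} {B : Mat}
    (hB : IsInertiaInverse I (m * r ^ 2) B) (hσ : IsContactFamily r E G θ K σ)
    (h : IsTrajectoryFamily I (m * r ^ 2) E G θ K U) :
    IsQuasiperiodicFamily (verticalFull I (m * r ^ 2)) (IsFullSolution I m r) (E ×ˢ Set.univ)
      (translates (fullTorus G θ σ)) (fun δ => torusFrequency θ K δ.1) where
  isOpen_param := h.isOpen_param.prod isOpen_univ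
  analytic_map := hσ.analytic_translates h
  analytic_freq := fun δ hδ => (h.analytic_torusFrequency δ.1 hδ.1).comp_of_eq analyticAt_fst rfl
  eq_iff x y _ hε _ hδ := hσ.translates_eq_iff h x y hε.1 hδ.1
  immersion x _ hε := hσ.immersion_translates h x hε.1
  isOpen_image := by
    refine ⟨(fun z : Mat × Vec × Plane => (z.1, z.2.1)) ⁻¹'
      {z : Mat × Vec | momentEnergy I (m * r ^ 2) z ∈ E ∧ vert z.1 ∈ U},
      h.isOpen_momentEnergy_region.preimage (by fun_prop), ?_⟩
    ext z
    constructor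
    · rintro ⟨⟨x, ε, c⟩, ⟨-, hε, -⟩, rfl⟩
      have h1 : rotTorus G θ (x, ε) ∈ rotTorus G θ '' (Set.univ ×ˢ E) := ⟨_, ⟨trivial, hε⟩, rfl⟩
      rw [h.image_rotTorus hB] at h1
      rw [translates_eq]
      exact h1
    · rintro ⟨⟨hz, hzU⟩, hzV⟩
      obtain ⟨x, c, hx⟩ := h.exists_translates_eq hB (σ := σ) hz
        (mem_levelSet_of_mem_verticalRot hzV) hzU
      exact ⟨(x, _, c), ⟨trivial, hz, trivial⟩, hx⟩
  motion x _ hε := hσ.isFullSolution h x hε.1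

end

/-! ### Lifting level curves on the sphere to trajectories -/

/-- An analytic family of closed curves `s ↦ V (s, ε)` which parametrize the part in `U` of the
level curves on the sphere; `1 / k` is the velocity of the parameter `s`. -/
structure IsLevelCurve (ρ : ℝ) (B : Mat) (E : Set (ℝ × ℝ)) (V : ℝ × (ℝ × ℝ) → Vec)
    (k : ℝ × (ℝ × ℝ) → ℝ) (U : Set Vec) : Prop where
  isOpen_param : IsOpen E
  isOpen_region : IsOpen U
  moment_ne_zero : ∀ ε ∈ E, ε.1 ≠ 0
  denom_pos : ∀ ε ∈ E, 0 < ε.1 ^ 2 + 2 * ρ * ε.2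
  analytic : AnalyticOnNhd ℝ V (Set.univ ×ˢ E)
  analytic_slowness : AnalyticOnNhd ℝ k (Set.univ ×ˢ E)
  add_one : ∀ s ε, V (s + 1, ε) = V (s, ε)
  slowness_add_one : ∀ s ε, k (s + 1, ε) = k (s, ε)
  slowness_pos : ∀ s, ∀ ε ∈ E, 0 < k (0, ε) * k (s, ε)
  unit : ∀ s, ∀ ε ∈ E, V (s, ε) ⬝ᵥ V (s, ε) = 1
  level : ∀ s, ∀ ε ∈ E, V (s, ε) ⬝ᵥ (B *ᵥ V (s, ε)) = levelValue ρ ε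
  velocity : ∀ s, ∀ ε ∈ E, HasDerivAt (fun s => V (s, ε))
    (k (s, ε) • (V (s, ε) ⨯₃ (levelFactor ρ ε • (B *ᵥ V (s, ε))))) s
  injective : ∀ ε ∈ E, ∀ s t, V (s, ε) = V (t, ε) → ∃ n : ℤ, s = t + n
  mem_region : ∀ s, ∀ ε ∈ E, V (s, ε) ∈ U
  surjective : ∀ ε ∈ E, ∀ u : Vec, u ⬝ᵥ u = 1 → u ⬝ᵥ (B *ᵥ u) = levelValue ρ ε → u ∈ U →
    ∃ s, u = V (s, ε)
  cross_ne_zero : ∀ s, ∀ ε ∈ E, V (s, ε) ⨯₃ (B *ᵥ V (s, ε)) ≠ 0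

/-- The rotation whose inverse takes the vertical to `u` and the first unit vector to `q`. -/
def frameOf (u q : Vec) : Mat := Matrix.of ![q, u ⨯₃ q, u]

theorem vert_frameOf (u q : Vec) : vert (frameOf u q) = u := by
  ext i
  simp [vert, frameOf, e₃, mulVec, dotProduct, Fin.sum_univ_three]

theorem frameOf_mem {u q : Vec} (hu : u ⬝ᵥ u = 1) (hq : q ⬝ᵥ q = 1) (huq : u ⬝ᵥ q = 0) :
    frameOf u q ∈ SO3 := by
  have hqu : q ⬝ᵥ u = 0 := by rw [dotProduct_comm, huq]
  have hp : (u ⨯₃ q) ⬝ᵥ (u ⨯₃ q) = 1 := by rw [cross_dot_cross_self, hu, hq, huq]; norm_num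
  have h1 : u ⬝ᵥ (u ⨯₃ q) = 0 := dot_self_cross u q
  have h2 : q ⬝ᵥ (u ⨯₃ q) = 0 := dot_cross_self u q
  have h1' : (u ⨯₃ q) ⬝ᵥ u = 0 := by rw [dotProduct_comm, h1]
  have h2' : (u ⨯₃ q) ⬝ᵥ q = 0 := by rw [dotProduct_comm, h2]
  refine ⟨mul_eq_one_comm.1 ?_, ?_⟩
  · ext i j
    change (![q, u ⨯₃ q, u] i) ⬝ᵥ (![q, u ⨯₃ q, u] j) = _
    fin_cases i <;> fin_cases j <;> simp [hu, hq, huq, hqu, hp, h1, h2, h1', h2']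
  · change det ![q, u ⨯₃ q, u] = 1
    rw [← triple_product_eq_det, cross_cross_eq_smul_sub_smul, hu, hqu, one_smul, zero_smul,
      sub_zero, hq]

theorem analyticAt_frameOf {X : Type*} [NormedAddCommGroup X] [NormedSpace ℝ X] {u q : X → Vec}
    {x : X} (hu : AnalyticAt ℝ u x) (hq : AnalyticAt ℝ q x) :
    AnalyticAt ℝ (fun x => frameOf (u x) (q x)) x := by
  have hp := analyticAt_cross hu hq
  rw [analyticAt_pi_iff (f := fun i x => u x i)] at hu
  rw [analyticAt_pi_iff (f := fun i x => q x i)] at hq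
  rw [analyticAt_pi_iff (f := fun i x => (u x ⨯₃ q x) i)] at hp
  rw [analyticAt_mat_iff]
  intro i j
  fin_cases i
  · exact hq j
  · exact hp j
  · exact hu j

theorem cross_cross_add_cross_cross (u q ω : Vec) :
    (u ⨯₃ ω) ⨯₃ q + u ⨯₃ (q ⨯₃ ω) = (u ⨯₃ q) ⨯₃ ω := by
  ext i
  fin_cases i <;> simp [cross_apply] <;> ring

theorem mul_hat_row (S : Mat) (ω : Vec) (i : Fin 3) : (S * hat ω) i = (S i) ⨯₃ ω := by
  ext j
  fin_cases j <;> simp [hat, Matrix.mul_apply, cross_apply, Fin.sum_univ_three] <;> ring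

theorem hat_e₃_mul_eq (S : Mat) : hat e₃ * S = Matrix.of ![-S 1, S 0, 0] := by
  ext i j
  fin_cases i <;> simp [hat, e₃, Matrix.mul_apply, Fin.sum_univ_three]

/-- Without the term in `β` all rows would move as body coordinates of vectors fixed in space. The
term turns `q` and `u × q` about `u`, which for the frame is a rotation about `e₃`. -/
theorem hasDerivAt_frameOf {u q : ℝ → Vec} {ω : Vec} {k β s : ℝ}
    (hu : HasDerivAt u (k • (u s ⨯₃ ω)) s)
    (hq : HasDerivAt q (k • (q s ⨯₃ ω + β • (u s ⨯₃ q s))) s) (hun : u s ⬝ᵥ u s = 1)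
    (huq : u s ⬝ᵥ q s = 0) :
    HasDerivAt (fun s => frameOf (u s) (q s))
      (k • (frameOf (u s) (q s) * hat ω - β • (hat e₃ * frameOf (u s) (q s)))) s := by
  have hp := hasDerivAt_cross hu hq
  have hp' : HasDerivAt (fun s => u s ⨯₃ q s) (k • ((u s ⨯₃ q s) ⨯₃ ω - β • q s)) s := by
    refine hp.congr_deriv ?_
    have h1 : u s ⨯₃ (u s ⨯₃ q s) = - q s := by
      rw [cross_cross_eq_smul_sub_smul', huq, hun]
      simp
    rw [LinearMap.map_smul₂, map_smul, map_add, map_smul, h1, ← smul_add]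
    congr 1
    rw [← cross_cross_add_cross_cross (u s) (q s) ω]
    simp only [smul_neg]
    abel
  rw [hasDerivAt_pi] at hu hq hp'
  rw [hasDerivAt_mat_iff]
  intro i j
  change HasDerivAt _ (k * ((frameOf (u s) (q s) * hat ω) i j -
    β * (hat e₃ * frameOf (u s) (q s)) i j)) s
  rw [mul_hat_row, hat_e₃_mul_eq]
  fin_cases i
  · refine (hq j).congr_deriv ?_
    change _ = k * ((q s ⨯₃ ω) j - β * -((u s ⨯₃ q s) j))
    simp
  · refine (hp' j).congr_deriv ?_
    change _ = k * (((u s ⨯₃ q s) ⨯₃ ω) j - β * q s j)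
    simp
  · refine (hu j).congr_deriv ?_
    change _ = k * ((u s ⨯₃ ω) j - β * 0)
    simp

/-- The unit vector in the direction of `m`. -/
noncomputable def unitOf (m : Vec) : Vec := (√(m ⬝ᵥ m))⁻¹ • m

theorem dot_self_pos {m : Vec} (hm : m ≠ 0) : 0 < m ⬝ᵥ m :=
  lt_of_le_of_ne (dot_self_nonneg m) fun h => hm (dot_self_eq_zero_iff.1 h.symm)

theorem unitOf_dot_self {m : Vec} (hm : m ≠ 0) : unitOf m ⬝ᵥ unitOf m = 1 := by
  have h := dot_self_pos hm
  rw [unitOf, smul_dotProduct, dotProduct_smul, smul_eq_mul, smul_eq_mul, ← mul_assoc, ← mul_inv,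
    Real.mul_self_sqrt h.le, inv_mul_cancel₀ h.ne']

theorem analyticAt_sqrt {X : Type*} [NormedAddCommGroup X] [NormedSpace ℝ X] {f : X → ℝ} {x : X}
    (hf : AnalyticAt ℝ f x) (hx : 0 < f x) : AnalyticAt ℝ (fun x => √(f x)) x :=
  ((Real.contDiffAt_sqrt (n := ⊤) hx.ne').analyticAt).comp_of_eq hf rfl

theorem analyticAt_unitOf {X : Type*} [NormedAddCommGroup X] [NormedSpace ℝ X] {m : X → Vec}
    {x : X} (hm : AnalyticAt ℝ m x) (hx : m x ≠ 0) : AnalyticAt ℝ (fun x => unitOf (m x)) x :=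
  ((analyticAt_sqrt (analyticAt_dot hm hm) (dot_self_pos hx)).fun_inv
    (Real.sqrt_pos.2 (dot_self_pos hx)).ne').fun_smul hm

/-- Normalization discards the radial term `α m`. The other two terms are linear in `m` and
orthogonal to it, so they survive. -/
theorem hasDerivAt_unitOf {m : ℝ → Vec} {u ω : Vec} {k α β s : ℝ}
    (hm : HasDerivAt m (k • (m s ⨯₃ ω + α • m s + β • (u ⨯₃ m s))) s) (h0 : m s ≠ 0) :
    HasDerivAt (fun s => unitOf (m s)) (k • (unitOf (m s) ⨯₃ ω + β • (u ⨯₃ unitOf (m s)))) s := by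
  have hpos := dot_self_pos h0
  have hsq := Real.sqrt_pos.2 hpos
  have h1 : HasDerivAt (fun s => m s ⬝ᵥ m s) (2 * (k * α * (m s ⬝ᵥ m s))) s := by
    refine (hasDerivAt_dot hm hm).congr_deriv ?_
    rw [dotProduct_comm, ← two_mul]
    congr 1
    rw [dotProduct_smul, dotProduct_add, dotProduct_add, dot_self_cross, dotProduct_smul,
      dotProduct_smul, dot_cross_self]
    simp [mul_assoc]
  have h2 : HasDerivAt (fun s => (√(m s ⬝ᵥ m s))⁻¹) (-(k * α) * (√(m s ⬝ᵥ m s))⁻¹) s := by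
    refine ((h1.sqrt hpos.ne').fun_inv hsq.ne').congr_deriv ?_
    have h3 := Real.sq_sqrt hpos.le
    set N := √(m s ⬝ᵥ m s)
    rw [← h3]
    field_simp
  refine (h2.smul hm).congr_deriv ?_
  simp only [unitOf, LinearMap.smul_apply, map_smul, smul_add, smul_smul, neg_mul, neg_smul]
  rw [show (√(m s ⬝ᵥ m s))⁻¹ * (k * α) = k * α * (√(m s ⬝ᵥ m s))⁻¹ by ring,
    show (√(m s ⬝ᵥ m s))⁻¹ * k = k * (√(m s ⬝ᵥ m s))⁻¹ by ring,
    show (√(m s ⬝ᵥ m s))⁻¹ * (k * β) = k * (β * (√(m s ⬝ᵥ m s))⁻¹) by ring]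
  abel

/-- The vector `u × x` is orthogonal to `u` and is decomposed along the orthogonal vectors `m` and
`u × m`. -/
theorem smul_cross_eq {u m x : Vec} (h : u ⬝ᵥ m = 0) :
    (m ⬝ᵥ m) • (u ⨯₃ x) = (m ⬝ᵥ (u ⨯₃ x)) • m + (x ⬝ᵥ m) • (u ⨯₃ m) := by
  simp only [dotProduct, Fin.sum_univ_three] at h
  ext i
  fin_cases i
  · simp [cross_apply, dotProduct, Fin.sum_univ_three]
    linear_combination (m 1 * x 2 - m 2 * x 1) * h
  · simp [cross_apply, dotProduct, Fin.sum_univ_three]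
    linear_combination (m 2 * x 0 - m 0 * x 2) * h
  · simp [cross_apply, dotProduct, Fin.sum_univ_three]
    linear_combination (m 0 * x 1 - m 1 * x 0) * h

/-- The angular velocity, about the vertical, of the frame carried by a level curve. -/
noncomputable def frameRate (B : Mat) (κ : ℝ) (u : Vec) : ℝ :=
  κ * ((B *ᵥ (u ⨯₃ (B *ᵥ u))) ⬝ᵥ (u ⨯₃ (B *ᵥ u))) *
    ((u ⨯₃ (B *ᵥ u)) ⬝ᵥ (u ⨯₃ (B *ᵥ u)))⁻¹

/-- The frame carried by a level curve. -/
noncomputable def levelFrame (B : Mat) (u : Vec) : Mat := frameOf u (unitOf (u ⨯₃ (B *ᵥ u)))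

theorem vert_levelFrame (B : Mat) (u : Vec) : vert (levelFrame B u) = u := vert_frameOf _ _

theorem dot_unitOf_cross (u v : Vec) : u ⬝ᵥ unitOf (u ⨯₃ v) = 0 := by
  rw [unitOf, dotProduct_smul, dot_self_cross, smul_zero]

theorem levelFrame_mem {B : Mat} {u : Vec} (hu : u ⬝ᵥ u = 1) (h : u ⨯₃ (B *ᵥ u) ≠ 0) :
    levelFrame B u ∈ SO3 :=
  frameOf_mem hu (unitOf_dot_self h) (dot_unitOf_cross _ _)

/-- For `m = u × B u` the derivative is `k (m × ω + κ u × B m)`. By `smul_cross_eq` the second term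
is a radial part, which normalization removes, plus `frameRate` times `u × m`. -/
theorem hasDerivAt_levelFrame {B : Mat} {u : ℝ → Vec} {κ k s : ℝ}
    (hu : HasDerivAt u (k • (u s ⨯₃ (κ • (B *ᵥ u s)))) s) (hun : u s ⬝ᵥ u s = 1)
    (h0 : u s ⨯₃ (B *ᵥ u s) ≠ 0) :
    HasDerivAt (fun s => levelFrame B (u s)) (k • (levelFrame B (u s) * hat (κ • (B *ᵥ u s)) -
      frameRate B κ (u s) • (hat e₃ * levelFrame B (u s)))) s := by
  have hm := hasDerivAt_cross hu (hasDerivAt_const_mulVec B hu)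
  refine hasDerivAt_frameOf hu ?_ hun (dot_unitOf_cross _ _)
  set m := u s ⨯₃ (B *ᵥ u s) with hmdef
  have hpos := dot_self_pos h0
  refine hasDerivAt_unitOf (m := fun s => u s ⨯₃ (B *ᵥ u s))
    (α := κ * (m ⬝ᵥ (u s ⨯₃ (B *ᵥ m))) * (m ⬝ᵥ m)⁻¹) (hm.congr_deriv ?_) h0
  have h1 : u s ⨯₃ (B *ᵥ m) = (m ⬝ᵥ m)⁻¹ • ((m ⬝ᵥ (u s ⨯₃ (B *ᵥ m))) • m +
      ((B *ᵥ m) ⬝ᵥ m) • (u s ⨯₃ m)) := by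
    rw [← smul_cross_eq (dot_self_cross _ _), inv_smul_smul₀ hpos.ne']
  simp only [← hmdef, frameRate, map_smul, mulVec_smul, LinearMap.smul_apply]
  rw [add_assoc, smul_add]
  congr 1
  generalize m ⬝ᵥ (u s ⨯₃ (B *ᵥ m)) = a at h1 ⊢
  rw [h1]
  simp only [smul_add, smul_smul]
  congr 2 <;> ring

theorem vert_rotVertical (y : ℝ) : vert (rotVertical y) = e₃ := rotVertical_transpose_mulVec_e₃ y

theorem analyticAt_levelFactor (ρ : ℝ) {ε : ℝ × ℝ} (hε : ε.1 ≠ 0) :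
    AnalyticAt ℝ (levelFactor ρ) ε := by
  have h1 : AnalyticAt ℝ (fun ε : ℝ × ℝ => ε.1) ε := analyticAt_fst
  have h2 : AnalyticAt ℝ (fun ε : ℝ × ℝ => ε.2) ε := analyticAt_snd
  exact ((h1.fun_pow 2).fun_add (analyticAt_const.fun_mul h2)).fun_div h1 hε

theorem analyticAt_frameRate {X : Type*} [NormedAddCommGroup X] [NormedSpace ℝ X] (B : Mat)
    {κ : X → ℝ} {u : X → Vec} {x : X} (hκ : AnalyticAt ℝ κ x) (hu : AnalyticAt ℝ u x)
    (h0 : u x ⨯₃ (B *ᵥ u x) ≠ 0) : AnalyticAt ℝ (fun x => frameRate B (κ x) (u x)) x := by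
  have hm := analyticAt_cross hu (analyticAt_const_mulVec B hu)
  exact (hκ.fun_mul (analyticAt_dot (analyticAt_const_mulVec B hm) hm)).fun_mul
    ((analyticAt_dot hm hm).fun_inv (dot_self_pos h0).ne')

theorem analyticAt_levelFrame {X : Type*} [NormedAddCommGroup X] [NormedSpace ℝ X] (B : Mat)
    {u : X → Vec} {x : X} (hu : AnalyticAt ℝ u x) (h0 : u x ⨯₃ (B *ᵥ u x) ≠ 0) :
    AnalyticAt ℝ (fun x => levelFrame B (u x)) x :=
  analyticAt_frameOf hu (analyticAt_unitOf (analyticAt_cross hu (analyticAt_const_mulVec B hu)) h0)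

/-- The level curves lift to an analytic family of trajectories of the rotational motion. -/
theorem IsLevelCurve.exists_isTrajectoryFamily {I : Mat} {ρ : ℝ} {B : Mat}
    (hB : IsInertiaInverse I ρ B) {E : Set (ℝ × ℝ)} {V : ℝ × (ℝ × ℝ) → Vec} {k : ℝ × (ℝ × ℝ) → ℝ}
    {U : Set Vec} (hV : IsLevelCurve ρ B E V k U) :
    ∃ G θ K, IsTrajectoryFamily I ρ E G θ K U := by
  have hκ : ∀ z ∈ (Set.univ : Set ℝ) ×ˢ E,
      AnalyticAt ℝ (fun z : ℝ × (ℝ × ℝ) => levelFactor ρ z.2) z := fun z hz =>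
    (analyticAt_levelFactor ρ (hV.moment_ne_zero z.2 hz.2)).comp_of_eq analyticAt_snd rfl
  -- Angles of `rotVertical` are counted in full turns, hence the factor `(2 π)⁻¹`. The integral `Y`
  -- of `g` compensates the turning of the frame.
  let g : ℝ × (ℝ × ℝ) → ℝ := fun z =>
    k z * frameRate B (levelFactor ρ z.2) (V z) * (2 * Real.pi)⁻¹
  have hg : AnalyticOnNhd ℝ g (Set.univ ×ˢ E) := fun z hz =>
    ((hV.analytic_slowness z hz).fun_mul (analyticAt_frameRate B (hκ z hz) (hV.analytic z hz)
      (hV.cross_ne_zero z.1 z.2 hz.2))).fun_mul analyticAt_const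
  have hg1 : ∀ s ε, g (s + 1, ε) = g (s, ε) := fun s ε => by
    simp only [g, hV.add_one, hV.slowness_add_one]
  let Y : ℝ × (ℝ × ℝ) → ℝ := fun z => ∫ s in (0 : ℝ)..z.1, g (s, z.2)
  have hY : AnalyticOnNhd ℝ Y (Set.univ ×ˢ E) := hg.parametric_primitive hV.isOpen_param
  have hYd : ∀ s, ∀ ε ∈ E, HasDerivAt (fun s => Y (s, ε)) (g (s, ε)) s := fun s ε hε =>
    hg.hasDerivAt_parametric_primitive hε s
  have hY1 : ∀ s, ∀ ε ∈ E, Y (s + 1, ε) = Y (s, ε) + Y (1, ε) := fun s ε hε =>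
    intervalIntegral_add_period (hg.continuous_slice hε) (fun s => hg1 s ε) s
  let Γ : ℝ × (ℝ × ℝ) → Mat × Vec := fun z =>
    (rotVertical (Y z) * levelFrame B (V z), levelFactor ρ z.2 • (B *ᵥ V z))
  have hΓ : AnalyticOnNhd ℝ Γ (Set.univ ×ˢ E) := fun z hz =>
    (analyticAt_mul (analyticAt_rotVertical (hY z hz)) (analyticAt_levelFrame B (hV.analytic z hz)
      (hV.cross_ne_zero z.1 z.2 hz.2))).prod
      ((hκ z hz).fun_smul (analyticAt_const_mulVec B (hV.analytic z hz)))
  have hvert : ∀ z, vert (Γ z).1 = V z := fun z => by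
    simp only [Γ, vert_rotVertical_mul, vert_levelFrame]
  have hΓ1 : ∀ s, ∀ ε ∈ E, Γ (s + 1, ε) = (rotVertical (Y (1, ε)) * (Γ (s, ε)).1, (Γ (s, ε)).2) :=
    fun s ε hε => by
      simp only [Γ, hY1 s ε hε, hV.add_one, ← Matrix.mul_assoc, ← rotVertical_add, add_comm]
  have hΓd : ∀ s, ∀ ε ∈ E, HasDerivAt (fun s => Γ (s, ε))
      (k (s, ε) • ((Γ (s, ε)).1 * hat (Γ (s, ε)).2),
        k (s, ε) • (levelFactor ρ ε • (B *ᵥ (V (s, ε) ⨯₃ (Γ (s, ε)).2)))) s := by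
    intro s ε hε
    have h1 := hasDerivAt_levelFrame (hV.velocity s ε hε) (hV.unit s ε hε)
      (hV.cross_ne_zero s ε hε)
    have h2 := hasDerivAt_mul (hasDerivAt_rotVertical (hYd s ε hε)) h1
    have h3 := (hasDerivAt_const_mulVec B (hV.velocity s ε hε)).const_smul (levelFactor ρ ε)
    refine (h2.prodMk h3).congr_deriv (Prod.ext ?_ ?_)
    · have e1 : 2 * Real.pi * g (s, ε) =
          k (s, ε) * frameRate B (levelFactor ρ ε) (V (s, ε)) := by
        simp only [g]
        field_simp
      have e2 : hat e₃ * rotVertical (Y (s, ε)) = rotVertical (Y (s, ε)) * hat e₃ := by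
        rw [hat_e₃_mul (rotVertical_mem _), vert_rotVertical]
      simp only [e1, e2, Γ, Matrix.smul_mul, Matrix.mul_smul, Matrix.mul_sub, smul_sub, mul_smul,
        Matrix.mul_assoc]
      abel
    · simp only [Γ, mulVec_smul]
      rw [smul_comm]
  have hmem : ∀ s, ∀ ε ∈ E, Γ (s, ε) ∈ levelSet I ρ (ε.1 • e₃) ε.2 := by
    intro s ε hε
    have hA : (Γ (s, ε)).1 ∈ SO3 := mul_mem (rotVertical_mem _)
      (levelFrame_mem (hV.unit s ε hε) (hV.cross_ne_zero s ε hε))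
    rw [hB.mem_levelSet_iff (hV.moment_ne_zero ε hε) (hV.denom_pos ε hε) hA, hvert]
    exact ⟨hV.level s ε hε, rfl⟩
  -- The geometric parameter is replaced by a phase proportional to time; a full turn, and hence the
  -- angle `Y (1, ε)`, is unaffected.
  obtain ⟨K, φ, hK, hφ, hK0, hφ1, hφb, hφd⟩ := exists_uniform_phase hV.isOpen_param
    hV.analytic_slowness hV.slowness_add_one hV.slowness_pos
  have hk0 : ∀ s, ∀ ε ∈ E, k (s, ε) ≠ 0 := fun s ε hε h => by
    have := hV.slowness_pos s ε hε
    rw [h, mul_zero] at this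
    exact this.false
  refine ⟨fun z => Γ (φ z, z.2), fun ε => Y (1, ε), K, hV.isOpen_param, hV.isOpen_region, ?_, ?_, hK,
    hK0, fun x ε hε => hmem _ ε hε, ?_, ?_, ?_, ?_, ?_, ?_⟩
  · exact fun z hz => (hΓ (φ z, z.2) ⟨trivial, hz.2⟩).comp_of_eq
      ((hφ z hz).prod analyticAt_snd) rfl
  · exact fun ε hε => (hY (1, ε) ⟨trivial, hε⟩).comp_of_eq (f := fun ε => ((1 : ℝ), ε))
      (analyticAt_const.prod analyticAt_id) rfl
  · intro x ε hε
    simp only [hφ1 ε hε, hΓ1 _ ε hε]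
  · intro x ε hε
    refine ⟨levelFactor ρ ε • (B *ᵥ (V (φ (x, ε), ε) ⨯₃ (Γ (φ (x, ε), ε)).2)), ?_, ?_⟩
    · refine ((hΓd (φ (x, ε)) ε hε).scomp x (hφd ε hε x)).congr_deriv ?_
      rw [Prod.smul_mk, smul_smul, smul_smul, mul_assoc, inv_mul_cancel₀ (hk0 _ ε hε), mul_one]
    · rw [hvert]
      exact hB.dynamicalEq rfl
  · intro ε hε x y hxy
    rw [hvert, hvert] at hxy
    obtain ⟨n, hn⟩ := hV.injective ε hε _ _ hxy
    refine ⟨n, (hφb ε hε).1 ?_⟩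
    simp only
    rw [hn, eq_add_int_of_add_one (X := fun x => φ (x, ε)) (hφ1 ε hε)]
  · intro x ε hε
    rw [hvert]
    exact hV.mem_region _ ε hε
  · intro ε hε z hz hzU
    have hz' := (hB.mem_levelSet_iff (hV.moment_ne_zero ε hε) (hV.denom_pos ε hε) hz.1).1 hz
    obtain ⟨s, hs⟩ := hV.surjective ε hε _ (vert_dot_vert hz.1) hz'.1 hzU
    obtain ⟨x, hx⟩ := (hφb ε hε).2 s
    refine ⟨x, ?_⟩
    simp only at hx
    rw [hvert, hx, hs]
  · intro x ε hε
    rw [hvert]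
    simp only [Γ, map_smul]
    exact smul_ne_zero (div_ne_zero (hV.denom_pos ε hε).ne' (hV.moment_ne_zero ε hε))
      (hV.cross_ne_zero _ ε hε)

/-! ### Explicit parametrization of the level curves -/

/-- The semiaxes of the projection of a level curve along the third principal axis. -/
noncomputable def levelRadius (b : Vec) (i : Fin 3) (c : ℝ) : ℝ := √((b 2 - c) / (b 2 - b i))

/-- The third coordinate, up to its sign, of the points of a level curve. -/
noncomputable def levelHeight (b : Vec) (c s : ℝ) : ℝ :=
  √(1 - (levelRadius b 0 c * Real.cos (2 * Real.pi * s)) ^ 2 -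
    (levelRadius b 1 c * Real.sin (2 * Real.pi * s)) ^ 2)

/-- The parametrization of the level curve `∑ bᵢ vᵢ² = c` of the unit sphere around the third
principal axis. -/
noncomputable def levelPoint (b : Vec) (σ c s : ℝ) : Vec :=
  ![levelRadius b 0 c * Real.cos (2 * Real.pi * s), levelRadius b 1 c * Real.sin (2 * Real.pi * s),
    σ * levelHeight b c s]

/-- The derivative of the time with respect to the parameter of a level curve. -/
noncomputable def levelSlowness (b : Vec) (σ κ c s : ℝ) : ℝ :=
  -(2 * Real.pi * levelRadius b 0 c) /
    (κ * (b 2 - b 1) * levelRadius b 1 c * σ * levelHeight b c s)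

section

variable {b : Vec} {c : ℝ} {i : Fin 3}

theorem sub_mul_sub_pos (h : 0 < (b 2 - c) * (c - b i)) : 0 < (b 2 - c) * (b 2 - b i) := by
  nlinarith [sq_nonneg (b 2 - c)]

theorem sub_ne_zero_of_pos (h : 0 < (b 2 - c) * (c - b i)) : b 2 - b i ≠ 0 := fun h0 => by
  have := sub_mul_sub_pos h
  rw [h0, mul_zero] at this
  exact this.false

theorem level_quotient_pos (h : 0 < (b 2 - c) * (c - b i)) : 0 < (b 2 - c) / (b 2 - b i) := by
  have h1 := sub_mul_sub_pos h
  have h2 := sub_ne_zero_of_pos h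
  have : (b 2 - c) / (b 2 - b i) = (b 2 - c) * (b 2 - b i) / (b 2 - b i) ^ 2 := by
    field_simp
  rw [this]
  positivity

theorem levelRadius_pos (h : 0 < (b 2 - c) * (c - b i)) : 0 < levelRadius b i c :=
  Real.sqrt_pos.2 (level_quotient_pos h)

theorem levelRadius_sq_mul (h : 0 < (b 2 - c) * (c - b i)) :
    levelRadius b i c ^ 2 * (b 2 - b i) = b 2 - c := by
  rw [levelRadius, Real.sq_sqrt (level_quotient_pos h).le, div_mul_cancel₀ _ (sub_ne_zero_of_pos h)]

/-- The sign condition places `c` strictly between `b i` and `b 2`. With both semiaxes below one,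
the projected ellipse stays inside the open unit disc, so the third coordinate never vanishes on the
curve. -/
theorem levelRadius_sq_lt_one (h : 0 < (b 2 - c) * (c - b i)) : levelRadius b i c ^ 2 < 1 := by
  rw [levelRadius, Real.sq_sqrt (level_quotient_pos h).le]
  have h2 := sub_ne_zero_of_pos h
  have h3 : 1 - (b 2 - c) / (b 2 - b i) = ((b 2 - c) * (c - b i) + (c - b i) ^ 2) /
      (b 2 - b i) ^ 2 := by
    field_simp
    ring
  have h4 : 0 < ((b 2 - c) * (c - b i) + (c - b i) ^ 2) / (b 2 - b i) ^ 2 := by positivity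
  linarith

theorem levelHeight_radicand_pos (h₀ : 0 < (b 2 - c) * (c - b 0))
    (h₁ : 0 < (b 2 - c) * (c - b 1)) (s : ℝ) :
    0 < 1 - (levelRadius b 0 c * Real.cos (2 * Real.pi * s)) ^ 2 -
      (levelRadius b 1 c * Real.sin (2 * Real.pi * s)) ^ 2 := by
  have hr0 := levelRadius_sq_lt_one h₀
  have hr1 := levelRadius_sq_lt_one h₁
  have hcs := Real.sin_sq_add_cos_sq (2 * Real.pi * s)
  set C := Real.cos (2 * Real.pi * s)
  set S := Real.sin (2 * Real.pi * s)
  -- The radicand is a convex combination of two positive numbers, with weights `C ^ 2` and `S ^ 2`.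
  have e : 1 - (levelRadius b 0 c * C) ^ 2 - (levelRadius b 1 c * S) ^ 2 =
      (1 - levelRadius b 0 c ^ 2) * C ^ 2 + (1 - levelRadius b 1 c ^ 2) * S ^ 2 := by
    linear_combination (-1 : ℝ) * hcs
  rw [e]
  rcases eq_or_ne C 0 with h | h
  · have : S ^ 2 = 1 := by rw [h] at hcs; linarith
    rw [h, this]
    linarith
  · have h1 : 0 < (1 - levelRadius b 0 c ^ 2) * C ^ 2 := mul_pos (by linarith) (by positivity)
    have h2 : 0 ≤ (1 - levelRadius b 1 c ^ 2) * S ^ 2 := mul_nonneg (by linarith) (sq_nonneg _)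
    linarith

theorem levelHeight_pos (h₀ : 0 < (b 2 - c) * (c - b 0)) (h₁ : 0 < (b 2 - c) * (c - b 1)) (s : ℝ) :
    0 < levelHeight b c s := Real.sqrt_pos.2 (levelHeight_radicand_pos h₀ h₁ s)

theorem levelHeight_sq (h₀ : 0 < (b 2 - c) * (c - b 0)) (h₁ : 0 < (b 2 - c) * (c - b 1)) (s : ℝ) :
    levelHeight b c s ^ 2 = 1 - (levelRadius b 0 c * Real.cos (2 * Real.pi * s)) ^ 2 -
      (levelRadius b 1 c * Real.sin (2 * Real.pi * s)) ^ 2 :=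
  Real.sq_sqrt (levelHeight_radicand_pos h₀ h₁ s).le

theorem levelHeight_add_one (b : Vec) (c s : ℝ) : levelHeight b c (s + 1) = levelHeight b c s := by
  simp only [levelHeight, mul_add, mul_one, Real.cos_add_two_pi, Real.sin_add_two_pi]

theorem levelPoint_dot_self (h₀ : 0 < (b 2 - c) * (c - b 0)) (h₁ : 0 < (b 2 - c) * (c - b 1))
    {σ : ℝ} (hσ : σ ^ 2 = 1) (s : ℝ) : levelPoint b σ c s ⬝ᵥ levelPoint b σ c s = 1 := by
  have h := levelHeight_sq h₀ h₁ s
  simp only [levelPoint, dotProduct, Fin.sum_univ_three, cons_val_zero, cons_val_one, cons_val]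
  linear_combination h + levelHeight b c s ^ 2 * hσ

theorem levelPoint_level (h₀ : 0 < (b 2 - c) * (c - b 0)) (h₁ : 0 < (b 2 - c) * (c - b 1))
    {σ : ℝ} (hσ : σ ^ 2 = 1) (s : ℝ) :
    levelPoint b σ c s ⬝ᵥ (diagonal b *ᵥ levelPoint b σ c s) = c := by
  have h := levelHeight_sq h₀ h₁ s
  have hr0 := levelRadius_sq_mul h₀
  have hr1 := levelRadius_sq_mul h₁
  have hcs := Real.sin_sq_add_cos_sq (2 * Real.pi * s)
  simp only [levelPoint, mulVec_diagonal, dotProduct, Fin.sum_univ_three, cons_val_zero,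
    cons_val_one, cons_val]
  linear_combination b 2 * h + b 2 * levelHeight b c s ^ 2 * hσ -
    Real.cos (2 * Real.pi * s) ^ 2 * hr0 - Real.sin (2 * Real.pi * s) ^ 2 * hr1 - (b 2 - c) * hcs

/-- The first coordinate dictates `levelSlowness`. The other two agree with it because `b 2 - c` is
the common value of `levelRadius b i c ^ 2 * (b 2 - b i)` for `i = 0, 1`. -/
theorem hasDerivAt_levelPoint (h₀ : 0 < (b 2 - c) * (c - b 0)) (h₁ : 0 < (b 2 - c) * (c - b 1))
    {σ κ : ℝ} (hσ : σ ^ 2 = 1) (hκ : κ ≠ 0) (s : ℝ) :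
    HasDerivAt (levelPoint b σ c) (levelSlowness b σ κ c s •
      (levelPoint b σ c s ⨯₃ (κ • (diagonal b *ᵥ levelPoint b σ c s)))) s := by
  have hh := levelHeight_pos h₀ h₁ s
  have hr0 := levelRadius_sq_mul h₀
  have hr1 := levelRadius_sq_mul h₁
  have hp1 := levelRadius_pos h₁
  have hb1 := sub_ne_zero_of_pos h₁
  have hσ0 : σ ≠ 0 := fun h => by rw [h] at hσ; norm_num at hσ
  have hang : HasDerivAt (fun s : ℝ => 2 * Real.pi * s) (2 * Real.pi) s := by
    simpa using (hasDerivAt_id s).const_mul (2 * Real.pi)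
  have hc := hang.cos.const_mul (levelRadius b 0 c)
  have hs := hang.sin.const_mul (levelRadius b 1 c)
  have hheight := (((hc.fun_pow 2).const_sub 1).sub (hs.fun_pow 2)).sqrt
    (levelHeight_radicand_pos h₀ h₁ s).ne'
  have hheight' : HasDerivAt (levelHeight b c) (2 * Real.pi * (levelRadius b 0 c ^ 2 -
      levelRadius b 1 c ^ 2) * Real.cos (2 * Real.pi * s) * Real.sin (2 * Real.pi * s) /
      levelHeight b c s) s := by
    refine hheight.congr_deriv ?_
    change _ / (2 * levelHeight b c s) = _
    field_simp
    norm_num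
    ring
  rw [hasDerivAt_pi]
  intro i
  fin_cases i
  · refine hc.congr_deriv ?_
    simp only [levelPoint, levelSlowness, mulVec_diagonal, cross_apply, Pi.smul_apply, smul_eq_mul,
      Fin.zero_eta, cons_val_zero, cons_val_one, cons_val]
    field_simp
  · refine hs.congr_deriv ?_
    simp only [levelPoint, levelSlowness, mulVec_diagonal, cross_apply, Pi.smul_apply, smul_eq_mul,
      Fin.mk_one, cons_val_zero, cons_val_one, cons_val]
    field_simp
    linear_combination Real.cos (2 * Real.pi * s) * (hr1 - hr0)
  · refine (hheight'.const_mul σ).congr_deriv ?_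
    simp only [levelPoint, levelSlowness, mulVec_diagonal, cross_apply, Pi.smul_apply, smul_eq_mul,
      Fin.reduceFinMk, cons_val_zero, cons_val_one, cons_val]
    field_simp
    rw [hσ]
    linear_combination Real.cos (2 * Real.pi * s) * Real.sin (2 * Real.pi * s) * (hr0 - hr1)

theorem levelPoint_injective (h₀ : 0 < (b 2 - c) * (c - b 0)) (h₁ : 0 < (b 2 - c) * (c - b 1))
    {σ s t : ℝ} (h : levelPoint b σ c s = levelPoint b σ c t) : ∃ n : ℤ, s = t + n := by
  have hc : Real.cos (2 * Real.pi * s) = Real.cos (2 * Real.pi * t) :=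
    mul_left_cancel₀ (levelRadius_pos h₀).ne' (congrFun h 0)
  have hs : Real.sin (2 * Real.pi * s) = Real.sin (2 * Real.pi * t) :=
    mul_left_cancel₀ (levelRadius_pos h₁).ne' (congrFun h 1)
  exact rotVertical_eq_iff.1 (by rw [rotVertical, rotVertical, hc, hs])

/-- Subtracting the level equation from `b 2` times the sphere equation puts `(v 0, v 1)` on the
ellipse, whence the angle. The sphere equation gives `v 2` up to a sign, and `σ` selects the oval.
-/
theorem exists_eq_levelPoint (h₀ : 0 < (b 2 - c) * (c - b 0)) (h₁ : 0 < (b 2 - c) * (c - b 1))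
    {σ : ℝ} (hσ : σ ^ 2 = 1) {v : Vec} (hv : v ⬝ᵥ v = 1) (hvc : v ⬝ᵥ (diagonal b *ᵥ v) = c)
    (hpos : 0 < σ * v 2) : ∃ s, v = levelPoint b σ c s := by
  have hr0 := levelRadius_sq_mul h₀
  have hr1 := levelRadius_sq_mul h₁
  have hp0 := levelRadius_pos h₀
  have hp1 := levelRadius_pos h₁
  simp only [mulVec_diagonal, dotProduct, Fin.sum_univ_three] at hv hvc
  have hne : b 2 - c ≠ 0 := fun h => by simp [h] at h₀
  have hell : (v 0 / levelRadius b 0 c) ^ 2 + (v 1 / levelRadius b 1 c) ^ 2 = 1 := by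
    have e0 : (v 0 / levelRadius b 0 c) ^ 2 = v 0 ^ 2 * (b 2 - b 0) / (b 2 - c) := by
      rw [← hr0]
      have := sub_ne_zero_of_pos h₀
      field_simp
    have e1 : (v 1 / levelRadius b 1 c) ^ 2 = v 1 ^ 2 * (b 2 - b 1) / (b 2 - c) := by
      rw [← hr1]
      have := sub_ne_zero_of_pos h₁
      field_simp
    rw [e0, e1, ← add_div, div_eq_one_iff_eq hne]
    linear_combination b 2 * hv - hvc
  obtain ⟨φ, hφc, hφs⟩ := exists_eq_cos_sin hell
  have hφ : 2 * Real.pi * (φ / (2 * Real.pi)) = φ := by field_simp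
  have hv0 : v 0 = levelRadius b 0 c * Real.cos φ := by rw [← hφc]; field_simp
  have hv1 : v 1 = levelRadius b 1 c * Real.sin φ := by rw [← hφs]; field_simp
  refine ⟨φ / (2 * Real.pi), ?_⟩
  have hh : σ * v 2 = levelHeight b c (φ / (2 * Real.pi)) := by
    refine (Real.sqrt_eq_iff_mul_self_eq (levelHeight_radicand_pos h₀ h₁ _).le hpos.le).2 ?_ |>.symm
    rw [hφ, ← hv0, ← hv1]
    linear_combination -hv - v 2 ^ 2 * hσ
  ext i
  fin_cases i
  · simpa [levelPoint, hφ] using hv0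
  · simpa [levelPoint, hφ] using hv1
  · simp only [levelPoint, Fin.reduceFinMk, cons_val]
    rw [← hh]
    linear_combination (-v 2) * hσ

theorem levelPoint_cross_ne_zero (h₀ : 0 < (b 2 - c) * (c - b 0))
    (h₁ : 0 < (b 2 - c) * (c - b 1)) {σ : ℝ} (hσ : σ ^ 2 = 1) (s : ℝ) :
    levelPoint b σ c s ⨯₃ (diagonal b *ᵥ levelPoint b σ c s) ≠ 0 := by
  intro h
  have hh := levelHeight_pos h₀ h₁ s
  have hσ0 : σ ≠ 0 := fun h => by rw [h] at hσ; norm_num at hσ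
  have hp0 := levelRadius_pos h₀
  have hp1 := levelRadius_pos h₁
  have hb0 := sub_ne_zero_of_pos h₀
  have hb1 := sub_ne_zero_of_pos h₁
  have c0 := congrFun h 0
  have c1 := congrFun h 1
  simp only [levelPoint, mulVec_diagonal, cross_apply, cons_val_zero, cons_val_one, cons_val,
    Pi.zero_apply] at c0 c1
  have e0 : (b 2 - b 1) * levelRadius b 1 c * σ * levelHeight b c s *
      Real.sin (2 * Real.pi * s) = 0 := by linear_combination c0
  have e1 : (b 2 - b 0) * levelRadius b 0 c * σ * levelHeight b c s *
      Real.cos (2 * Real.pi * s) = 0 := by linear_combination -c1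
  have hs : Real.sin (2 * Real.pi * s) = 0 := (mul_eq_zero.1 e0).resolve_left (by positivity)
  have hc : Real.cos (2 * Real.pi * s) = 0 := (mul_eq_zero.1 e1).resolve_left (by positivity)
  have := Real.sin_sq_add_cos_sq (2 * Real.pi * s)
  rw [hs, hc] at this
  norm_num at this

theorem levelSlowness_mul_pos (h₀ : 0 < (b 2 - c) * (c - b 0))
    (h₁ : 0 < (b 2 - c) * (c - b 1)) {σ κ : ℝ} (hσ : σ ^ 2 = 1) (hκ : κ ≠ 0) (s t : ℝ) :
    0 < levelSlowness b σ κ c s * levelSlowness b σ κ c t := by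
  have hs := levelHeight_pos h₀ h₁ s
  have ht := levelHeight_pos h₀ h₁ t
  have hσ0 : σ ≠ 0 := fun h => by rw [h] at hσ; norm_num at hσ
  have hp0 := levelRadius_pos h₀
  have hp1 := levelRadius_pos h₁
  have hb1 := sub_ne_zero_of_pos h₁
  have e : levelSlowness b σ κ c s * levelSlowness b σ κ c t = (2 * Real.pi * levelRadius b 0 c) ^ 2 /
      ((κ * (b 2 - b 1) * levelRadius b 1 c * σ) ^ 2 * (levelHeight b c s * levelHeight b c t)) := by
    simp only [levelSlowness]
    field_simp
  rw [e]
  have := Real.pi_pos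
  positivity

end

/-- The parameters for which the level set of the quadratic form with eigenvalues `b` consists of
curves around the third principal axis. -/
def levelParam (ρ : ℝ) (b : Vec) : Set (ℝ × ℝ) :=
  {ε | ε.1 ≠ 0 ∧ 0 < ε.1 ^ 2 + 2 * ρ * ε.2 ∧ 0 < (b 2 * (ε.1 ^ 2 + 2 * ρ * ε.2) - 2 * ε.2) *
    (2 * ε.2 - b 0 * (ε.1 ^ 2 + 2 * ρ * ε.2)) ∧ 0 < (b 2 * (ε.1 ^ 2 + 2 * ρ * ε.2) - 2 * ε.2) *
    (2 * ε.2 - b 1 * (ε.1 ^ 2 + 2 * ρ * ε.2))}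

/-- Clearing denominators in `levelParam` makes its openness evident; the two forms differ by the
square of the positive denominator of `levelValue`. -/
theorem mem_levelParam_iff {ρ : ℝ} {b : Vec} {ε : ℝ × ℝ} :
    ε ∈ levelParam ρ b ↔ ε.1 ≠ 0 ∧ 0 < ε.1 ^ 2 + 2 * ρ * ε.2 ∧
      0 < (b 2 - levelValue ρ ε) * (levelValue ρ ε - b 0) ∧
      0 < (b 2 - levelValue ρ ε) * (levelValue ρ ε - b 1) := by
  refine and_congr_right fun _ => and_congr_right fun hD => ?_
  have h : ∀ i, (b 2 * (ε.1 ^ 2 + 2 * ρ * ε.2) - 2 * ε.2) *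
      (2 * ε.2 - b i * (ε.1 ^ 2 + 2 * ρ * ε.2)) =
      (ε.1 ^ 2 + 2 * ρ * ε.2) ^ 2 * ((b 2 - levelValue ρ ε) * (levelValue ρ ε - b i)) := fun i => by
    rw [levelValue]
    field_simp
  have hD2 : 0 < (ε.1 ^ 2 + 2 * ρ * ε.2) ^ 2 := pow_pos hD 2
  rw [h, h, mul_pos_iff_of_pos_left hD2, mul_pos_iff_of_pos_left hD2]

theorem isOpen_levelParam (ρ : ℝ) (b : Vec) : IsOpen (levelParam ρ b) := by
  have h1 : Continuous fun ε : ℝ × ℝ => ε.1 := continuous_fst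
  have h2 : Continuous fun ε : ℝ × ℝ => ε.2 := continuous_snd
  have hD : Continuous fun ε : ℝ × ℝ => ε.1 ^ 2 + 2 * ρ * ε.2 := by fun_prop
  have hQ : ∀ i, Continuous fun ε : ℝ × ℝ => (b 2 * (ε.1 ^ 2 + 2 * ρ * ε.2) - 2 * ε.2) *
      (2 * ε.2 - b i * (ε.1 ^ 2 + 2 * ρ * ε.2)) := fun i => by fun_prop
  exact (isOpen_ne_fun h1 continuous_const).inter ((isOpen_lt continuous_const hD).inter
    ((isOpen_lt continuous_const (hQ 0)).inter (isOpen_lt continuous_const (hQ 1))))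

section

variable {X : Type*} [NormedAddCommGroup X] [NormedSpace ℝ X] {b : Vec} {x : X}

theorem analyticAt_levelValue {ρ : ℝ} {ε : ℝ × ℝ} (hD : 0 < ε.1 ^ 2 + 2 * ρ * ε.2) :
    AnalyticAt ℝ (levelValue ρ) ε := by
  have h1 : AnalyticAt ℝ (fun ε : ℝ × ℝ => ε.1) ε := analyticAt_fst
  have h2 : AnalyticAt ℝ (fun ε : ℝ × ℝ => ε.2) ε := analyticAt_snd
  exact (analyticAt_const.fun_mul h2).fun_div
    ((h1.fun_pow 2).fun_add (analyticAt_const.fun_mul h2)) hD.ne'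

theorem analyticAt_levelRadius {i : Fin 3} {c : X → ℝ} (hc : AnalyticAt ℝ c x)
    (h : 0 < (b 2 - c x) * (c x - b i)) : AnalyticAt ℝ (fun x => levelRadius b i (c x)) x :=
  analyticAt_sqrt ((analyticAt_const.fun_sub hc).fun_div analyticAt_const (sub_ne_zero_of_pos h))
    (level_quotient_pos h)

theorem analyticAt_cos_two_pi_mul {s : X → ℝ} (hs : AnalyticAt ℝ s x) :
    AnalyticAt ℝ (fun x => Real.cos (2 * Real.pi * s x)) x :=
  Real.analyticAt_cos.comp_of_eq (analyticAt_const.fun_mul hs) rfl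

theorem analyticAt_sin_two_pi_mul {s : X → ℝ} (hs : AnalyticAt ℝ s x) :
    AnalyticAt ℝ (fun x => Real.sin (2 * Real.pi * s x)) x :=
  Real.analyticAt_sin.comp_of_eq (analyticAt_const.fun_mul hs) rfl

theorem analyticAt_levelHeight {c s : X → ℝ} (hc : AnalyticAt ℝ c x) (hs : AnalyticAt ℝ s x)
    (h₀ : 0 < (b 2 - c x) * (c x - b 0)) (h₁ : 0 < (b 2 - c x) * (c x - b 1)) :
    AnalyticAt ℝ (fun x => levelHeight b (c x) (s x)) x :=
  analyticAt_sqrt ((analyticAt_const.fun_sub (((analyticAt_levelRadius hc h₀).fun_mul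
    (analyticAt_cos_two_pi_mul hs)).fun_pow 2)).fun_sub (((analyticAt_levelRadius hc h₁).fun_mul
    (analyticAt_sin_two_pi_mul hs)).fun_pow 2)) (levelHeight_radicand_pos h₀ h₁ _)

theorem analyticAt_levelPoint (σ : ℝ) {c s : X → ℝ} (hc : AnalyticAt ℝ c x) (hs : AnalyticAt ℝ s x)
    (h₀ : 0 < (b 2 - c x) * (c x - b 0)) (h₁ : 0 < (b 2 - c x) * (c x - b 1)) :
    AnalyticAt ℝ (fun x => levelPoint b σ (c x) (s x)) x := by
  refine AnalyticAt.pi (f := fun i x => levelPoint b σ (c x) (s x) i) fun i => ?_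
  fin_cases i
  · exact (analyticAt_levelRadius hc h₀).fun_mul (analyticAt_cos_two_pi_mul hs)
  · exact (analyticAt_levelRadius hc h₁).fun_mul (analyticAt_sin_two_pi_mul hs)
  · exact analyticAt_const.fun_mul (analyticAt_levelHeight hc hs h₀ h₁)

theorem analyticAt_levelSlowness {σ : ℝ} (hσ : σ ≠ 0) {κ c s : X → ℝ} (hκ : AnalyticAt ℝ κ x)
    (hκ0 : κ x ≠ 0) (hc : AnalyticAt ℝ c x) (hs : AnalyticAt ℝ s x)
    (h₀ : 0 < (b 2 - c x) * (c x - b 0)) (h₁ : 0 < (b 2 - c x) * (c x - b 1)) :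
    AnalyticAt ℝ (fun x => levelSlowness b σ (κ x) (c x) (s x)) x := by
  refine ((analyticAt_const.fun_mul (analyticAt_levelRadius hc h₀)).fun_neg).fun_div
    ((((hκ.fun_mul analyticAt_const).fun_mul (analyticAt_levelRadius hc h₁)).fun_mul
      analyticAt_const).fun_mul (analyticAt_levelHeight hc hs h₀ h₁)) ?_
  have := sub_ne_zero_of_pos h₁
  have := levelRadius_pos h₁
  have := levelHeight_pos h₀ h₁ (s x)
  positivity

end

theorem conj_mulVec_mulVec {F : Mat} (hF : F ∈ SO3) (S : Mat) (v : Vec) :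
    (F * S * Fᵀ) *ᵥ (F *ᵥ v) = F *ᵥ (S *ᵥ v) := by
  rw [← mulVec_mulVec, ← mulVec_mulVec, transpose_mulVec_mulVec hF]

/-- The level curves of a quadratic form around its third principal axis. -/
theorem isLevelCurve {ρ : ℝ} {b : Vec} {F : Mat} (hF : F ∈ SO3) {σ : ℝ} (hσ : σ ^ 2 = 1) :
    IsLevelCurve ρ (F * diagonal b * Fᵀ) (levelParam ρ b)
      (fun z => F *ᵥ levelPoint b σ (levelValue ρ z.2) z.1)
      (fun z => levelSlowness b σ (levelFactor ρ z.2) (levelValue ρ z.2) z.1)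
      {u | 0 < σ * (Fᵀ *ᵥ u) 2} := by
  have hσ0 : σ ≠ 0 := fun h => by rw [h] at hσ; norm_num at hσ
  have hM := fun (ε : ℝ × ℝ) (hε : ε ∈ levelParam ρ b) => mem_levelParam_iff.1 hε
  have hκ : ∀ ε ∈ levelParam ρ b, levelFactor ρ ε ≠ 0 := fun ε hε =>
    div_ne_zero hε.2.1.ne' hε.1
  have hval : ∀ z ∈ (Set.univ : Set ℝ) ×ˢ levelParam ρ b,
      AnalyticAt ℝ (fun z : ℝ × (ℝ × ℝ) => levelValue ρ z.2) z := fun z hz =>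
    (analyticAt_levelValue hz.2.2.1).comp_of_eq analyticAt_snd rfl
  refine ⟨isOpen_levelParam ρ b, ?_, fun ε hε => hε.1, fun ε hε => hε.2.1, ?_, ?_, ?_, ?_, ?_, ?_, ?_,
    ?_, ?_, ?_, ?_, ?_⟩
  · refine isOpen_lt continuous_const (continuous_const.mul ?_)
    exact (continuous_apply 2).comp (Continuous.matrix_mulVec continuous_const continuous_id)
  · intro z hz
    exact analyticAt_const_mulVec F (analyticAt_levelPoint σ (hval z hz) analyticAt_fst
      (hM z.2 hz.2).2.2.1 (hM z.2 hz.2).2.2.2)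
  · intro z hz
    exact analyticAt_levelSlowness hσ0 ((analyticAt_levelFactor ρ hz.2.1).comp_of_eq
      analyticAt_snd rfl) (hκ z.2 hz.2) (hval z hz) analyticAt_fst
      (hM z.2 hz.2).2.2.1 (hM z.2 hz.2).2.2.2
  · intro s ε
    simp only [levelPoint, levelHeight_add_one, mul_add, mul_one, Real.cos_add_two_pi,
      Real.sin_add_two_pi]
  · intro s ε
    simp only [levelSlowness, levelHeight_add_one]
  · exact fun s ε hε => levelSlowness_mul_pos (hM ε hε).2.2.1 (hM ε hε).2.2.2 hσ (hκ ε hε) 0 s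
  · intro s ε hε
    rw [dot_mulVec_mulVec hF]
    exact levelPoint_dot_self (hM ε hε).2.2.1 (hM ε hε).2.2.2 hσ s
  · intro s ε hε
    simp only
    rw [conj_mulVec_mulVec hF, dot_mulVec_mulVec hF]
    exact levelPoint_level (hM ε hε).2.2.1 (hM ε hε).2.2.2 hσ s
  · intro s ε hε
    refine (hasDerivAt_const_mulVec F (hasDerivAt_levelPoint (hM ε hε).2.2.1 (hM ε hε).2.2.2 hσ
      (hκ ε hε) s)).congr_deriv ?_
    simp only
    rw [conj_mulVec_mulVec hF, mulVec_smul, mulVec_cross hF, mulVec_smul]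
  · intro ε hε s t hst
    refine levelPoint_injective (σ := σ) (hM ε hε).2.2.1 (hM ε hε).2.2.2 ?_
    simpa only [transpose_mulVec_mulVec hF] using congrArg (Fᵀ *ᵥ ·) hst
  · intro s ε hε
    simp only [Set.mem_ofPred_eq]
    rw [transpose_mulVec_mulVec hF]
    change 0 < σ * (σ * levelHeight b (levelValue ρ ε) s)
    rw [← mul_assoc, ← sq, hσ, one_mul]
    exact levelHeight_pos (hM ε hε).2.2.1 (hM ε hε).2.2.2 s
  · intro ε hε u hu huc hpos
    have e := mulVec_transpose_mulVec hF u
    obtain ⟨s, hs⟩ := exists_eq_levelPoint (v := Fᵀ *ᵥ u) (hM ε hε).2.2.1 (hM ε hε).2.2.2 hσ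
      (by rw [dot_mulVec_mulVec (transpose_mem hF), hu])
      (by rw [← huc, ← dot_mulVec_mulVec hF, ← conj_mulVec_mulVec hF (diagonal b), e]) hpos
    exact ⟨s, by rw [← hs, e]⟩
  · intro s ε hε h
    simp only at h
    rw [conj_mulVec_mulVec hF, ← mulVec_cross hF] at h
    refine levelPoint_cross_ne_zero (hM ε hε).2.2.1 (hM ε hε).2.2.2 hσ s ?_
    simpa only [transpose_mulVec_mulVec hF, mulVec_zero] using congrArg (Fᵀ *ᵥ ·) h

/-! ### Consequences of regularity of the energy -/

/-- The derivative of a real function does not refer to the norm of `𝔸`. This allows a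
submultiplicative norm to be used for the entries of the exponential, while `Mat` carries the
entrywise sup norm. -/
theorem hasDerivAt_linear_exp_smul {𝔸 : Type*} [NormedRing 𝔸] [NormedAlgebra ℝ 𝔸]
    [FiniteDimensional ℝ 𝔸] (ℓ : 𝔸 →ₗ[ℝ] ℝ) (M : 𝔸) :
    HasDerivAt (fun s : ℝ => ℓ (NormedSpace.exp (s • M))) (ℓ M) 0 := by
  have : CompleteSpace 𝔸 := FiniteDimensional.complete ℝ 𝔸
  have h : HasDerivAt (fun s : ℝ => NormedSpace.exp (s • M)) M (0 : ℝ) := by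
    simpa using hasDerivAt_exp_smul_const (𝕂 := ℝ) M 0
  exact ((LinearMap.toContinuousLinearMap ℓ).hasFDerivAt
    (x := NormedSpace.exp ((0 : ℝ) • M))).comp_hasDerivAt (0 : ℝ) h

theorem hasDerivAt_exp_smul (M : Mat) :
    HasDerivAt (fun s : ℝ => NormedSpace.exp (s • M)) M 0 := by
  rw [hasDerivAt_mat_iff]
  intro i j
  exact @hasDerivAt_linear_exp_smul Mat Matrix.linftyOpNormedRing Matrix.linftyOpNormedAlgebra
    inferInstance (Matrix.entryLinearMap ℝ ℝ i j) M

theorem exp_transpose_mul_exp {M : Mat} (hM : Mᵀ = -M) :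
    (NormedSpace.exp M)ᵀ * NormedSpace.exp M = 1 := by
  rw [← Matrix.exp_transpose, hM, Matrix.exp_neg, Matrix.nonsing_inv_mul _
    ((Matrix.isUnit_iff_isUnit_det _).1 (Matrix.isUnit_exp M))]

section

variable {I : Mat} {ρ : ℝ} {B : Mat}

theorem IsInertiaInverse.inertiaAt_mulVec_omegaOf (hB : IsInertiaInverse I ρ B) {A : Mat}
    (hu : vert A ⬝ᵥ vert A = 1) (j : ℝ) :
    inertiaAt I ρ (vert A) *ᵥ omegaOf I ρ (j • e₃) A = j • vert A := by
  -- The matrix inverse in `omegaOf` is a true inverse: moment zero forces `ω = 0`.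
  have hdet : IsUnit (inertiaAt I ρ (vert A)).det := by
    rw [isUnit_iff_ne_zero]
    intro h
    obtain ⟨ω, hω, h0⟩ := Matrix.exists_mulVec_eq_zero_iff.2 h
    refine hω ?_
    have := (hB.inertiaAt_mulVec_eq_iff hu 0).1 (by rw [h0, zero_smul])
    rw [this, zero_div, zero_smul]
  rw [omegaOf, Matrix.mulVec_mulVec, Matrix.mul_nonsing_inv _ hdet, one_mulVec, mulVec_smul]
  rfl

theorem IsInertiaInverse.energyOn_eq (hB : IsInertiaInverse I ρ B) {A : Mat}
    (hu : vert A ⬝ᵥ vert A = 1) (j : ℝ) : energyOn I ρ (j • e₃) A =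
      1 / 2 * j ^ 2 * (vert A ⬝ᵥ (B *ᵥ vert A)) / (1 - ρ * (vert A ⬝ᵥ (B *ᵥ vert A))) :=
  hB.energy_eq hu (hB.inertiaAt_mulVec_omegaOf hu j)

theorem IsInertiaInverse.energyOn_of_mem (hB : IsInertiaInverse I ρ B) {j T : ℝ} {z : Mat × Vec}
    (hz : z ∈ levelSet I ρ (j • e₃) T) : energyOn I ρ (j • e₃) z.1 = T := by
  have hu := vert_dot_vert hz.1
  rw [hB.energyOn_eq hu, ← hB.energy_eq hu ((moment_eq_iff hz.1).1 hz.2.1), hz.2.2]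

theorem vert_mul_exp_dot {A : Mat} (hA : A ∈ SO3) (ν : Vec) (s : ℝ) :
    vert (A * NormedSpace.exp (s • hat ν)) ⬝ᵥ vert (A * NormedSpace.exp (s • hat ν)) = 1 := by
  have hM : (s • hat ν)ᵀ = -(s • hat ν) := by rw [transpose_smul, hat_transpose, smul_neg]
  have h := mul_eq_one_comm.1 (exp_transpose_mul_exp hM)
  rw [vert, mulVec_dot, mulVec_mulVec, transpose_transpose, transpose_mul, Matrix.mul_assoc,
    ← Matrix.mul_assoc (NormedSpace.exp _), h, Matrix.one_mul, mul_transpose_of_mem hA, one_mulVec,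
    e₃_dot_e₃]

/-- For `j = 0` the function `T_j` vanishes identically, so every point is critical. -/
theorem IsInertiaInverse.moment_ne_zero (hB : IsInertiaInverse I ρ B) {j T : ℝ}
    (hT : IsRegularValue I ρ (j • e₃) T) {z : Mat × Vec} (hz : z ∈ levelSet I ρ (j • e₃) T) :
    j ≠ 0 := by
  rintro rfl
  obtain ⟨ν, hν⟩ := hT z.1 hz.1 (hB.energyOn_of_mem hz)
  refine hν ?_
  have : (fun s : ℝ => energyOn I ρ ((0 : ℝ) • e₃) (z.1 * NormedSpace.exp (s • hat ν))) =
      fun _ => 0 := funext fun s => by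
    rw [hB.energyOn_eq (vert_mul_exp_dot hz.1 ν s)]
    simp
  rw [this, deriv_const]

/-- At a regular energy the vertical is not a principal direction. -/
theorem IsInertiaInverse.mulVec_ne_smul (hB : IsInertiaInverse I ρ B) {j T : ℝ}
    (hT : IsRegularValue I ρ (j • e₃) T) {A : Mat} (hA : A ∈ SO3)
    (hAT : energyOn I ρ (j • e₃) A = T) (c : ℝ) : B *ᵥ vert A ≠ c • vert A := by
  intro hc
  obtain ⟨ν, hν⟩ := hT A hA hAT
  refine hν ?_
  have h1 : HasDerivAt (fun s : ℝ => A * NormedSpace.exp (s • hat ν)) (A * hat ν) 0 :=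
    (hasDerivAt_mul (hasDerivAt_const 0 A) (hasDerivAt_exp_smul (hat ν))).congr_deriv (by simp)
  have h2 := hasDerivAt_vert h1
  have h3 := hasDerivAt_dot h2 (hasDerivAt_const_mulVec B h2)
  have h4 := (h3.const_mul (1 / 2 * j ^ 2)).fun_div ((h3.const_mul ρ).const_sub 1)
    (sub_pos.2 (hB.lt_one _ (vert_mul_exp_dot hA ν 0))).ne'
  have h5 : (fun s : ℝ => energyOn I ρ (j • e₃) (A * NormedSpace.exp (s • hat ν))) = _ :=
    funext fun s => hB.energyOn_eq (vert_mul_exp_dot hA ν s) j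
  rw [h5, h4.deriv]
  -- The variation of `u` is orthogonal to `u`, hence to `B u = c u`; so `⟨u, B u⟩`, and with it
  -- `T_j`, is stationary.
  have h6 : vert (A * hat ν) ⬝ᵥ (B *ᵥ vert A) = 0 := by
    rw [hc, vert_mul_hat, dotProduct_smul, dotProduct_comm, dot_self_cross, smul_zero]
  have h7 : vert A ⬝ᵥ (B *ᵥ vert (A * hat ν)) = 0 := by
    rw [← hB.dot_comm, dotProduct_comm, h6]
  have e : vert (A * NormedSpace.exp ((0 : ℝ) • hat ν)) = vert A := by simp
  rw [e, h6, h7]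
  simp

end

/-! ### Principal axes -/

theorem exists_conj_diagonal {I : Mat} (hI : I.PosDef) :
    ∃ F ∈ SO3, ∃ d : Vec, (∀ i, 0 < d i) ∧ I = F * diagonal d * Fᵀ := by
  have hH := hI.isHermitian
  set W : Mat := (hH.eigenvectorUnitary : Mat) with hW
  have hs : I = W * diagonal hH.eigenvalues * Wᵀ := by
    have := hH.spectral_theorem
    rwa [Unitary.conjStarAlgAut_apply, star_eq_conjTranspose, conjTranspose_eq_transpose_of_trivial] at this
  have hu : Wᵀ * W = 1 := by
    have := Unitary.coe_star_mul_self hH.eigenvectorUnitary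
    rwa [star_eq_conjTranspose, conjTranspose_eq_transpose_of_trivial] at this
  have hdet : W.det * W.det = 1 := by
    have := congrArg det hu
    rwa [det_mul, det_transpose, det_one] at this
  rcases mul_self_eq_one_iff.1 hdet with h | h
  · exact ⟨W, ⟨hu, h⟩, _, hI.eigenvalues_pos, hs⟩
  -- In dimension three `-W` has the opposite determinant, and it gives the same conjugation.
  · refine ⟨-W, ⟨by simpa using hu, by simp [det_neg, h]; norm_num⟩, _, hI.eigenvalues_pos, by simpa using hs⟩

theorem dot_conj_diagonal_mulVec {F : Mat} (b u : Vec) :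
    u ⬝ᵥ ((F * diagonal b * Fᵀ) *ᵥ u) = b 0 * (Fᵀ *ᵥ u) 0 ^ 2 + b 1 * (Fᵀ *ᵥ u) 1 ^ 2 +
      b 2 * (Fᵀ *ᵥ u) 2 ^ 2 := by
  rw [Matrix.mul_assoc, ← mulVec_mulVec, ← mulVec_mulVec, ← transpose_transpose F, ← mulVec_dot,
    transpose_transpose]
  simp only [mulVec_diagonal, dotProduct, Fin.sum_univ_three]
  ring

theorem transpose_mulVec_sq {F : Mat} (hF : F ∈ SO3) {u : Vec} (hu : u ⬝ᵥ u = 1) :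
    (Fᵀ *ᵥ u) 0 ^ 2 + (Fᵀ *ᵥ u) 1 ^ 2 + (Fᵀ *ᵥ u) 2 ^ 2 = 1 := by
  rw [← hu, ← dot_mulVec_mulVec (transpose_mem hF)]
  simp only [dotProduct, Fin.sum_univ_three, sq]

theorem exists_isInertiaInverse {I : Mat} (hI : I.PosDef) {ρ : ℝ} (hρ : 0 < ρ) :
    ∃ F ∈ SO3, ∃ b : Vec, IsInertiaInverse I ρ (F * diagonal b * Fᵀ) := by
  obtain ⟨F, hF, d, hd, rfl⟩ := exists_conj_diagonal hI
  refine ⟨F, hF, fun i => (d i + ρ)⁻¹, ?_, ?_, ?_⟩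
  · have h1 : F * diagonal d * Fᵀ + ρ • (1 : Mat) = F * diagonal (fun i => d i + ρ) * Fᵀ := by
      have : diagonal (fun i => d i + ρ) = diagonal d + ρ • (1 : Mat) := by
        rw [← diagonal_one, ← diagonal_smul, diagonal_add]
        congr 1
        ext i
        simp
      rw [this, Matrix.mul_add, Matrix.add_mul, Matrix.mul_smul, Matrix.smul_mul, Matrix.mul_one,
        mul_transpose_of_mem hF]
    have h2 : diagonal (fun i => d i + ρ) * diagonal (fun i => (d i + ρ)⁻¹) = 1 := by
      rw [diagonal_mul_diagonal, ← diagonal_one]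
      congr 1
      ext i
      exact mul_inv_cancel₀ (add_pos (hd i) hρ).ne'
    rw [h1]
    calc F * diagonal (fun i => d i + ρ) * Fᵀ * (F * diagonal (fun i => (d i + ρ)⁻¹) * Fᵀ)
        = F * (diagonal (fun i => d i + ρ) * (Fᵀ * F) * diagonal (fun i => (d i + ρ)⁻¹)) * Fᵀ := by
          simp only [Matrix.mul_assoc]
      _ = 1 := by rw [hF.1, Matrix.mul_one, h2, Matrix.mul_one, mul_transpose_of_mem hF]
  · simp [transpose_mul, Matrix.mul_assoc]
  · intro u hu
    -- The eigenvalues of `ρ B` are below one because those of `I` are positive.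
    have hlt : ∀ i, ρ * (d i + ρ)⁻¹ < 1 := fun i => by
      rw [← div_eq_mul_inv, div_lt_one (add_pos (hd i) hρ)]
      linarith [hd i]
    have h := transpose_mulVec_sq hF hu
    rw [dot_conj_diagonal_mulVec]
    set v := Fᵀ *ᵥ u
    have hle : ∀ i, ρ * (d i + ρ)⁻¹ * v i ^ 2 ≤ v i ^ 2 := fun i =>
      mul_le_of_le_one_left (sq_nonneg _) (hlt i).le
    have hlt' : ∀ i, v i ≠ 0 → ρ * (d i + ρ)⁻¹ * v i ^ 2 < v i ^ 2 := fun i hi =>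
      mul_lt_of_lt_one_left (by positivity) (hlt i)
    have hne : v 0 ≠ 0 ∨ v 1 ≠ 0 ∨ v 2 ≠ 0 := by
      by_contra! hc
      rw [hc.1, hc.2.1, hc.2.2] at h
      norm_num at h
    have := hle 0
    have := hle 1
    have := hle 2
    rcases hne with hi | hi | hi <;> have := hlt' _ hi <;> linarith

/-- The cyclic permutation of the coordinate axes. -/
def cyclic : Mat := !![0, 0, 1; 1, 0, 0; 0, 1, 0]

theorem cyclic_mem : cyclic ∈ SO3 := by
  refine ⟨?_, by simp [cyclic, det_fin_three]⟩
  ext i j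
  fin_cases i <;> fin_cases j <;> simp [cyclic, Matrix.mul_apply, Fin.sum_univ_three]

/-- Cyclic permutations have determinant one, so any axis can be made the third one within `SO(3)`.
-/
theorem conj_cyclic (F : Mat) (b : Vec) :
    F * cyclic * diagonal ![b 1, b 2, b 0] * (F * cyclic)ᵀ = F * diagonal b * Fᵀ := by
  have h : cyclic * diagonal ![b 1, b 2, b 0] * cyclicᵀ = diagonal b := by
    ext i j
    fin_cases i <;> fin_cases j <;>
      simp [cyclic, Matrix.mul_apply, diagonal, vecHead, vecTail]
  rw [← h, transpose_mul]
  simp only [Matrix.mul_assoc]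

section

variable {I : Mat} {ρ : ℝ} {B : Mat}

/-- At a regular energy the level value is not an eigenvalue. -/
theorem IsInertiaInverse.ne_levelValue (hB : IsInertiaInverse I ρ B) {j T : ℝ}
    (hT : IsRegularValue I ρ (j • e₃) T) {z : Mat × Vec} (hz : z ∈ levelSet I ρ (j • e₃) T)
    {F : Mat} (hF : F ∈ SO3) {b : Vec} (hFB : B = F * diagonal b * Fᵀ) :
    b 2 ≠ vert z.1 ⬝ᵥ (B *ᵥ vert z.1) := by
  intro hb
  have he : diagonal b *ᵥ e₃ = b 2 • e₃ := by
    ext i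
    fin_cases i <;> simp [mulVec_diagonal, e₃]
  have hv : vert Fᵀ = F *ᵥ e₃ := by rw [vert, transpose_transpose]
  have hBF : B *ᵥ vert Fᵀ = b 2 • vert Fᵀ := by
    rw [hv, hFB, conj_mulVec_mulVec hF, he, mulVec_smul]
  have hu := vert_dot_vert (transpose_mem hF)
  -- If `b 2` were the level value, the principal direction itself would lie on the energy level,
  -- and it is critical there.
  refine hB.mulVec_ne_smul hT (transpose_mem hF) ?_ (b 2) hBF
  rw [← hB.energyOn_of_mem hz, hB.energyOn_eq (vert_dot_vert hz.1), hB.energyOn_eq hu, hBF,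
    dotProduct_smul, hu, smul_eq_mul, mul_one, hb]

/-- At a regular energy the level set of the quadratic form winds around a principal axis. -/
theorem IsInertiaInverse.exists_axis (hB : IsInertiaInverse I ρ B) {j T : ℝ}
    (hT : IsRegularValue I ρ (j • e₃) T) {z : Mat × Vec} (hz : z ∈ levelSet I ρ (j • e₃) T)
    {F : Mat} (hF : F ∈ SO3) {b : Vec} (hFB : B = F * diagonal b * Fᵀ) :
    ∃ F' ∈ SO3, ∃ b' : Vec, B = F' * diagonal b' * F'ᵀ ∧
      0 < (b' 2 - vert z.1 ⬝ᵥ (B *ᵥ vert z.1)) * (vert z.1 ⬝ᵥ (B *ᵥ vert z.1) - b' 0) ∧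
      0 < (b' 2 - vert z.1 ⬝ᵥ (B *ᵥ vert z.1)) * (vert z.1 ⬝ᵥ (B *ᵥ vert z.1) - b' 1) := by
  have hF1 := mul_mem hF cyclic_mem
  have hF2 := mul_mem hF1 cyclic_mem
  have hB1 : B = F * cyclic * diagonal ![b 1, b 2, b 0] * (F * cyclic)ᵀ := by rw [conj_cyclic, hFB]
  have hB2 : B = F * cyclic * cyclic * diagonal ![b 2, b 0, b 1] * (F * cyclic * cyclic)ᵀ := by
    rw [hB1, ← conj_cyclic (F * cyclic)]
    rfl
  have hn2 := hB.ne_levelValue hT hz hF hFB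
  have hn0 : b 0 ≠ _ := hB.ne_levelValue hT hz hF1 hB1
  have hn1 : b 1 ≠ _ := hB.ne_levelValue hT hz hF2 hB2
  have hc := dot_conj_diagonal_mulVec (F := F) b (vert z.1)
  have hv := transpose_mulVec_sq hF (vert_dot_vert hz.1)
  rw [← hFB] at hc
  set c := vert z.1 ⬝ᵥ (B *ᵥ vert z.1)
  set v := Fᵀ *ᵥ vert z.1
  -- The number `c` is a mean of the eigenvalues, so they do not all lie on the same side of it. One
  -- of the three is then alone on its side, and its axis becomes the third.
  have key : (b 0 - c) * v 0 ^ 2 + (b 1 - c) * v 1 ^ 2 + (b 2 - c) * v 2 ^ 2 = 0 := by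
    linear_combination -hc - c * hv
  have p : ∀ {x y : ℝ}, x < c → c < y → 0 < (x - c) * (c - y) ∧ 0 < (y - c) * (c - x) :=
    fun hx hy => ⟨mul_pos_of_neg_of_neg (by linarith) (by linarith),
      mul_pos (by linarith) (by linarith)⟩
  have hne : v 0 ≠ 0 ∨ v 1 ≠ 0 ∨ v 2 ≠ 0 := by
    by_contra! h
    rw [h.1, h.2.1, h.2.2] at hv
    norm_num at hv
  rcases hn0.lt_or_gt with h0 | h0 <;> rcases hn1.lt_or_gt with h1 | h1 <;>
    rcases hn2.lt_or_gt with h2 | h2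
  · exfalso
    have p0 := mul_nonneg (sub_pos.2 h0).le (sq_nonneg (v 0))
    have p1 := mul_nonneg (sub_pos.2 h1).le (sq_nonneg (v 1))
    have p2 := mul_nonneg (sub_pos.2 h2).le (sq_nonneg (v 2))
    rcases hne with h | h | h
    · have := mul_pos (sub_pos.2 h0) (pow_pos (abs_pos.2 h) 2); rw [sq_abs] at this; linarith
    · have := mul_pos (sub_pos.2 h1) (pow_pos (abs_pos.2 h) 2); rw [sq_abs] at this; linarith
    · have := mul_pos (sub_pos.2 h2) (pow_pos (abs_pos.2 h) 2); rw [sq_abs] at this; linarith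
  · exact ⟨F, hF, b, hFB, (p h0 h2).2, (p h1 h2).2⟩
  · exact ⟨_, hF2, _, hB2, (p h2 h1).2, (p h0 h1).2⟩
  · exact ⟨_, hF1, _, hB1, (p h0 h1).1, (p h0 h2).1⟩
  · exact ⟨_, hF1, _, hB1, (p h1 h0).2, (p h2 h0).2⟩
  · exact ⟨_, hF2, _, hB2, (p h1 h2).1, (p h1 h0).1⟩
  · exact ⟨F, hF, b, hFB, (p h2 h0).1, (p h2 h1).1⟩
  · exfalso
    have p0 := mul_nonneg (sub_pos.2 h0).le (sq_nonneg (v 0))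
    have p1 := mul_nonneg (sub_pos.2 h1).le (sq_nonneg (v 1))
    have p2 := mul_nonneg (sub_pos.2 h2).le (sq_nonneg (v 2))
    rcases hne with h | h | h
    · have := mul_pos (sub_pos.2 h0) (pow_pos (abs_pos.2 h) 2); rw [sq_abs] at this; linarith
    · have := mul_pos (sub_pos.2 h1) (pow_pos (abs_pos.2 h) 2); rw [sq_abs] at this; linarith
    · have := mul_pos (sub_pos.2 h2) (pow_pos (abs_pos.2 h) 2); rw [sq_abs] at this; linarith

/-- Near each point of a regular level set the rotational motion is organized by an analytic family
of trajectories. -/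
theorem exists_isTrajectoryFamily (hI : I.PosDef) (hρ : 0 < ρ) {j T : ℝ}
    (hT : IsRegularValue I ρ (j • e₃) T) {z : Mat × Vec} (hz : z ∈ levelSet I ρ (j • e₃) T) :
    ∃ B, IsInertiaInverse I ρ B ∧ ∃ E G θ K U, IsTrajectoryFamily I ρ E G θ K U ∧
      (j, T) ∈ E ∧ vert z.1 ∈ U := by
  obtain ⟨F₀, hF₀, b₀, hB⟩ := exists_isInertiaInverse hI hρ
  obtain ⟨F, hF, b, hFB, h0, h1⟩ := hB.exists_axis hT hz hF₀ rfl
  have hj := hB.moment_ne_zero hT hz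
  have hD := hB.pos_of_mem_levelSet (ε := (j, T)) hj hz
  have hc := ((hB.mem_levelSet_iff (ε := (j, T)) hj hD hz.1).1 hz).1
  rw [hFB] at hB hc h0 h1
  have hv := transpose_mulVec_sq hF (vert_dot_vert hz.1)
  have hq := dot_conj_diagonal_mulVec (F := F) b (vert z.1)
  rw [hc] at h0 h1 hq
  -- In the plane orthogonal to the third axis, a combination of `v 0 ^ 2` and `v 1 ^ 2` with
  -- positive coefficients would vanish.
  have hv2 : (Fᵀ *ᵥ vert z.1) 2 ≠ 0 := by
    intro h
    rw [h] at hv hq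
    set v := Fᵀ *ᵥ vert z.1
    set c := levelValue ρ (j, T)
    have key : ((b 2 - c) * (c - b 0)) * v 0 ^ 2 + ((b 2 - c) * (c - b 1)) * v 1 ^ 2 = 0 := by
      linear_combination (b 2 - c) * hq + (b 2 - c) * c * hv
    have p0 := mul_nonneg h0.le (sq_nonneg (v 0))
    have p1 := mul_nonneg h1.le (sq_nonneg (v 1))
    have z0 : v 0 ^ 2 = 0 := (mul_eq_zero.1 (by linarith : _ * v 0 ^ 2 = 0)).resolve_left h0.ne'
    have z1 : v 1 ^ 2 = 0 := (mul_eq_zero.1 (by linarith : _ * v 1 ^ 2 = 0)).resolve_left h1.ne'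
    rw [z0, z1] at hv
    norm_num at hv
  have hE : (j, T) ∈ levelParam ρ b := mem_levelParam_iff.2 ⟨hj, hD, h0, h1⟩
  obtain ⟨σ, hσ, hpos⟩ : ∃ σ : ℝ, σ ^ 2 = 1 ∧ 0 < σ * (Fᵀ *ᵥ vert z.1) 2 := by
    rcases hv2.lt_or_gt with h | h
    · exact ⟨-1, by norm_num, by linarith⟩
    · exact ⟨1, by norm_num, by linarith⟩
  obtain ⟨G, θ, K, h⟩ := (isLevelCurve (ρ := ρ) (b := b) hF hσ).exists_isTrajectoryFamily hB
  exact ⟨_, hB, _, G, θ, K, _, h, hE, hpos⟩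

end

/-! ### Periods, boundedness and the three statements -/

theorem IsMinimalPeriod.unique {X : Type*} {f : ℝ → X} {P Q : ℝ} (hP : IsMinimalPeriod f P)
    (hQ : IsMinimalPeriod f Q) : P = Q := by
  rcases lt_trichotomy P Q with h | h | h
  · exact absurd hP.2.1 (hQ.2.2 P hP.1 h)
  · exact h
  · exact absurd hQ.2.1 (hP.2.2 Q hQ.1 h)

theorem periodic_abs {X : Type*} {f : ℝ → X} {P : ℝ} (h : Function.Periodic f P) :
    Function.Periodic f |P| := by
  rcases abs_choice P with hP | hP <;> rw [hP]
  · exact h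
  · exact h.neg

section

variable {I : Mat} {ρ : ℝ} {B : Mat} {E : Set (ℝ × ℝ)} {G : ℝ × (ℝ × ℝ) → Mat × Vec}
  {θ K : ℝ × ℝ → ℝ} {U : Set Vec}

theorem reduce_rotTorus_line (x : Fin 2 → ℝ) (ε : ℝ × ℝ) (t : ℝ) :
    reduce (rotTorus G θ (x + t • torusFrequency θ K ε, ε)) =
      reduce (G (x 1 + t * (K ε)⁻¹, ε)) := by
  rw [IsTrajectoryFamily.rotTorus_line, reduce, reduce, vert_rotVertical_mul]

/-- The trajectories are periodic modulo rotations about the vertical axis. -/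
theorem IsTrajectoryFamily.isMinimalPeriod (h : IsTrajectoryFamily I ρ E G θ K U) (x : Fin 2 → ℝ)
    {ε : ℝ × ℝ} (hε : ε ∈ E) :
    IsMinimalPeriod (fun t : ℝ => reduce (rotTorus G θ (x + t • torusFrequency θ K ε, ε)))
      |K ε| := by
  have hK := h.period_ne_zero ε hε
  simp only [reduce_rotTorus_line]
  refine ⟨abs_pos.2 hK, periodic_abs fun t => ?_, fun Q hQ hQK hper => ?_⟩
  · have : x 1 + (t + K ε) * (K ε)⁻¹ = x 1 + t * (K ε)⁻¹ + 1 := by field_simp; ring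
    rw [this, h.add_one _ ε hε, reduce, reduce, vert_rotVertical_mul]
  -- A period returns `u`, so it shifts the phase by an integer `n` and equals `n * K ε`. Being
  -- positive and less than `|K ε|` is then impossible.
  · have h1 := congrArg Prod.fst (hper 0)
    obtain ⟨n, hn⟩ := h.injective ε hε _ _ h1
    have h2 : Q = n * K ε := by
      field_simp at hn
      linarith
    have h3 : |(n : ℝ)| * |K ε| < 1 * |K ε| := by
      rw [← abs_mul, ← h2, one_mul, abs_of_pos hQ]
      exact hQK
    have h4 : |(n : ℝ)| < 1 := lt_of_mul_lt_mul_right h3 (abs_nonneg _)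
    have h5 : |n| < 1 := by exact_mod_cast h4
    rw [Int.abs_lt_one_iff.1 h5] at h2
    simp at h2
    exact hQ.ne' h2

/-- At a resonance the trajectories are periodic. -/
theorem IsTrajectoryFamily.periodic (h : IsTrajectoryFamily I ρ E G θ K U) (x : Fin 2 → ℝ)
    {ε : ℝ × ℝ} (hε : ε ∈ E) (hθ : Real.cos (2 * Real.pi * θ ε) = 1) :
    Function.Periodic (fun t : ℝ => rotTorus G θ (x + t • torusFrequency θ K ε, ε)) |K ε| := by
  have hK := h.period_ne_zero ε hε
  obtain ⟨n, hn⟩ := (Real.cos_eq_one_iff _).1 hθ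
  have hn' : θ ε = n := by
    have := Real.pi_pos
    field_simp at hn
    linarith
  refine periodic_abs fun t => ?_
  have : x 1 + (t + K ε) * (K ε)⁻¹ = x 1 + t * (K ε)⁻¹ + 1 := by field_simp; ring
  simp only [rotTorus_line]
  rw [this, h.add_one _ ε hε, rotVertical_eq_one_iff.2 ⟨n, hn'⟩, Matrix.one_mul]

/-- The contact point stays bounded along the tori. -/
theorem IsContactFamily.isBounded {r : ℝ} {σ : ℝ × (ℝ × ℝ) → Plane}
    (hσ : IsContactFamily r E G θ K σ) (h : IsTrajectoryFamily I ρ E G θ K U)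
    {ε : ℝ × ℝ} (hε : ε ∈ E) (c : Plane) :
    Bornology.IsBounded
      (Set.range fun x : Fin 2 → ℝ => (translates (fullTorus G θ σ) (x, ε, c)).2.2) := by
  have hcont : Continuous fun x : Fin 2 → ℝ => (translates (fullTorus G θ σ) (x, ε, c)).2.2 := by
    have h1 : Continuous fun x : Fin 2 → ℝ => fullTorus G θ σ (x, ε) :=
      continuous_iff_continuousAt.2 fun x =>
        ((hσ.analytic_fullTorus h (x, ε) ⟨trivial, hε⟩).continuousAt).comp_of_eq
          (by fun_prop) rfl
    have h2 : Continuous fun x : Fin 2 → ℝ => fullTorus G θ σ (x, ε) + (0, 0, c) :=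
      h1.add continuous_const
    exact continuous_snd.comp (continuous_snd.comp h2)
  -- The position is invariant under integer shifts of the phases, so the compact unit square gives
  -- all values.
  refine ((isCompact_Icc (a := (0 : Fin 2 → ℝ)) (b := 1)).image hcont).isBounded.subset ?_
  rintro _ ⟨x, rfl⟩
  refine ⟨fun i => Int.fract (x i), ⟨fun i => Int.fract_nonneg _, fun i => (Int.fract_lt_one _).le⟩,
    ?_⟩
  simp only [translates_eq]
  congr 1
  exact (hσ.rotPlane_eq hε ⟨fun i => ⌊x i⌋, fun i => (Int.fract_add_floor (x i)).symm⟩).symm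

theorem IsTrajectoryFamily.eq_rotTorus (hB : IsInertiaInverse I ρ B)
    (h : IsTrajectoryFamily I ρ E G θ K U) {ε : ℝ × ℝ} (hε : ε ∈ E) {γ : ℝ → Mat × Vec}
    (hγ : IsRotSolution I ρ γ) {x : Fin 2 → ℝ} (hx : rotTorus G θ (x, ε) = γ 0) (t : ℝ) :
    γ t = rotTorus G θ (x + t • torusFrequency θ K ε, ε) := by
  have hz := h.rotTorus_mem_levelSet x hε
  rw [hx] at hz
  exact congrFun (hB.isRotSolution_unique hγ (h.isRotSolution x hε) hz.2.1 (by simp [hx])) t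

end

/-- The reduced motion on a regular level set with vertical moment is periodic. -/
theorem exists_isMinimalPeriod_of_isReducedSolution {I : Mat} (hI : I.PosDef) {m r : ℝ} (hρ : 0 < m * r ^ 2) {j₃ T : ℝ}
    (hT : IsRegularValue I (m * r ^ 2) (j₃ • e₃) T) :
    ∀ γ : ℝ → Vec × Vec,
      IsReducedSolution I (m * r ^ 2) γ →
      γ 0 ∈ reduce ''
        levelSet I (m * r ^ 2) (j₃ • e₃) T →
      ∃ P, IsMinimalPeriod γ P := by
  rintro γ hγ ⟨z, hz, hz0⟩
  obtain ⟨B, hB, E, G, θ, K, U, h, hE, hU⟩ := exists_isTrajectoryFamily hI hρ hT hz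
  obtain ⟨x, hx⟩ := h.exists_rotTorus_eq hB hE hz hU
  have hu := (moment_eq_iff hz.1).1 hz.2.1
  have hγx := hB.isReducedSolution_unique hγ (h.isRotSolution x hE).reduce (j := j₃)
    (by rw [← hz0]; exact hu) (by simp [← hz0, hx])
  exact ⟨|K (j₃, T)|, hγx ▸ h.isMinimalPeriod x hE⟩

/-- The rotational motion on a regular level set with vertical moment is quasiperiodic. -/
theorem exists_isQuasiperiodicFamily_rot {I : Mat} (hI : I.PosDef) {m r : ℝ} (hρ : 0 < m * r ^ 2) {j₃ T : ℝ}
    (hT : IsRegularValue I (m * r ^ 2) (j₃ • e₃) T) :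
    ∀ z₀ ∈ levelSet I (m * r ^ 2) (j₃ • e₃) T,
      ∃ (E : Set (ℝ × ℝ))
        (Φ : (Fin 2 → ℝ) × (ℝ × ℝ) → Mat × Vec)
        (ν : ℝ × ℝ → Fin 2 → ℝ) (x₀ : Fin 2 → ℝ),
        IsQuasiperiodicFamily (verticalRot I (m * r ^ 2))
          (IsRotSolution I (m * r ^ 2)) E Φ ν ∧
        (∀ x, ∀ ε ∈ E, Φ (x, ε) ∈
          levelSet I (m * r ^ 2) (ε.1 • e₃) ε.2) ∧
        (j₃, T) ∈ E ∧ Φ (x₀, (j₃, T)) = z₀ ∧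
        ∀ γ : ℝ → Mat × Vec,
          IsRotSolution I (m * r ^ 2) γ → γ 0 = z₀ →
          ∀ t, γ t = Φ (x₀ + t • ν (j₃, T), (j₃, T)) := by
  intro z hz
  obtain ⟨B, hB, E, G, θ, K, U, h, hE, hU⟩ := exists_isTrajectoryFamily hI hρ hT hz
  obtain ⟨x, hx⟩ := h.exists_rotTorus_eq hB hE hz hU
  exact ⟨E, rotTorus G θ, torusFrequency θ K, x, h.isQuasiperiodicFamily_rot hB,
    fun x ε hε => h.rotTorus_mem_levelSet x hε, hE, hx,
    fun γ hγ hγ0 => h.eq_rotTorus hB hE hγ (hx.trans hγ0.symm)⟩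

/-- The full motion on a regular level set with vertical moment is quasiperiodic or drifts. -/
theorem full_motion {I : Mat} (hI : I.PosDef) {m r : ℝ} (hρ : 0 < m * r ^ 2) {j₃ T : ℝ}
    (hT : IsRegularValue I (m * r ^ 2) (j₃ • e₃) T) :
    ∀ γ : ℝ → Mat × Vec × Plane,
      IsFullSolution I m r γ →
      ((γ 0).1, (γ 0).2.1) ∈
        levelSet I (m * r ^ 2) (j₃ • e₃) T →
      ∀ P, IsMinimalPeriod
          (fun t => reduce ((γ t).1, (γ t).2.1)) P →
        (¬ Function.Periodic (fun t => ((γ t).1, (γ t).2.1)) P →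
          (∃ (E : Set (ℝ × ℝ))
            (Φ : (Fin 2 → ℝ) × (ℝ × ℝ) →
              Mat × Vec × Plane)
            (ν : ℝ × ℝ → Fin 2 → ℝ) (x₀ : Fin 2 → ℝ) (c₀ : Plane),
            IsQuasiperiodicFamily (verticalFull I (m * r ^ 2))
              (IsFullSolution I m r) (E ×ˢ Set.univ)
              (translates Φ) (fun δ => ν δ.1) ∧
            (∀ x, ∀ ε ∈ E, ((Φ (x, ε)).1, (Φ (x, ε)).2.1) ∈
              levelSet I (m * r ^ 2) (ε.1 • e₃) ε.2) ∧
            (j₃, T) ∈ E ∧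
            ∀ t, γ t = translates Φ
              (x₀ + t • ν (j₃, T), ((j₃, T), c₀))) ∧
          Bornology.IsBounded (Set.range (fun t => (γ t).2.2))) ∧
        (Function.Periodic (fun t => ((γ t).1, (γ t).2.1)) P →
          ∃ (w : Plane) (q : ℝ → Plane),
            Function.Periodic q P ∧ ∀ t, (γ t).2.2 = t • w + q t) := by
  intro γ hγ hz P hP
  refine ⟨fun hnper => ?_, hγ.exists_drift hP.1.ne'⟩
  obtain ⟨B, hB, E, G, θ, K, U, h, hE, hU⟩ := exists_isTrajectoryFamily hI hρ hT hz
  obtain ⟨y, hy⟩ := h.exists_rotTorus_eq hB hE hz hU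
  have hγy := funext (h.eq_rotTorus hB hE hγ.isRotSolution hy)
  have hP' : P = |K (j₃, T)| := by
    refine hP.unique ?_
    have := h.isMinimalPeriod y hE
    have e := congrArg (fun f => fun t : ℝ => reduce (f t)) hγy
    exact e ▸ this
  -- At an integer `θ` the twist is trivial and the rotational motion would have the reduced period
  -- `|K (j₃, T)|`.
  have hθ : Real.cos (2 * Real.pi * θ (j₃, T)) ≠ 1 := fun hθ =>
    hnper (by rw [hγy, hP']; exact h.periodic y hE hθ)
  -- Non-resonance is an open condition; the parameters are restricted to it so that the contact
  -- point can be centred for all of them.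
  let E' : Set (ℝ × ℝ) := E ∩ (fun ε => Real.cos (2 * Real.pi * θ ε)) ⁻¹' {1}ᶜ
  have hE'o : IsOpen E' := by
    refine ContinuousOn.isOpen_inter_preimage ?_ h.isOpen_param isOpen_compl_singleton
    exact Real.continuous_cos.comp_continuousOn
      (continuousOn_const.mul h.analytic_angle.continuousOn)
  have hE' : (j₃, T) ∈ E' := ⟨hE, hθ⟩
  have h' := h.mono hE'o Set.inter_subset_left
  obtain ⟨σ, hσ⟩ := h'.exists_isContactFamily r fun ε hε => hε.2
  obtain ⟨x, c, hxc⟩ := h'.exists_translates_eq (σ := σ) hB hE' (z := γ 0) hz hU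
  have hsol := hσ.isFullSolution h' x (ε := ((j₃, T), c)) hE'
  have hγx := congrFun (hB.isFullSolution_unique hγ hsol hz.2.1 (by simp [hxc]))
  refine ⟨⟨E', fullTorus G θ σ, torusFrequency θ K, x, c, hσ.isQuasiperiodicFamily_full hB h',
    fun x ε hε => h'.rotTorus_mem_levelSet x hε, hE', hγx⟩, ?_⟩
  refine (hσ.isBounded h' hE' c).subset ?_
  rintro _ ⟨t, rfl⟩
  exact ⟨x + t • torusFrequency θ K (j₃, T), by simp only [hγx t]⟩

end ChaplyginSphere

theorem mainTheorem10
    (I : ChaplyginSphere.Mat) (hI : I.PosDef) (m r : ℝ) (hm : 0 < m) (hr : 0 < r)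
    (j₃ T : ℝ)
    (hT : ChaplyginSphere.IsRegularValue I (m * r ^ 2) (j₃ • ChaplyginSphere.e₃) T) :
    -- every solution of the reduced system on the level set is periodic
    (∀ γ : ℝ → ChaplyginSphere.Vec × ChaplyginSphere.Vec,
      ChaplyginSphere.IsReducedSolution I (m * r ^ 2) γ →
      γ 0 ∈ ChaplyginSphere.reduce ''
        ChaplyginSphere.levelSet I (m * r ^ 2) (j₃ • ChaplyginSphere.e₃) T →
      ∃ P, ChaplyginSphere.IsMinimalPeriod γ P) ∧
    -- the rotational motion is quasiperiodic on 2-tori depending analytically on `j` and `T`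
    (∀ z₀ ∈ ChaplyginSphere.levelSet I (m * r ^ 2) (j₃ • ChaplyginSphere.e₃) T,
      ∃ (E : Set (ℝ × ℝ))
        (Φ : (Fin 2 → ℝ) × (ℝ × ℝ) → ChaplyginSphere.Mat × ChaplyginSphere.Vec)
        (ν : ℝ × ℝ → Fin 2 → ℝ) (x₀ : Fin 2 → ℝ),
        ChaplyginSphere.IsQuasiperiodicFamily (ChaplyginSphere.verticalRot I (m * r ^ 2))
          (ChaplyginSphere.IsRotSolution I (m * r ^ 2)) E Φ ν ∧
        (∀ x, ∀ ε ∈ E, Φ (x, ε) ∈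
          ChaplyginSphere.levelSet I (m * r ^ 2) (ε.1 • ChaplyginSphere.e₃) ε.2) ∧
        (j₃, T) ∈ E ∧ Φ (x₀, (j₃, T)) = z₀ ∧
        ∀ γ : ℝ → ChaplyginSphere.Mat × ChaplyginSphere.Vec,
          ChaplyginSphere.IsRotSolution I (m * r ^ 2) γ → γ 0 = z₀ →
          ∀ t, γ t = Φ (x₀ + t • ν (j₃, T), (j₃, T))) ∧
    -- the full motion, where `P` is the minimal period of the reduced motion
    (∀ γ : ℝ → ChaplyginSphere.Mat × ChaplyginSphere.Vec × ChaplyginSphere.Plane,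
      ChaplyginSphere.IsFullSolution I m r γ →
      ((γ 0).1, (γ 0).2.1) ∈
        ChaplyginSphere.levelSet I (m * r ^ 2) (j₃ • ChaplyginSphere.e₃) T →
      ∀ P, ChaplyginSphere.IsMinimalPeriod
          (fun t => ChaplyginSphere.reduce ((γ t).1, (γ t).2.1)) P →
        (¬ Function.Periodic (fun t => ((γ t).1, (γ t).2.1)) P →
          (∃ (E : Set (ℝ × ℝ))
            (Φ : (Fin 2 → ℝ) × (ℝ × ℝ) →
              ChaplyginSphere.Mat × ChaplyginSphere.Vec × ChaplyginSphere.Plane)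
            (ν : ℝ × ℝ → Fin 2 → ℝ) (x₀ : Fin 2 → ℝ) (c₀ : ChaplyginSphere.Plane),
            ChaplyginSphere.IsQuasiperiodicFamily (ChaplyginSphere.verticalFull I (m * r ^ 2))
              (ChaplyginSphere.IsFullSolution I m r) (E ×ˢ Set.univ)
              (ChaplyginSphere.translates Φ) (fun δ => ν δ.1) ∧
            (∀ x, ∀ ε ∈ E, ((Φ (x, ε)).1, (Φ (x, ε)).2.1) ∈
              ChaplyginSphere.levelSet I (m * r ^ 2) (ε.1 • ChaplyginSphere.e₃) ε.2) ∧
            (j₃, T) ∈ E ∧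
            ∀ t, γ t = ChaplyginSphere.translates Φ
              (x₀ + t • ν (j₃, T), ((j₃, T), c₀))) ∧
          Bornology.IsBounded (Set.range (fun t => (γ t).2.2))) ∧
        (Function.Periodic (fun t => ((γ t).1, (γ t).2.1)) P →
          ∃ (w : ChaplyginSphere.Plane) (q : ℝ → ChaplyginSphere.Plane),
            Function.Periodic q P ∧ ∀ t, (γ t).2.2 = t • w + q t)) := by
  have hρ : 0 < m * r ^ 2 := by positivity
  exact ⟨ChaplyginSphere.exists_isMinimalPeriod_of_isReducedSolution hI hρ hT,
    ChaplyginSphere.exists_isQuasiperiodicFamily_rot hI hρ hT, ChaplyginSphere.full_motion hI hρ hT⟩
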